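/- Let \(G\) be a connected, simply connected, solvable complex Lie group with Lie algebra \(\mathfrak g\), let \(G_0\subset G\) be a connected (automatically simply connected) real Lie subgroup with Lie algebra \(\mathfrak g_0\) such that \(\mathfrak g_0+i\mathfrak g_0=\mathfrak g\), and let \(\Gamma\subset G_0\) be a discrete subgroup with \(G_0/\Gamma\) compact; such a triple \((\Gamma,G_0,G)\) is called a CR-solvmanifold (CRS). Put \(X=G/\Gamma\) (a complex manifold), \(Y=G_0/\Gamma\subset X\), and \(\mathfrak m=\mathfrak g_0\cap i\mathfrak g_0\). The CRS is called Kähler if the complex manifold \(X\) admits a Kähler form, and locally Kähler if some open neighbourhood of \(Y\) in \(X\) admits a Kähler form. Suppose that \((\Gamma,G_0,G)\) is a CRS and that \(G\) is nilpotent. Then the following three conditions are equivalent: 1) \((\Gamma,G_0,G)\) is locally Kähler. 2) \((\Gamma,G_0,G)\) is Kähler. 3) There is a direct sum decomposition of Lie algebras \(\mathfrak g_0=\mathfrak a_0\oplus\mathfrak m\) (both summands being ideals of \(\mathfrak g_0\)), where \(\mathfrak m\) is abelian and \(\mathfrak a_0\cap i\mathfrak a_0=0\). -/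

import Mathlib

open scoped Manifold ContDiff

noncomputable section

section Kahler

variable {E : Type*} [NormedAddCommGroup E] [NormedSpace ℂ E]
  {M : Type*} [TopologicalSpace M] [ChartedSpace E M]

/-- The almost complex structure of a complex manifold `M` modelled on `E`: multiplication by `i` on
each (real) tangent space, which is a copy of `E` through the preferred holomorphic chart. -/
def complexStructure (x : M) :
    TangentSpace 𝓘(ℝ, E) x →L[ℝ] TangentSpace 𝓘(ℝ, E) x :=
  ((Complex.I • ContinuousLinearMap.id ℂ E).restrictScalars ℝ : E →L[ℝ] E)

/-- The expression in a chart `e` of a real differential 2-form on `M`, that is, its pullback under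
the inverse of the chart (meaningful on the target of `e`). -/
def formInChart (η : ∀ x : M, TangentSpace 𝓘(ℝ, E) x [⋀^Fin 2]→L[ℝ] ℝ)
    (e : OpenPartialHomeomorph M E) (y : E) : E [⋀^Fin 2]→L[ℝ] ℝ :=
  (η (e.symm y)).compContinuousLinearMap
    (mfderiv 𝓘(ℝ, E) 𝓘(ℝ, E) (e.symm : E → M) y : E →L[ℝ] TangentSpace 𝓘(ℝ, E) (e.symm y))

/-- `η` restricts to a Kähler form on the open subset `U` of the complex manifold `M`: a smooth closed
real 2-form of type (1,1) that is positive. -/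
structure IsKahlerFormOn [IsManifold 𝓘(ℂ, E) ω M]
    (η : ∀ x : M, TangentSpace 𝓘(ℝ, E) x [⋀^Fin 2]→L[ℝ] ℝ) (U : Set M) : Prop where
  smooth : ∀ e ∈ atlas E M, ContDiffOn ℝ ∞ (formInChart η e) (e.target ∩ e.symm ⁻¹' U)
  closed : ∀ e ∈ atlas E M, ∀ y ∈ e.target ∩ e.symm ⁻¹' U, extDeriv (formInChart η e) y = 0
  invariant : ∀ x ∈ U, ∀ v w : TangentSpace 𝓘(ℝ, E) x,
    η x ![complexStructure x v, complexStructure x w] = η x ![v, w]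
  positive : ∀ x ∈ U, ∀ v : TangentSpace 𝓘(ℝ, E) x, v ≠ 0 → 0 < η x ![v, complexStructure x v]

/-- The open subset `U` of the complex manifold `M` is Kähler: it carries a Kähler form. -/
def IsKahlerOpen [IsManifold 𝓘(ℂ, E) ω M] (U : Set M) : Prop :=
  ∃ η : ∀ x : M, TangentSpace 𝓘(ℝ, E) x [⋀^Fin 2]→L[ℝ] ℝ, IsKahlerFormOn η U

end Kahler

section Quotient

variable {E : Type*} [NormedAddCommGroup E] [NormedSpace ℂ E]
  {G : Type*} [TopologicalSpace G] [ChartedSpace E G] [Group G] [LieGroup 𝓘(ℂ, E) ω G]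

theorem isLocalHomeomorph_quotientMk (E : Type*) [NormedAddCommGroup E] [NormedSpace ℂ E]
    {G : Type*} [TopologicalSpace G] [ChartedSpace E G] [Group G] [LieGroup 𝓘(ℂ, E) ω G]
    {Γ : Subgroup G} (hΓ : IsDiscrete (Γ : Set G)) :
    IsLocalHomeomorph (QuotientGroup.mk : G → G ⧸ Γ) :=
  haveI : IsTopologicalGroup G := topologicalGroup_of_lieGroup 𝓘(ℂ, E) ω
  (Γ.isQuotientCoveringMap hΓ).isCoveringMap.isLocalHomeomorph

/-- The charts of `G ⧸ Γ`, for a discrete subgroup `Γ` of a complex Lie group `G`: the charts of `G`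
composed with local inverses of the projection `G → G ⧸ Γ`. -/
@[reducible] def quotientChartedSpace {Γ : Subgroup G} (hΓ : IsDiscrete (Γ : Set G)) :
    ChartedSpace E (G ⧸ Γ) :=
  (isLocalHomeomorph_quotientMk E hΓ).chartedSpace QuotientGroup.mk_surjective

/-- With these charts `G ⧸ Γ` is a complex manifold. -/
theorem quotient_isManifold {Γ : Subgroup G} (hΓ : IsDiscrete (Γ : Set G)) :
    letI : ChartedSpace E (G ⧸ Γ) := quotientChartedSpace hΓ
    IsManifold 𝓘(ℂ, E) ω (G ⧸ Γ) := by
  let : ChartedSpace E (G ⧸ Γ) := quotientChartedSpace hΓ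
  have : IsTopologicalGroup G := topologicalGroup_of_lieGroup 𝓘(ℂ, E) ω
  have hloc := isLocalHomeomorph_quotientMk E hΓ
  apply isManifold_of_contDiffOn
  rintro e e' ⟨a, rfl⟩ ⟨b, rfl⟩
  generalize (QuotientGroup.mk_surjective (s := Γ)).hasRightInverse.choose a = p
  generalize (QuotientGroup.mk_surjective (s := Γ)).hasRightInverse.choose b = q
  rintro y ⟨hy, -⟩
  apply ContDiffAt.contDiffWithinAt
  simp only [modelWithCornersSelf_coe_symm, Set.preimage_id_eq, id_eq,
    OpenPartialHomeomorph.trans_source, OpenPartialHomeomorph.symm_source,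
    OpenPartialHomeomorph.trans_target, OpenPartialHomeomorph.coe_trans_symm,
    Set.mem_inter_iff, Set.mem_preimage,
    IsLocalHomeomorph.localInverseAt_symm, Function.comp_def] at hy
  obtain ⟨⟨hy1, hy2⟩, hy3, hy4⟩ := hy
  set x₀ := (chartAt E p).symm y with hx₀
  set s := hloc.localInverseAt q with hs
  have hmk : (QuotientGroup.mk (s (QuotientGroup.mk x₀)) : G ⧸ Γ) = QuotientGroup.mk x₀ :=
    hloc.apply_localInverseAt_of_mem hy3
  have hγ : x₀⁻¹ * s (QuotientGroup.mk x₀) ∈ Γ := QuotientGroup.eq.1 hmk.symm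
  set γ := x₀⁻¹ * s (QuotientGroup.mk x₀) with hγdef
  have hxγ : x₀ * γ = s (QuotientGroup.mk x₀) := by simp [hγdef]
  -- near `x₀`, the local section is the right translation by `γ`
  have hev : ∀ᶠ x in nhds x₀, s (QuotientGroup.mk x) = x * γ := by
    have h1 : ∀ᶠ x in nhds x₀, x * γ ∈ s.target := by
      have : ContinuousAt (fun x : G => x * γ) x₀ := by fun_prop
      apply this.eventually_mem
      refine s.open_target.mem_nhds ?_
      rw [hxγ]
      exact s.map_source hy3
    have h2 : ∀ᶠ x in nhds x₀, (QuotientGroup.mk x : G ⧸ Γ) ∈ s.source :=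
      (hloc.continuous.continuousAt).eventually_mem (s.open_source.mem_nhds hy3)
    filter_upwards [h1, h2] with x hx1 hx2
    apply hloc.injOn_localInverseAt_target (x := q) (s.map_source hx2) hx1
    rw [hloc.apply_localInverseAt_of_mem hx2]
    exact QuotientGroup.eq.2 (by simpa using hγ)
  have hcont : ContinuousAt (chartAt E p).symm y :=
    (chartAt E p).continuousAt_symm hy1
  have hsm : ContMDiffAt 𝓘(ℂ, E) 𝓘(ℂ, E) ω
      (fun z => chartAt E q ((chartAt E p).symm z * γ)) y := by
    have A : ContMDiffAt 𝓘(ℂ, E) 𝓘(ℂ, E) ω (chartAt E p).symm y :=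
      contMDiffOn_chart_symm.contMDiffAt ((chartAt E p).open_target.mem_nhds hy1)
    have B : ContMDiffAt 𝓘(ℂ, E) 𝓘(ℂ, E) ω (fun x : G => x * γ) x₀ :=
      contMDiff_mul_right.contMDiffAt
    have C : ContMDiffAt 𝓘(ℂ, E) 𝓘(ℂ, E) ω (chartAt E q) (x₀ * γ) := by
      refine contMDiffOn_chart.contMDiffAt ((chartAt E q).open_source.mem_nhds ?_)
      rw [hxγ]
      exact hy4
    exact ContMDiffAt.comp (g := fun x : G => chartAt E q (x * γ)) (f := (chartAt E p).symm) y
      (ContMDiffAt.comp (g := chartAt E q) (f := fun x : G => x * γ) x₀ C B) A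
  refine (contMDiffAt_iff_contDiffAt.1 hsm).congr_of_eventuallyEq ?_
  filter_upwards [hcont.eventually hev] with z hz
  simp [← hz, hs]

end Quotient

section CRS

/-- The differential at the identity of a homomorphism `ι : G₀ → G` from a real Lie group to a complex
Lie group, as a real linear map between the Lie algebras. -/
def lieDifferential (E₀ E : Type*) [NormedAddCommGroup E₀] [NormedSpace ℝ E₀]
    [NormedAddCommGroup E] [NormedSpace ℂ E]
    {G₀ : Type*} [TopologicalSpace G₀] [ChartedSpace E₀ G₀] [Group G₀]
    {G : Type*} [TopologicalSpace G] [ChartedSpace E G] [Group G] (ι : G₀ →* G) :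
    GroupLieAlgebra 𝓘(ℝ, E₀) G₀ →ₗ[ℝ] TangentSpace 𝓘(ℝ, E) (ι 1) :=
  (mfderiv 𝓘(ℝ, E₀) 𝓘(ℝ, E) ι 1 :
    TangentSpace 𝓘(ℝ, E₀) (1 : G₀) →L[ℝ] TangentSpace 𝓘(ℝ, E) (ι 1))

variable (E₀ E : Type*) [NormedAddCommGroup E₀] [NormedSpace ℝ E₀]
  [NormedAddCommGroup E] [NormedSpace ℂ E]
  {G₀ : Type*} [TopologicalSpace G₀] [ChartedSpace E₀ G₀] [Group G₀]
  {G : Type*} [TopologicalSpace G] [ChartedSpace E G] [Group G]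

/-- The image `i V` of a real subspace `V` of the Lie algebra of `G₀`, embedded in the (complex) Lie
algebra of `G`, under multiplication by `i`. -/
def iLieSubspace (ι : G₀ →* G) (V : Submodule ℝ (GroupLieAlgebra 𝓘(ℝ, E₀) G₀)) :
    Submodule ℝ (TangentSpace 𝓘(ℝ, E) (ι 1)) :=
  (V.map (lieDifferential E₀ E ι)).map (complexStructure (E := E) (ι 1)).toLinearMap

/-- CR-solvmanifolds `(Γ, G₀, G)`: `G` is a connected simply connected solvable complex Lie group,
`ι : G₀ → G` is the inclusion of a connected real Lie subgroup with `𝔤₀ + i 𝔤₀ = 𝔤`, and `Γ` is a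
discrete subgroup contained in `G₀`, with `G₀ / Γ` compact. -/
structure IsCRSolvmanifold (ι : G₀ →* G) (Γ : Subgroup G) : Prop where
  simplyConnected : SimplyConnectedSpace G
  solvable : Group.IsSolvable G
  connected : ConnectedSpace G₀
  smooth : ContMDiff 𝓘(ℝ, E₀) 𝓘(ℝ, E) ∞ ι
  injective : Function.Injective ι
  immersion : ∀ g : G₀, Function.Injective (mfderiv 𝓘(ℝ, E₀) 𝓘(ℝ, E) ι g)
  le_range : Γ ≤ ι.range
  discrete : IsDiscrete (Γ : Set G)
  cocompact : CompactSpace (G₀ ⧸ Γ.comap ι)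
  generic : (⊤ : Submodule ℝ (GroupLieAlgebra 𝓘(ℝ, E₀) G₀)).map (lieDifferential E₀ E ι) ⊔
    iLieSubspace E₀ E ι ⊤ = ⊤

/-- `𝔪 = 𝔤₀ ∩ i 𝔤₀`, as a real subspace of `𝔤₀`. -/
def complexPart (ι : G₀ →* G) : Submodule ℝ (GroupLieAlgebra 𝓘(ℝ, E₀) G₀) :=
  (iLieSubspace E₀ E ι ⊤).comap (lieDifferential E₀ E ι)

/-- The complex manifold `X = G ⧸ Γ` is Kähler. -/
def IsKahlerCRS [LieGroup 𝓘(ℂ, E) ω G] {Γ : Subgroup G} (hΓ : IsDiscrete (Γ : Set G)) : Prop :=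
  letI : ChartedSpace E (G ⧸ Γ) := quotientChartedSpace hΓ
  haveI : IsManifold 𝓘(ℂ, E) ω (G ⧸ Γ) := quotient_isManifold hΓ
  IsKahlerOpen (E := E) (Set.univ : Set (G ⧸ Γ))

/-- The compact submanifold `Y = G₀ / Γ` of `X = G ⧸ Γ` has an open neighbourhood in `X` which is
Kähler. -/
def IsLocallyKahlerCRS [LieGroup 𝓘(ℂ, E) ω G] (ι : G₀ →* G) {Γ : Subgroup G}
    (hΓ : IsDiscrete (Γ : Set G)) : Prop :=
  letI : ChartedSpace E (G ⧸ Γ) := quotientChartedSpace hΓ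
  haveI : IsManifold 𝓘(ℂ, E) ω (G ⧸ Γ) := quotient_isManifold hΓ
  ∃ U : Set (G ⧸ Γ), IsOpen U ∧ Set.range (fun g : G₀ => (QuotientGroup.mk (ι g) : G ⧸ Γ)) ⊆ U ∧
    IsKahlerOpen (E := E) U

/-- Smooth real Lie groups are smooth enough to have a Lie algebra. -/
instance leInfty_minSmoothness : ENat.LEInfty (minSmoothness ℝ 3) :=
  ⟨by rw [minSmoothness_of_isRCLikeNormedField]; exact ENat.LEInfty.out⟩

/-- There is a direct sum decomposition `𝔤₀ = 𝔞₀ ⊕ 𝔪` of Lie algebras (so both summands are ideals),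
with `𝔪 = 𝔤₀ ∩ i 𝔤₀` abelian and `𝔞₀ ∩ i 𝔞₀ = 0`. -/
def HasAbelianSplitting [FiniteDimensional ℝ E₀] [LieGroup 𝓘(ℝ, E₀) ∞ G₀] (ι : G₀ →* G) : Prop :=
  ∃ 𝔞₀ 𝔪 : LieIdeal ℝ (GroupLieAlgebra 𝓘(ℝ, E₀) G₀),
    𝔪.toSubmodule = complexPart E₀ E ι ∧ IsCompl 𝔞₀ 𝔪 ∧ IsLieAbelian 𝔪 ∧
    𝔞₀.toSubmodule.map (lieDifferential E₀ E ι) ⊓ iLieSubspace E₀ E ι 𝔞₀.toSubmodule = ⊥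

end CRS

end

set_option linter.unusedSectionVars false

noncomputable section

/-! ### Calculus on a Lie group in the chart at the identity -/

section LieGroupCalculus

open Filter Topology

variable {E : Type*} [NormedAddCommGroup E] [NormedSpace ℝ E]
  {G : Type*} [TopologicalSpace G] [ChartedSpace E G] [Group G]
  {F : Type*} [NormedAddCommGroup F] [NormedSpace ℝ F]

/-! A Kähler form on `X` is in particular one on a neighbourhood of `Y`; the other two implications
carry the theorem.

Locally Kähler implies splitting. Evaluate a Kähler form near `Y`, at the points of `Y`, on the
vector fields generated by the action of `G` on `X`. Each pair of vectors of `𝔤₀` yields a function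
on `G₀` that is right invariant under `Γ`, hence bounded by cocompactness. The group `G₀` is
nilpotent, so it carries an invariant mean (`exists_isInvariantMean_of_isNilpotent`), and averaging
gives a bilinear form `β` on `𝔤₀`. Expand the closedness of the form on three such vector fields:
the derivative terms have mean zero (`IsInvariantMean.map_rightDeriv_eq_zero`), and what survives
says that `β` is a Lie algebra 2-cocycle. By compactness `β(v, iv) > 0` for nonzero `v ∈ 𝔪`. The
rest is algebra. If `z = [a, w]` lies in `𝔪` and `iz` is central, the cocycle identity gives `β(z,
iz) = 0`, so `z = 0`. Applied to iterated brackets, from the longest down, this shows that `𝔪` is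
central (`lie_eq_zero_of_positive_cocycle`). The same identity gives `[𝔤₀, 𝔤₀] ∩ 𝔪 = 0`, and any
complement of `𝔪` containing `[𝔤₀, 𝔤₀]` serves as `𝔞₀` (`exists_splitting_of_positive_cocycle`).

Splitting implies Kähler. The ideal `𝔪` is central. Birkhoff's theorem
(`exists_strict_representation`) provides a faithful strictly triangular real representation of
`𝔤₀/𝔪`. It extends complex linearly to `𝔤` and, `G` being simply connected, integrates to a
holomorphic homomorphism `A` into unitriangular matrices that is real on `G₀`. The slope `(Im A)(Re
A)⁻¹` does not change under right multiplication by `G₀`, hence by `Γ`. Nested exponentials of its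
entries (`levelFun`) are plurisubharmonic, strictly so in the directions in which `A` varies
(`lineLaplacian_levelFun_slopeMat`). The missing directions are those of `𝔪`. The projection onto
`𝔪` along `𝔞₀` kills brackets, so its complex extension integrates to additive holomorphic functions
`w`, and `|w|²` changes under `Γ` only by the real part of a holomorphic function. The sum of all
these functions is a strictly plurisubharmonic potential on `G` whose form descends to `X`
(`isKahlerCRS_of_potential`). -/

variable (E G) in
/-- The inverse of the preferred chart at the identity of a Lie group. -/
def unitParam (z : E) : G := (chartAt E (1 : G)).symm z

variable (E G) in
/-- The coordinate of the identity of a Lie group in the preferred chart there. -/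
def unitCoord : E := chartAt E (1 : G) 1

variable (E G) in
/-- The multiplication of a Lie group in the chart at the identity. -/
def localMul (p : E × E) : E := chartAt E (1 : G) (unitParam E G p.1 * unitParam E G p.2)

variable (E G) in
/-- The left invariant frame in the chart at the identity. -/
def leftFrame (z : E) : E →L[ℝ] E := fderiv ℝ (fun w => localMul E G (z, w)) (unitCoord E G)

variable (E G) in
/-- The right invariant frame in the chart at the identity. -/
def rightFrame (z : E) : E →L[ℝ] E := fderiv ℝ (fun w => localMul E G (w, z)) (unitCoord E G)

variable (E G) in
/-- The mixed second derivative of the multiplication at the identity. -/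
def mixedDeriv : E →L[ℝ] E →L[ℝ] E := fderiv ℝ (leftFrame E G) (unitCoord E G)

variable (E G) in
/-- The Lie bracket on the tangent space at the identity. -/
def unitBracket (X Y : E) : E := mixedDeriv E G X Y - mixedDeriv E G Y X

/-- The derivative of a function along left invariant vector fields. -/
def leftDeriv (f : G → F) (g : G) : E →L[ℝ] F :=
  fderiv ℝ (fun z => f (g * unitParam E G z)) (unitCoord E G)

@[simp] theorem unitParam_unitCoord : unitParam E G (unitCoord E G) = 1 :=
  (chartAt E (1 : G)).left_inv (mem_chart_source E 1)

theorem unitCoord_mem : unitCoord E G ∈ (chartAt E (1 : G)).target := mem_chart_target E 1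

theorem target_mem_nhds : (chartAt E (1 : G)).target ∈ 𝓝 (unitCoord E G) :=
  (chartAt E (1 : G)).open_target.mem_nhds unitCoord_mem

theorem unitParam_chart {g : G} (hg : g ∈ (chartAt E (1 : G)).source) :
    unitParam E G (chartAt E (1 : G) g) = g := (chartAt E (1 : G)).left_inv hg

theorem chart_unitParam {z : E} (hz : z ∈ (chartAt E (1 : G)).target) :
    chartAt E (1 : G) (unitParam E G z) = z := (chartAt E (1 : G)).right_inv hz

theorem unitParam_mem {z : E} (hz : z ∈ (chartAt E (1 : G)).target) :
    unitParam E G z ∈ (chartAt E (1 : G)).source := (chartAt E (1 : G)).map_target hz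

theorem source_mem_nhds : (chartAt E (1 : G)).source ∈ 𝓝 (1 : G) :=
  (chartAt E (1 : G)).open_source.mem_nhds (mem_chart_source E 1)

theorem localMul_unitCoord_left {z : E} (hz : z ∈ (chartAt E (1 : G)).target) :
    localMul E G (unitCoord E G, z) = z := by
  simp [localMul, chart_unitParam hz]

theorem localMul_unitCoord_right {z : E} (hz : z ∈ (chartAt E (1 : G)).target) :
    localMul E G (z, unitCoord E G) = z := by
  simp [localMul, chart_unitParam hz]

variable [LieGroup 𝓘(ℝ, E) ∞ G]

theorem contMDiffAt_unitParam {z : E} (hz : z ∈ (chartAt E (1 : G)).target) :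
    ContMDiffAt 𝓘(ℝ, E) 𝓘(ℝ, E) ∞ (unitParam E G) z :=
  contMDiffOn_chart_symm.contMDiffAt ((chartAt E (1 : G)).open_target.mem_nhds hz)

theorem contMDiffAt_unitChart {g : G} (hg : g ∈ (chartAt E (1 : G)).source) :
    ContMDiffAt 𝓘(ℝ, E) 𝓘(ℝ, E) ∞ (chartAt E (1 : G)) g :=
  contMDiffOn_chart.contMDiffAt ((chartAt E (1 : G)).open_source.mem_nhds hg)

/-- A map into a Lie group, read in the chart at the identity. -/
theorem contDiffAt_unitChart_comp {φ : F → G} {z : F} (hφ : ContMDiffAt 𝓘(ℝ, F) 𝓘(ℝ, E) ∞ φ z)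
    (hz : φ z ∈ (chartAt E (1 : G)).source) :
    ContDiffAt ℝ ∞ (fun w => chartAt E (1 : G) (φ w)) z :=
  contMDiffAt_iff_contDiffAt.1 ((contMDiffAt_unitChart hz).comp z hφ)

theorem contDiffAt_comp_of_contMDiff {H : Type*} [NormedAddCommGroup H] [NormedSpace ℝ H]
    {f : G → F} (hf : ContMDiff 𝓘(ℝ, E) 𝓘(ℝ, F) ∞ f) {φ : H → G} {z : H}
    (hφ : ContMDiffAt 𝓘(ℝ, H) 𝓘(ℝ, E) ∞ φ z) :
    ContDiffAt ℝ ∞ (fun w => f (φ w)) z :=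
  contMDiffAt_iff_contDiffAt.1 (hf.contMDiffAt.comp z hφ)

theorem contMDiffAt_mul_unitParam (g : G) {z : E} (hz : z ∈ (chartAt E (1 : G)).target) :
    ContMDiffAt 𝓘(ℝ, E) 𝓘(ℝ, E) ∞ (fun w => g * unitParam E G w) z :=
  contMDiffAt_const.mul (contMDiffAt_unitParam hz)

theorem contMDiffAt_unitParam_mul (g : G) {z : E} (hz : z ∈ (chartAt E (1 : G)).target) :
    ContMDiffAt 𝓘(ℝ, E) 𝓘(ℝ, E) ∞ (fun w => unitParam E G w * g) z :=
  (contMDiffAt_unitParam hz).mul contMDiffAt_const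

theorem continuousAt_unitParam {z : E} (hz : z ∈ (chartAt E (1 : G)).target) :
    ContinuousAt (unitParam E G) z := (contMDiffAt_unitParam hz).continuousAt

theorem localMul_contDiffAt {p : E × E} (h₁ : p.1 ∈ (chartAt E (1 : G)).target)
    (h₂ : p.2 ∈ (chartAt E (1 : G)).target)
    (h : unitParam E G p.1 * unitParam E G p.2 ∈ (chartAt E (1 : G)).source) :
    ContDiffAt ℝ ∞ (localMul E G) p := by
  refine contDiffAt_unitChart_comp (φ := fun p : E × E => unitParam E G p.1 * unitParam E G p.2)
    ?_ h
  have A : ContMDiffAt 𝓘(ℝ, E × E) 𝓘(ℝ, E) ∞ (fun p : E × E => p.1) p :=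
    contMDiffAt_iff_contDiffAt.2 contDiffAt_fst
  have B : ContMDiffAt 𝓘(ℝ, E × E) 𝓘(ℝ, E) ∞ (fun p : E × E => p.2) p :=
    contMDiffAt_iff_contDiffAt.2 contDiffAt_snd
  exact (ContMDiffAt.comp (g := unitParam E G) p (contMDiffAt_unitParam h₁) A).mul
    (ContMDiffAt.comp (g := unitParam E G) p (contMDiffAt_unitParam h₂) B)

theorem localMul_contDiffAt_left {z : E} (hz : z ∈ (chartAt E (1 : G)).target) :
    ContDiffAt ℝ ∞ (localMul E G) (z, unitCoord E G) :=
  localMul_contDiffAt hz unitCoord_mem (by simpa using unitParam_mem hz)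

theorem localMul_contDiffAt_right {z : E} (hz : z ∈ (chartAt E (1 : G)).target) :
    ContDiffAt ℝ ∞ (localMul E G) (unitCoord E G, z) :=
  localMul_contDiffAt unitCoord_mem hz (by simpa using unitParam_mem hz)

theorem fderiv_localMul_apply :
    fderiv ℝ (localMul E G) (unitCoord E G, unitCoord E G) =
      ContinuousLinearMap.fst ℝ E E + ContinuousLinearMap.snd ℝ E E := by
  have hd : DifferentiableAt ℝ (localMul E G) (unitCoord E G, unitCoord E G) :=
    (localMul_contDiffAt_left unitCoord_mem).differentiableAt (by simp)
  have A : fderiv ℝ (fun w => localMul E G (w, unitCoord E G)) (unitCoord E G) = .id ℝ E := by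
    rw [← fderiv_id (𝕜 := ℝ) (x := unitCoord E G)]
    apply Filter.EventuallyEq.fderiv_eq
    filter_upwards [target_mem_nhds (E := E) (G := G)] with w hw using localMul_unitCoord_right hw
  have B : fderiv ℝ (fun w => localMul E G (unitCoord E G, w)) (unitCoord E G) = .id ℝ E := by
    rw [← fderiv_id (𝕜 := ℝ) (x := unitCoord E G)]
    apply Filter.EventuallyEq.fderiv_eq
    filter_upwards [target_mem_nhds (E := E) (G := G)] with w hw using localMul_unitCoord_left hw
  have A' := HasFDerivAt.fderiv (HasFDerivAt.comp (f := fun e => (e, unitCoord E G))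
    (unitCoord E G) hd.hasFDerivAt (hasFDerivAt_prodMk_left (𝕜 := ℝ) (unitCoord E G) (unitCoord E G)))
  have B' := HasFDerivAt.fderiv (HasFDerivAt.comp (f := fun e => (unitCoord E G, e))
    (unitCoord E G) hd.hasFDerivAt (hasFDerivAt_prodMk_right (𝕜 := ℝ) (unitCoord E G) (unitCoord E G)))
  rw [show localMul E G ∘ (fun e => (e, unitCoord E G)) =
    fun w => localMul E G (w, unitCoord E G) from rfl, A] at A'
  rw [show localMul E G ∘ (fun e => (unitCoord E G, e)) =
    fun w => localMul E G (unitCoord E G, w) from rfl, B] at B'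
  ext p
  · have := DFunLike.congr_fun A' p
    simpa using this.symm
  · have := DFunLike.congr_fun B' p
    simpa using this.symm

theorem hasFDerivAt_localMul :
    HasFDerivAt (localMul E G)
      (ContinuousLinearMap.fst ℝ E E + ContinuousLinearMap.snd ℝ E E)
      (unitCoord E G, unitCoord E G) := by
  rw [← fderiv_localMul_apply (E := E) (G := G)]
  exact ((localMul_contDiffAt_left (E := E) (G := G) unitCoord_mem).differentiableAt
    (by simp)).hasFDerivAt

theorem leftFrame_eq {z : E} (hz : z ∈ (chartAt E (1 : G)).target) :
    leftFrame E G z =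
      (fderiv ℝ (localMul E G) (z, unitCoord E G)).comp (ContinuousLinearMap.inr ℝ E E) :=
  (HasFDerivAt.comp (f := fun e => (z, e)) (unitCoord E G)
    (((localMul_contDiffAt_left hz).differentiableAt (by simp)).hasFDerivAt)
    (hasFDerivAt_prodMk_right (𝕜 := ℝ) z (unitCoord E G))).fderiv

theorem rightFrame_eq {z : E} (hz : z ∈ (chartAt E (1 : G)).target) :
    rightFrame E G z =
      (fderiv ℝ (localMul E G) (unitCoord E G, z)).comp (ContinuousLinearMap.inl ℝ E E) :=
  (HasFDerivAt.comp (f := fun e => (e, z)) (unitCoord E G)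
    (((localMul_contDiffAt_right hz).differentiableAt (by simp)).hasFDerivAt)
    (hasFDerivAt_prodMk_left (𝕜 := ℝ) (unitCoord E G) z)).fderiv

@[simp] theorem leftFrame_unitCoord : leftFrame E G (unitCoord E G) = .id ℝ E := by
  rw [leftFrame_eq unitCoord_mem, fderiv_localMul_apply]; ext; simp

@[simp] theorem rightFrame_unitCoord : rightFrame E G (unitCoord E G) = .id ℝ E := by
  rw [rightFrame_eq unitCoord_mem, fderiv_localMul_apply]; ext; simp

theorem contDiffAt_fderiv_localMul :
    ContDiffAt ℝ ∞ (fderiv ℝ (localMul E G)) (unitCoord E G, unitCoord E G) :=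
  (localMul_contDiffAt_left unitCoord_mem).fderiv_right (m := ∞) (by simp)

theorem contDiffAt_leftFrame {z : E} (hz : z ∈ (chartAt E (1 : G)).target) :
    ContDiffAt ℝ ∞ (leftFrame E G) z := by
  have A : ContDiffAt ℝ ∞ (fderiv ℝ (localMul E G)) (z, unitCoord E G) :=
    (localMul_contDiffAt_left hz).fderiv_right (m := ∞) (by simp)
  have B : ContDiffAt ℝ ∞ (fun w : E => fderiv ℝ (localMul E G) (w, unitCoord E G)) z :=
    A.comp (g := fderiv ℝ (localMul E G)) z (contDiffAt_id.prodMk contDiffAt_const)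
  refine (B.clm_comp (contDiffAt_const (c := ContinuousLinearMap.inr ℝ E E))).congr_of_eventuallyEq
    ?_
  filter_upwards [(chartAt E (1 : G)).open_target.mem_nhds hz] with w hw using leftFrame_eq hw

theorem hasFDerivAt_leftFrame :
    HasFDerivAt (leftFrame E G) (mixedDeriv E G) (unitCoord E G) :=
  ((contDiffAt_leftFrame unitCoord_mem).differentiableAt (by simp)).hasFDerivAt

theorem mixedDeriv_apply (X Y : E) : mixedDeriv E G X Y =
    fderiv ℝ (fderiv ℝ (localMul E G)) (unitCoord E G, unitCoord E G) (X, 0) (0, Y) := by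
  have A : HasFDerivAt (fderiv ℝ (localMul E G)) _ (unitCoord E G, unitCoord E G) :=
    ((contDiffAt_fderiv_localMul (E := E) (G := G)).differentiableAt (by simp)).hasFDerivAt
  have B := A.comp (f := fun e => (e, unitCoord E G)) (unitCoord E G)
    (hasFDerivAt_prodMk_left (𝕜 := ℝ) (unitCoord E G) (unitCoord E G))
  have C := (B.clm_comp (hasFDerivAt_const (ContinuousLinearMap.inr ℝ E E) (unitCoord E G)))
  have D : HasFDerivAt (leftFrame E G) _ (unitCoord E G) := C.congr_of_eventuallyEq (by
    filter_upwards [target_mem_nhds (E := E) (G := G)] with w hw using leftFrame_eq hw)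
  rw [hasFDerivAt_leftFrame.unique D]
  simp

/-- Symmetry of the second derivative of the multiplication exchanges the two slots. This is why
brackets of right invariant fields are the negatives of those of left invariant ones. -/
theorem hasFDerivAt_rightFrame :
    HasFDerivAt (rightFrame E G) (mixedDeriv E G).flip (unitCoord E G) := by
  have A : HasFDerivAt (fderiv ℝ (localMul E G)) _ (unitCoord E G, unitCoord E G) :=
    ((contDiffAt_fderiv_localMul (E := E) (G := G)).differentiableAt (by simp)).hasFDerivAt
  have B := A.comp (f := fun e => (unitCoord E G, e)) (unitCoord E G)
    (hasFDerivAt_prodMk_right (𝕜 := ℝ) (unitCoord E G) (unitCoord E G))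
  have C := (B.clm_comp (hasFDerivAt_const (ContinuousLinearMap.inl ℝ E E) (unitCoord E G)))
  have D : HasFDerivAt (rightFrame E G) _ (unitCoord E G) := C.congr_of_eventuallyEq (by
    filter_upwards [target_mem_nhds (E := E) (G := G)] with w hw using rightFrame_eq hw)
  convert! D using 1
  ext X Y
  have hs : IsSymmSndFDerivAt ℝ (localMul E G) (unitCoord E G, unitCoord E G) :=
    (localMul_contDiffAt_left unitCoord_mem).isSymmSndFDerivAt (by simp; exact ENat.LEInfty.out)
  simp [mixedDeriv_apply, hs.eq (0, X) (Y, 0)]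

section LeftDerivative

/-- The derivative of a function along a map into a Lie group. -/
theorem fderiv_comp_eq_leftDeriv {H : Type*} [NormedAddCommGroup H] [NormedSpace ℝ H]
    {f : G → F} {φ : H → G} {z : H}
    (hf : DifferentiableAt ℝ (fun w => f (φ z * unitParam E G w)) (unitCoord E G))
    (hφ : ContMDiffAt 𝓘(ℝ, H) 𝓘(ℝ, E) ∞ φ z) :
    HasFDerivAt (fun w => f (φ w)) ((leftDeriv f (φ z)).comp
      (fderiv ℝ (fun w => chartAt E (1 : G) ((φ z)⁻¹ * φ w)) z)) z := by
  have A : ContMDiffAt 𝓘(ℝ, H) 𝓘(ℝ, E) ∞ (fun w => (φ z)⁻¹ * φ w) z :=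
    contMDiffAt_const.mul hφ
  have B := contDiffAt_unitChart_comp A (by simp)
  have hz : chartAt E (1 : G) ((φ z)⁻¹ * φ z) = unitCoord E G := by simp [unitCoord]
  have C : HasFDerivAt (fun w => f (φ z * unitParam E G w)) (leftDeriv f (φ z))
      (chartAt E (1 : G) ((φ z)⁻¹ * φ z)) := by
    rw [hz]; exact hf.hasFDerivAt
  refine (C.comp z (B.differentiableAt (by simp)).hasFDerivAt).congr_of_eventuallyEq ?_
  have : ∀ᶠ w in 𝓝 z, (φ z)⁻¹ * φ w ∈ (chartAt E (1 : G)).source :=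
    A.continuousAt.eventually_mem (by simpa using source_mem_nhds)
  filter_upwards [this] with w hw
  simp [unitParam_chart hw]

theorem chart_mul_unitParam_comp (g : G) (z : E) :
    (fun w => chartAt E (1 : G) ((g * unitParam E G z)⁻¹ * (g * unitParam E G w))) =
      fun w => chartAt E (1 : G) ((unitParam E G z)⁻¹ * unitParam E G w) := by
  ext w; congr 1; group

/-- The left invariant coframe in the chart at the identity, at the point `z`. -/
theorem leftFrame_comp_coframe {z : E} (hz : z ∈ (chartAt E (1 : G)).target) :
    (leftFrame E G z).comp
      (fderiv ℝ (fun w => chartAt E (1 : G) ((unitParam E G z)⁻¹ * unitParam E G w)) z) =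
      .id ℝ E := by
  -- The chain rule is applied to the chart itself, whose left derivative at `unitParam E G z` is
  -- the left frame at `z`.
  have h := fderiv_comp_eq_leftDeriv (f := fun g : G => chartAt E (1 : G) g)
    (φ := unitParam E G) (z := z)
    ((contDiffAt_unitChart_comp (contMDiffAt_mul_unitParam _ unitCoord_mem)
      (by simpa using unitParam_mem hz)).differentiableAt (by simp)) (contMDiffAt_unitParam hz)
  have h' : HasFDerivAt (fun w => chartAt E (1 : G) (unitParam E G w)) (.id ℝ E) z := by
    refine (hasFDerivAt_id z).congr_of_eventuallyEq ?_
    filter_upwards [(chartAt E (1 : G)).open_target.mem_nhds hz] with w hw using chart_unitParam hw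
  exact h.unique h'

/-- In finite dimension a one-sided inverse is two-sided. -/
theorem coframe_comp_leftFrame [FiniteDimensional ℝ E] {z : E}
    (hz : z ∈ (chartAt E (1 : G)).target) :
    (fderiv ℝ (fun w => chartAt E (1 : G) ((unitParam E G z)⁻¹ * unitParam E G w)) z).comp
      (leftFrame E G z) = .id ℝ E := by
  have h := congrArg ContinuousLinearMap.toLinearMap (leftFrame_comp_coframe (G := G) hz)
  apply ContinuousLinearMap.coe_injective
  exact (LinearMap.comp_eq_id_comm ℝ E).1 h

theorem contDiffAt_mul_unitParam {f : G → F} (hf : ContMDiff 𝓘(ℝ, E) 𝓘(ℝ, F) ∞ f) (g : G) {z : E}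
    (hz : z ∈ (chartAt E (1 : G)).target) :
    ContDiffAt ℝ ∞ (fun w => f (g * unitParam E G w)) z :=
  contDiffAt_comp_of_contMDiff hf (contMDiffAt_mul_unitParam g hz)

theorem differentiableAt_mul_unitParam {f : G → F} (hf : ContMDiff 𝓘(ℝ, E) 𝓘(ℝ, F) ∞ f) (g : G) :
    DifferentiableAt ℝ (fun w => f (g * unitParam E G w)) (unitCoord E G) :=
  (contDiffAt_mul_unitParam hf g unitCoord_mem).differentiableAt (by simp)

theorem hasFDerivAt_leftDeriv {f : G → F} (hf : ContMDiff 𝓘(ℝ, E) 𝓘(ℝ, F) ∞ f) (g : G) :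
    HasFDerivAt (fun w => f (g * unitParam E G w)) (leftDeriv f g) (unitCoord E G) :=
  (differentiableAt_mul_unitParam hf g).hasFDerivAt

end LeftDerivative

end LieGroupCalculus

/-! ### The Lie bracket, differentials of homomorphisms, locally constant functions -/

section LieGroupBracket

open Filter Topology

variable {E : Type*} [NormedAddCommGroup E] [NormedSpace ℝ E]
  {G : Type*} [TopologicalSpace G] [ChartedSpace E G] [Group G]
  {F : Type*} [NormedAddCommGroup F] [NormedSpace ℝ F] [LieGroup 𝓘(ℝ, E) ∞ G]

theorem mpullback_mulInvariantVectorField_unitChart {z : E}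
    (hz : z ∈ (chartAt E (1 : G)).target) (v : E) :
    VectorField.mpullbackWithin 𝓘(ℝ, E) 𝓘(ℝ, E) (extChartAt 𝓘(ℝ, E) (1 : G)).symm
      (mulInvariantVectorField (I := 𝓘(ℝ, E)) (G := G) v) (Set.range 𝓘(ℝ, E)) z =
      leftFrame E G z v := by
  have : IsManifold 𝓘(ℝ, E) 1 G := IsManifold.of_le (n := ∞) (by simp)
  have hzt : z ∈ (extChartAt 𝓘(ℝ, E) (1 : G)).target := by simpa using hz
  have hsrc : unitParam E G z ∈ (chartAt E (1 : G)).source := unitParam_mem hz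
  have hinv : (mfderivWithin 𝓘(ℝ, E) 𝓘(ℝ, E) (extChartAt 𝓘(ℝ, E) (1 : G)).symm
      (Set.range 𝓘(ℝ, E)) z).inverse =
      mfderiv 𝓘(ℝ, E) 𝓘(ℝ, E) (extChartAt 𝓘(ℝ, E) (1 : G))
        ((extChartAt 𝓘(ℝ, E) (1 : G)).symm z) := by
    apply ContinuousLinearMap.inverse_eq
    · exact mfderivWithin_extChartAt_symm_comp_mfderiv_extChartAt hzt
    · exact mfderiv_extChartAt_comp_mfderivWithin_extChartAt_symm hzt
  rw [VectorField.mpullbackWithin_apply, hinv]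
  have h1 : MDifferentiableAt 𝓘(ℝ, E) 𝓘(ℝ, E) (extChartAt 𝓘(ℝ, E) (1 : G))
      (unitParam E G z * 1) := by
    rw [mul_one]; exact mdifferentiableAt_extChartAt hsrc
  have h2 : MDifferentiableAt 𝓘(ℝ, E) 𝓘(ℝ, E) (fun g : G => unitParam E G z * g) 1 :=
    (contMDiff_mul_left (I := 𝓘(ℝ, E)) (n := ∞)).contMDiffAt.mdifferentiableAt (by simp)
  have h3 := mfderiv_comp (I := 𝓘(ℝ, E)) (I' := 𝓘(ℝ, E)) (I'' := 𝓘(ℝ, E)) (1 : G) h1 h2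
  have h4 : mfderiv 𝓘(ℝ, E) 𝓘(ℝ, E)
      ((extChartAt 𝓘(ℝ, E) (1 : G)) ∘ fun g : G => unitParam E G z * g) 1 = leftFrame E G z := by
    rw [(h1.comp (1 : G) h2).mfderiv]
    simp only [mfld_simps, fderivWithin_univ]
    rfl
  have h5 : (mfderiv 𝓘(ℝ, E) 𝓘(ℝ, E) (extChartAt 𝓘(ℝ, E) (1 : G)) (unitParam E G z * 1) :
      E →L[ℝ] E) = (mfderiv 𝓘(ℝ, E) 𝓘(ℝ, E) (extChartAt 𝓘(ℝ, E) (1 : G)) (unitParam E G z) :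
      E →L[ℝ] E) := by rw [mul_one]
  have h6 : leftFrame E G z = (mfderiv 𝓘(ℝ, E) 𝓘(ℝ, E) (extChartAt 𝓘(ℝ, E) (1 : G))
      (unitParam E G z) : E →L[ℝ] E).comp
      (mfderiv 𝓘(ℝ, E) 𝓘(ℝ, E) (fun g : G => unitParam E G z * g) 1 : E →L[ℝ] E) := by
    rw [← h5]; exact h4.symm.trans h3
  exact (DFunLike.congr_fun h6 v).symm

/-- The bracket of the Lie algebra of a Lie group, in terms of the multiplication in the chart. -/
theorem groupLieAlgebra_bracket_eq [FiniteDimensional ℝ E] (v w : GroupLieAlgebra 𝓘(ℝ, E) G) :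
    ⁅v, w⁆ = unitBracket E G v w := by
  have : IsManifold 𝓘(ℝ, E) 1 G := IsManifold.of_le (n := ∞) (by simp)
  rw [GroupLieAlgebra.bracket_def, VectorField.mlieBracket, VectorField.mlieBracketWithin_apply,
    mfderiv_extChartAt_self]
  have key : ∀ v : E, (VectorField.mpullbackWithin 𝓘(ℝ, E) 𝓘(ℝ, E)
      (extChartAt 𝓘(ℝ, E) (1 : G)).symm
      (mulInvariantVectorField (I := 𝓘(ℝ, E)) (G := G) v) (Set.range 𝓘(ℝ, E))) =ᶠ[𝓝 (unitCoord E G)]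
      fun z => leftFrame E G z v := by
    intro v
    filter_upwards [target_mem_nhds (E := E) (G := G)] with z hz
    exact mpullback_mulInvariantVectorField_unitChart hz v
  have h1 : VectorField.lieBracketWithin ℝ
      (VectorField.mpullbackWithin 𝓘(ℝ, E) 𝓘(ℝ, E) (extChartAt 𝓘(ℝ, E) (1 : G)).symm
        (mulInvariantVectorField (I := 𝓘(ℝ, E)) (G := G) v) (Set.range 𝓘(ℝ, E)))
      (VectorField.mpullbackWithin 𝓘(ℝ, E) 𝓘(ℝ, E) (extChartAt 𝓘(ℝ, E) (1 : G)).symm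
        (mulInvariantVectorField (I := 𝓘(ℝ, E)) (G := G) w) (Set.range 𝓘(ℝ, E)))
      ((extChartAt 𝓘(ℝ, E) (1 : G)).symm ⁻¹' Set.univ ∩ Set.range 𝓘(ℝ, E))
      (unitCoord E G) = VectorField.lieBracket ℝ (fun z => leftFrame E G z v)
        (fun z => leftFrame E G z w) (unitCoord E G) := by
    have : (extChartAt 𝓘(ℝ, E) (1 : G)).symm ⁻¹' Set.univ ∩ Set.range 𝓘(ℝ, E) = Set.univ := by
      simp
    have aux : ∀ V W V' W' : E → E, V =ᶠ[𝓝 (unitCoord E G)] V' → W =ᶠ[𝓝 (unitCoord E G)] W' →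
        ∀ s : Set E, s = Set.univ → VectorField.lieBracketWithin ℝ V W s (unitCoord E G) =
          VectorField.lieBracket ℝ V' W' (unitCoord E G) := by
      rintro V W V' W' hV hW s rfl
      rw [VectorField.lieBracketWithin_univ]
      exact Filter.EventuallyEq.lieBracket_vectorField_eq hV hW
    exact aux _ _ _ _ (key v) (key w) _ this
  have h2 : (ContinuousLinearMap.id ℝ E).inverse = ContinuousLinearMap.id ℝ E :=
    ContinuousLinearMap.inverse_id
  refine (DFunLike.congr_fun h2 _).trans (h1.trans ?_)
  rw [VectorField.lieBracket]
  -- At the identity the frame is the identity map, so the bracket of the fields reduces to the two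
  -- mixed derivatives.
  have hd : ∀ v : E, HasFDerivAt (fun z => leftFrame E G z v) _ (unitCoord E G) :=
    fun v => (hasFDerivAt_leftFrame (E := E) (G := G)).clm_apply (hasFDerivAt_const v _)
  rw [(hd v).fderiv, (hd w).fderiv]
  simp [unitBracket]
  rfl

section Hom

variable {E₀ : Type*} [NormedAddCommGroup E₀] [NormedSpace ℝ E₀]
  {G₀ : Type*} [TopologicalSpace G₀] [ChartedSpace E₀ G₀] [Group G₀] [LieGroup 𝓘(ℝ, E₀) ∞ G₀]

variable (E E₀) in
/-- A map between Lie groups, in the charts at the identities. -/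
def localHom (ι : G₀ →* G) (z : E₀) : E := chartAt E (1 : G) (ι (unitParam E₀ G₀ z))

variable (E E₀) in
/-- The differential of a homomorphism of Lie groups at the identity. -/
def unitDeriv (ι : G₀ →* G) : E₀ →L[ℝ] E := fderiv ℝ (localHom E E₀ ι) (unitCoord E₀ G₀)

variable {ι : G₀ →* G} (hι : ContMDiff 𝓘(ℝ, E₀) 𝓘(ℝ, E) ∞ ι)

theorem localHom_unitCoord : localHom E E₀ ι (unitCoord E₀ G₀) = unitCoord E G := by
  rw [localHom, unitParam_unitCoord, map_one, unitCoord]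

include hι

theorem contMDiffAt_hom_unitParam {z : E₀} (hz : z ∈ (chartAt E₀ (1 : G₀)).target) :
    ContMDiffAt 𝓘(ℝ, E₀) 𝓘(ℝ, E) ∞ (fun z => ι (unitParam E₀ G₀ z)) z :=
  hι.contMDiffAt.comp z (contMDiffAt_unitParam hz)

theorem contDiffAt_localHom : ContDiffAt ℝ ∞ (localHom E E₀ ι) (unitCoord E₀ G₀) :=
  contDiffAt_unitChart_comp (contMDiffAt_hom_unitParam hι unitCoord_mem) (by simp)

theorem eventually_hom_mem :
    ∀ᶠ z in 𝓝 (unitCoord E₀ G₀), ι (unitParam E₀ G₀ z) ∈ (chartAt E (1 : G)).source :=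
  (contMDiffAt_hom_unitParam hι unitCoord_mem).continuousAt.eventually_mem
    (by simpa using source_mem_nhds)

theorem eventually_unitParam_localHom :
    ∀ᶠ z in 𝓝 (unitCoord E₀ G₀), unitParam E G (localHom E E₀ ι z) = ι (unitParam E₀ G₀ z) := by
  filter_upwards [eventually_hom_mem (E := E) hι] with z hz using unitParam_chart hz

theorem hasFDerivAt_localHom :
    HasFDerivAt (localHom E E₀ ι) (unitDeriv E E₀ ι) (unitCoord E₀ G₀) :=
  ((contDiffAt_localHom hι).differentiableAt (by simp)).hasFDerivAt

theorem mfderiv_hom_eq : mfderiv 𝓘(ℝ, E₀) 𝓘(ℝ, E) ι 1 = unitDeriv E E₀ ι := by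
  have h : MDifferentiableAt 𝓘(ℝ, E₀) 𝓘(ℝ, E) ι 1 := hι.mdifferentiable (by simp) 1
  rw [h.mfderiv]
  simp only [mfld_simps, fderivWithin_univ, unitDeriv]
  rw [map_one]
  rfl

/-- Differentiate `ι (z * w) = ι z * ι w` in `w` at the identity. The relation holds for all `z`
nearby, so it can be differentiated once more. -/
theorem leftFrame_hom : ∀ᶠ z in 𝓝 (unitCoord E₀ G₀),
    (fderiv ℝ (localHom E E₀ ι) z).comp (leftFrame E₀ G₀ z) =
      (leftFrame E G (localHom E E₀ ι z)).comp (unitDeriv E E₀ ι) := by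
  have hev : ∀ᶠ z in 𝓝 (unitCoord E₀ G₀), unitParam E₀ G₀ z ∈ (chartAt E₀ (1 : G₀)).source ∧
      ι (unitParam E₀ G₀ z) ∈ (chartAt E (1 : G)).source ∧
      localHom E E₀ ι z ∈ (chartAt E (1 : G)).target := by
    filter_upwards [target_mem_nhds (E := E₀) (G := G₀), eventually_hom_mem (E := E) hι] with z h1 h2
    exact ⟨unitParam_mem h1, h2, (chartAt E (1 : G)).map_source h2⟩
  filter_upwards [hev, target_mem_nhds (E := E₀) (G := G₀)] with z ⟨h1, h2, h3⟩ hz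
  have e1 : (fun w => localHom E E₀ ι (localMul E₀ G₀ (z, w))) =ᶠ[𝓝 (unitCoord E₀ G₀)]
      fun w => localMul E G (localHom E E₀ ι z, localHom E E₀ ι w) := by
    have c1 : ∀ᶠ w in 𝓝 (unitCoord E₀ G₀),
        unitParam E₀ G₀ z * unitParam E₀ G₀ w ∈ (chartAt E₀ (1 : G₀)).source :=
      (contMDiffAt_mul_unitParam _ unitCoord_mem).continuousAt.eventually_mem
        (by simpa using (chartAt E₀ (1 : G₀)).open_source.mem_nhds h1)
    filter_upwards [c1, eventually_unitParam_localHom (E := E) hι] with w hw hw2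
    simp only [localMul]
    rw [hw2]
    simp only [localHom]
    rw [unitParam_chart hw, unitParam_chart h2, map_mul]
  have hD : ContDiffAt ℝ ∞ (localHom E E₀ ι) z :=
    contDiffAt_unitChart_comp (contMDiffAt_hom_unitParam hι hz) h2
  have d1 : HasFDerivAt (fun w => localHom E E₀ ι (localMul E₀ G₀ (z, w)))
      ((fderiv ℝ (localHom E E₀ ι) z).comp (leftFrame E₀ G₀ z)) (unitCoord E₀ G₀) := by
    have a : HasFDerivAt (localHom E E₀ ι) (fderiv ℝ (localHom E E₀ ι) z)
        (localMul E₀ G₀ (z, unitCoord E₀ G₀)) := by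
      rw [localMul_unitCoord_right hz]; exact (hD.differentiableAt (by simp)).hasFDerivAt
    refine a.comp (unitCoord E₀ G₀) (f := fun w => localMul E₀ G₀ (z, w)) ?_
    refine DifferentiableAt.hasFDerivAt ?_
    exact ((localMul_contDiffAt_left hz).comp (unitCoord E₀ G₀)
      (contDiffAt_const.prodMk contDiffAt_id)).differentiableAt (by simp)
  have d2 : HasFDerivAt (fun w => localMul E G (localHom E E₀ ι z, localHom E E₀ ι w))
      ((leftFrame E G (localHom E E₀ ι z)).comp (unitDeriv E E₀ ι)) (unitCoord E₀ G₀) := by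
    refine HasFDerivAt.comp (g := fun w => localMul E G (localHom E E₀ ι z, w))
      (unitCoord E₀ G₀) ?_ (hasFDerivAt_localHom hι)
    rw [localHom_unitCoord]
    refine DifferentiableAt.hasFDerivAt ?_
    exact ((localMul_contDiffAt_left h3).comp (unitCoord E G)
      (contDiffAt_const.prodMk contDiffAt_id)).differentiableAt (by simp)
  exact d1.unique (d2.congr_of_eventuallyEq e1)

/-- The derivative of `leftFrame_hom`. The additional Hessian of the homomorphism is symmetric and
cancels in the bracket. -/
theorem mixedDeriv_hom (X Y : E₀) :
    fderiv ℝ (fderiv ℝ (localHom E E₀ ι)) (unitCoord E₀ G₀) X Y +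
      unitDeriv E E₀ ι (mixedDeriv E₀ G₀ X Y) =
      mixedDeriv E G (unitDeriv E E₀ ι X) (unitDeriv E E₀ ι Y) := by
  have h1 : ContDiffAt ℝ ∞ (fderiv ℝ (localHom E E₀ ι)) (unitCoord E₀ G₀) :=
    (contDiffAt_localHom hι).fderiv_right (m := ∞) (by simp)
  have d1 := ((h1.differentiableAt (by simp)).hasFDerivAt).clm_comp
    (hasFDerivAt_leftFrame (E := E₀) (G := G₀))
  have a : HasFDerivAt (leftFrame E G) (mixedDeriv E G)
      (localHom E E₀ ι (unitCoord E₀ G₀)) := by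
    rw [localHom_unitCoord]; exact hasFDerivAt_leftFrame
  have d2 := (a.comp (unitCoord E₀ G₀) (hasFDerivAt_localHom hι)).clm_comp
    (hasFDerivAt_const (unitDeriv E E₀ ι) (unitCoord E₀ G₀))
  have := d1.unique (d2.congr_of_eventuallyEq (leftFrame_hom hι))
  have := DFunLike.congr_fun (DFunLike.congr_fun this X) Y
  simpa [add_comm, unitDeriv] using this

/-- The differential of a homomorphism of Lie groups is a homomorphism of Lie algebras. -/
theorem unitDeriv_bracket (X Y : E₀) :
    unitDeriv E E₀ ι (unitBracket E₀ G₀ X Y) =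
      unitBracket E G (unitDeriv E E₀ ι X) (unitDeriv E E₀ ι Y) := by
  have hs : IsSymmSndFDerivAt ℝ (localHom E E₀ ι) (unitCoord E₀ G₀) :=
    (contDiffAt_localHom hι).isSymmSndFDerivAt (by simp; exact ENat.LEInfty.out)
  rw [unitBracket, unitBracket, ← mixedDeriv_hom hι, ← mixedDeriv_hom hι, map_sub, hs.eq X Y]
  abel

/-- The chain rule for left derivatives along a homomorphism of Lie groups. -/
theorem hasFDerivAt_comp_hom {f : G → F} {g : G}
    (hf : DifferentiableAt ℝ (fun z => f (g * unitParam E G z)) (unitCoord E G)) :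
    HasFDerivAt (fun z => f (g * ι (unitParam E₀ G₀ z)))
      ((leftDeriv f g).comp (unitDeriv E E₀ ι)) (unitCoord E₀ G₀) := by
  have a : HasFDerivAt (fun z => f (g * unitParam E G z)) (leftDeriv f g)
      (localHom E E₀ ι (unitCoord E₀ G₀)) := by
    rw [localHom_unitCoord]; exact hf.hasFDerivAt
  refine (a.comp (unitCoord E₀ G₀) (hasFDerivAt_localHom hι)).congr_of_eventuallyEq ?_
  filter_upwards [eventually_unitParam_localHom (E := E) hι] with z hz
  simp [hz]

end Hom

section LocallyConstant

theorem tendsto_mul_unitParam (g : G) :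
    Tendsto (fun z => g * unitParam E G z) (𝓝 (unitCoord E G)) (𝓝 g) := by
  simpa [ContinuousAt] using
    (contMDiffAt_mul_unitParam (E := E) g (unitCoord_mem (E := E) (G := G))).continuousAt

theorem tendsto_unitChart_inv_mul (g : G) :
    Tendsto (fun h => chartAt E (1 : G) (g⁻¹ * h)) (𝓝 g) (𝓝 (unitCoord E G)) := by
  have : IsTopologicalGroup G := topologicalGroup_of_lieGroup 𝓘(ℝ, E) ∞
  have h1 : Tendsto (fun h => g⁻¹ * h) (𝓝 g) (𝓝 1) := by
    have : ContinuousAt (fun h => g⁻¹ * h) g := by fun_prop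
    simpa [ContinuousAt] using this
  exact ((chartAt E (1 : G)).continuousAt (mem_chart_source E 1)).tendsto.comp h1

theorem eventually_mul_unitParam_chart (g : G) :
    ∀ᶠ h in 𝓝 g, g * unitParam E G (chartAt E (1 : G) (g⁻¹ * h)) = h := by
  have : IsTopologicalGroup G := topologicalGroup_of_lieGroup 𝓘(ℝ, E) ∞
  have : ContinuousAt (fun h => g⁻¹ * h) g := by fun_prop
  filter_upwards [this.eventually_mem (by simpa using source_mem_nhds (E := E))] with h hh
  rw [unitParam_chart hh]; group

theorem eventually_nhds_mul_unitParam {p : G → Prop} {g : G}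
    (h : ∀ᶠ z in 𝓝 (unitCoord E G), p (g * unitParam E G z)) : ∀ᶠ g' in 𝓝 g, p g' := by
  filter_upwards [(tendsto_unitChart_inv_mul g).eventually h,
    eventually_mul_unitParam_chart (E := E) g] with g' h1 h2
  rwa [h2] at h1

/-- A function with vanishing derivative is locally constant. -/
theorem eventually_eq_of_leftDeriv_eq_zero {f : G → F} {W : Set G} (hW : IsOpen W)
    (hf : ∀ g ∈ W, HasFDerivAt (fun z => f (g * unitParam E G z)) (0 : E →L[ℝ] F) (unitCoord E G))
    {g : G} (hg : g ∈ W) : ∀ᶠ g' in 𝓝 g, f g' = f g := by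
  have h1 : ∀ᶠ z in 𝓝 (unitCoord E G), g * unitParam E G z ∈ W :=
    (tendsto_mul_unitParam g).eventually_mem (hW.mem_nhds hg)
  obtain ⟨r, hr, hball⟩ := Metric.eventually_nhds_iff_ball.1
    (h1.and (target_mem_nhds (E := E) (G := G)))
  -- The hypothesis concerns each point of `W` in its own translated chart; the chain rule
  -- transports it to the whole ball of the single chart centred at `g`.
  have h2 : ∀ z ∈ Metric.ball (unitCoord E G) r,
      HasFDerivAt (fun w => f (g * unitParam E G w)) (0 : E →L[ℝ] F) z := by
    intro z hz
    have h := hf _ (hball z hz).1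
    have := fderiv_comp_eq_leftDeriv (φ := fun w => g * unitParam E G w) h.differentiableAt
      (contMDiffAt_mul_unitParam g (hball z hz).2)
    rwa [leftDeriv, h.fderiv, ContinuousLinearMap.zero_comp] at this
  apply eventually_nhds_mul_unitParam (E := E)
  filter_upwards [Metric.ball_mem_nhds _ hr] with z hz
  have := (convex_ball (unitCoord E G) r).is_const_of_fderivWithin_eq_zero (𝕜 := ℝ)
    (f := fun w => f (g * unitParam E G w))
    (fun w hw => (h2 w hw).differentiableAt.differentiableWithinAt)
    (fun w hw => by
      rw [fderivWithin_of_isOpen Metric.isOpen_ball hw, (h2 w hw).fderiv]) hz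
    (Metric.mem_ball_self hr)
  simpa using this

theorem eq_of_leftDeriv_eq_zero [PreconnectedSpace G] {f : G → F}
    (hf : ∀ g, HasFDerivAt (fun z => f (g * unitParam E G z)) (0 : E →L[ℝ] F) (unitCoord E G))
    (g g' : G) : f g = f g' := by
  have : IsLocallyConstant f := (IsLocallyConstant.iff_eventually_eq f).2 fun g =>
    eventually_eq_of_leftDeriv_eq_zero isOpen_univ (fun g _ => hf g) (Set.mem_univ g)
  exact this.apply_eq_of_preconnectedSpace g g'

end LocallyConstant

end LieGroupBracket

/-! ### The adjoint action and its unipotence for nilpotent groups -/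

section Adjoint

open Filter Topology

variable {E : Type*} [NormedAddCommGroup E] [NormedSpace ℝ E]
  {G : Type*} [TopologicalSpace G] [ChartedSpace E G] [Group G] [LieGroup 𝓘(ℝ, E) ∞ G]

/-- The adjoint action of a Lie group on its tangent space at the identity. -/
def conjDeriv (g : G) : E →L[ℝ] E :=
  fderiv ℝ (fun z => chartAt E (1 : G) (g * unitParam E G z * g⁻¹)) (unitCoord E G)

variable (E G) in
/-- The adjoint action of the Lie algebra. -/
def unitAd (X : E) : E →L[ℝ] E := mixedDeriv E G X - (mixedDeriv E G).flip X

theorem unitAd_apply (X Y : E) : unitAd E G X Y = unitBracket E G X Y := rfl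

@[simp] theorem conjDeriv_one : conjDeriv (E := E) (1 : G) = .id ℝ E := by
  rw [conjDeriv, ← fderiv_id (𝕜 := ℝ) (x := unitCoord E G)]
  apply Filter.EventuallyEq.fderiv_eq
  filter_upwards [target_mem_nhds (E := E) (G := G)] with z hz
  simp [chart_unitParam hz]

section Curves

variable {H : Type*} [NormedAddCommGroup H] [NormedSpace ℝ H] {φ ψ : H → G} {z : H}
  {A B : H →L[ℝ] E}

theorem hasFDerivAt_chart_mul (hφ : ContinuousAt φ z) (hψ : ContinuousAt ψ z)
    (hφ1 : φ z = 1) (hψ1 : ψ z = 1)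
    (hA : HasFDerivAt (fun w => chartAt E (1 : G) (φ w)) A z)
    (hB : HasFDerivAt (fun w => chartAt E (1 : G) (ψ w)) B z) :
    HasFDerivAt (fun w => chartAt E (1 : G) (φ w * ψ w)) (A + B) z := by
  have h : HasFDerivAt (localMul E G) (ContinuousLinearMap.fst ℝ E E +
      ContinuousLinearMap.snd ℝ E E) (chartAt E (1 : G) (φ z), chartAt E (1 : G) (ψ z)) := by
    rw [hφ1, hψ1]; exact hasFDerivAt_localMul
  have h' := h.comp z (hA.prodMk hB)
  have e : (ContinuousLinearMap.fst ℝ E E + ContinuousLinearMap.snd ℝ E E).comp (A.prod B) =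
      A + B := by ext; simp
  rw [e] at h'
  refine h'.congr_of_eventuallyEq ?_
  filter_upwards [hφ.eventually_mem (by rw [hφ1]; exact source_mem_nhds (E := E)),
    hψ.eventually_mem (by rw [hψ1]; exact source_mem_nhds (E := E))] with w h1 h2
  simp [localMul, unitParam_chart h1, unitParam_chart h2]

theorem hasFDerivAt_chart_conj (g : G) (hφ : ContinuousAt φ z) (hφ1 : φ z = 1)
    (hA : HasFDerivAt (fun w => chartAt E (1 : G) (φ w)) A z) :
    HasFDerivAt (fun w => chartAt E (1 : G) (g * φ w * g⁻¹)) ((conjDeriv g).comp A) z := by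
  have h : HasFDerivAt (fun z => chartAt E (1 : G) (g * unitParam E G z * g⁻¹)) (conjDeriv g)
      (chartAt E (1 : G) (φ z)) := by
    rw [hφ1]
    refine DifferentiableAt.hasFDerivAt ?_
    exact (contDiffAt_unitChart_comp ((contMDiffAt_mul_unitParam g unitCoord_mem).mul
      contMDiffAt_const) (by simp)).differentiableAt (by simp)
  refine (h.comp z hA).congr_of_eventuallyEq ?_
  filter_upwards [hφ.eventually_mem (by rw [hφ1]; exact source_mem_nhds (E := E))] with w h1
  simp [unitParam_chart h1]

/-- Apply the product rule at the identity to the constant `φ * φ⁻¹`. -/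
theorem hasFDerivAt_chart_inv (hφ : ContMDiffAt 𝓘(ℝ, H) 𝓘(ℝ, E) ∞ φ z) (hφ1 : φ z = 1)
    (hA : HasFDerivAt (fun w => chartAt E (1 : G) (φ w)) A z) :
    HasFDerivAt (fun w => chartAt E (1 : G) (φ w)⁻¹) (-A) z := by
  have hi : ContMDiffAt 𝓘(ℝ, H) 𝓘(ℝ, E) ∞ (fun w => (φ w)⁻¹) z := hφ.inv
  have hB := ((contDiffAt_unitChart_comp hi (by simp [hφ1])).differentiableAt
    (by simp)).hasFDerivAt
  have h := hasFDerivAt_chart_mul hφ.continuousAt hi.continuousAt hφ1 (by simp [hφ1]) hA hB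
  simp only [mul_inv_cancel] at h
  have := h.unique (hasFDerivAt_const _ z)
  rw [← eq_neg_iff_add_eq_zero.2 ((add_comm _ _).trans this)]
  exact hB

end Curves

/-- Differentiating `(z w z⁻¹) z = z w` in `w` at the identity says that the right frame composed
with `Ad z` is the left frame. Differentiating this in `z` gives the derivative of `Ad` as the
difference of the derivatives of the two frames. -/
theorem hasFDerivAt_conjDeriv :
    HasFDerivAt (fun z => conjDeriv (E := E) (unitParam E G z))
      (mixedDeriv E G - (mixedDeriv E G).flip) (unitCoord E G) := by
  let C : E × E → E := fun p =>
    chartAt E (1 : G) (unitParam E G p.1 * unitParam E G p.2 * (unitParam E G p.1)⁻¹)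
  have hC : ∀ z ∈ (chartAt E (1 : G)).target, ContDiffAt ℝ ∞ C (z, unitCoord E G) := by
    intro z hz
    refine contDiffAt_unitChart_comp (φ := fun p : E × E =>
      unitParam E G p.1 * unitParam E G p.2 * (unitParam E G p.1)⁻¹) ?_ (by simp)
    have A : ContMDiffAt 𝓘(ℝ, E × E) 𝓘(ℝ, E) ∞ (fun p : E × E => unitParam E G p.1)
        (z, unitCoord E G) :=
      ContMDiffAt.comp (g := unitParam E G) _ (contMDiffAt_unitParam hz)
        (contMDiffAt_iff_contDiffAt.2 contDiffAt_fst)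
    have B : ContMDiffAt 𝓘(ℝ, E × E) 𝓘(ℝ, E) ∞ (fun p : E × E => unitParam E G p.2)
        (z, unitCoord E G) :=
      ContMDiffAt.comp (g := unitParam E G) _ (contMDiffAt_unitParam unitCoord_mem)
        (contMDiffAt_iff_contDiffAt.2 contDiffAt_snd)
    exact (A.mul B).mul A.inv
  have hconj : ∀ z ∈ (chartAt E (1 : G)).target, conjDeriv (unitParam E G z) =
      (fderiv ℝ C (z, unitCoord E G)).comp (ContinuousLinearMap.inr ℝ E E) := fun z hz =>
    (HasFDerivAt.comp (f := fun e => (z, e)) (unitCoord E G)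
      ((hC z hz).differentiableAt (by simp)).hasFDerivAt
      (hasFDerivAt_prodMk_right (𝕜 := ℝ) z (unitCoord E G))).fderiv
  have hdiff : DifferentiableAt ℝ (fun z => conjDeriv (E := E) (unitParam E G z))
      (unitCoord E G) := by
    have h1 : ContDiffAt ℝ ∞ (fderiv ℝ C) (unitCoord E G, unitCoord E G) :=
      (hC _ unitCoord_mem).fderiv_right (m := ∞) (by simp)
    have h2 : ContDiffAt ℝ ∞ (fun z : E => fderiv ℝ C (z, unitCoord E G)) (unitCoord E G) :=
      ContDiffAt.comp (g := fderiv ℝ C) _ h1 (contDiffAt_id.prodMk contDiffAt_const)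
    refine ((h2.clm_comp (contDiffAt_const
      (c := ContinuousLinearMap.inr ℝ E E))).differentiableAt (by simp)).congr_of_eventuallyEq ?_
    filter_upwards [target_mem_nhds (E := E) (G := G)] with z hz using hconj z hz
  have hRL : ∀ᶠ z in 𝓝 (unitCoord E G),
      (rightFrame E G z).comp (conjDeriv (unitParam E G z)) = leftFrame E G z := by
    filter_upwards [target_mem_nhds (E := E) (G := G)] with z hz
    have a : HasFDerivAt (fun w => localMul E G (w, z)) (rightFrame E G z)
        (C (z, unitCoord E G)) := by
      have : C (z, unitCoord E G) = unitCoord E G := by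
        change chartAt E (1 : G) _ = _
        simp only [unitParam_unitCoord, mul_one, mul_inv_cancel]; rfl
      rw [this]
      refine DifferentiableAt.hasFDerivAt ?_
      exact ((localMul_contDiffAt_right hz).comp (unitCoord E G)
        (contDiffAt_id.prodMk contDiffAt_const)).differentiableAt (by simp)
    have b : HasFDerivAt (fun e => C (z, e)) (conjDeriv (unitParam E G z)) (unitCoord E G) := by
      rw [hconj z hz]
      exact HasFDerivAt.comp (f := fun e => (z, e)) (unitCoord E G)
        ((hC z hz).differentiableAt (by simp)).hasFDerivAt
        (hasFDerivAt_prodMk_right (𝕜 := ℝ) z (unitCoord E G))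
    have c := a.comp (unitCoord E G) b
    refine (c.congr_of_eventuallyEq ?_).fderiv.symm
    have hm : ∀ᶠ e in 𝓝 (unitCoord E G),
        unitParam E G z * unitParam E G e * (unitParam E G z)⁻¹ ∈ (chartAt E (1 : G)).source :=
      ContinuousAt.eventually_mem ((contMDiffAt_mul_unitParam (E := E) _ unitCoord_mem).mul
        (contMDiffAt_const (I' := 𝓘(ℝ, E)) (c := (unitParam E G z)⁻¹))).continuousAt
        (by simpa using source_mem_nhds (E := E))
    filter_upwards [hm] with e he
    simp [localMul, C, unitParam_chart he]
  have h1 := (hasFDerivAt_rightFrame (E := E) (G := G)).clm_comp hdiff.hasFDerivAt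
  have h2 := h1.unique (hasFDerivAt_leftFrame.congr_of_eventuallyEq hRL)
  have h3 : fderiv ℝ (fun z => conjDeriv (E := E) (unitParam E G z)) (unitCoord E G) =
      mixedDeriv E G - (mixedDeriv E G).flip := by
    ext X Y
    have := DFunLike.congr_fun (DFunLike.congr_fun h2 X) Y
    simp only [rightFrame_unitCoord, unitParam_unitCoord, conjDeriv_one] at this
    simp only [sub_apply, ContinuousLinearMap.flip_apply]
    rw [← this]
    simp
  rw [← h3]
  exact hdiff.hasFDerivAt

open scoped commutatorElement in
/-- In a nilpotent Lie group the adjoint action is unipotent, uniformly. -/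
theorem exists_pow_one_sub_conjDeriv (hG : Group.IsNilpotent G) :
    ∃ n : ℕ, ∀ g : G, (ContinuousLinearMap.id ℝ E - conjDeriv g) ^ n = 0 := by
  obtain ⟨n, hn⟩ := (Subgroup.isNilpotent_iff_lowerCentralSeries ⊤).1 (Group.isNilpotent_top.2 hG)
  refine ⟨n, fun g => ?_⟩
  -- Replacing `φ` by the commutator `⁅φ, g⁆` moves it one step down the lower central series and
  -- multiplies its derivative by `1 - Ad g`. After finitely many steps the map is constant.
  have key : ∀ k : ℕ, ∃ φ : E → G, ContMDiffAt 𝓘(ℝ, E) 𝓘(ℝ, E) ∞ φ (unitCoord E G) ∧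
      φ (unitCoord E G) = 1 ∧ (∀ z, φ z ∈ (⊤ : Subgroup G).lowerCentralSeries k) ∧
      HasFDerivAt (fun w => chartAt E (1 : G) (φ w))
        ((ContinuousLinearMap.id ℝ E - conjDeriv g) ^ k) (unitCoord E G) := by
    intro k
    induction k with
    | zero =>
      refine ⟨unitParam E G, contMDiffAt_unitParam unitCoord_mem, unitParam_unitCoord,
        fun z => by simp, ?_⟩
      rw [pow_zero]
      refine (hasFDerivAt_id (unitCoord E G)).congr_of_eventuallyEq ?_
      filter_upwards [target_mem_nhds (E := E) (G := G)] with w hw using chart_unitParam hw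
    | succ k ih =>
      obtain ⟨φ, h1, h2, h3, h4⟩ := ih
      refine ⟨fun z => φ z * (g * (φ z)⁻¹ * g⁻¹), h1.mul ((contMDiffAt_const.mul h1.inv).mul
        contMDiffAt_const), by simp [h2], fun z => ?_, ?_⟩
      · have : φ z * (g * (φ z)⁻¹ * g⁻¹) = ⁅φ z, g⁆ := by rw [commutatorElement_def]; group
        change φ z * (g * (φ z)⁻¹ * g⁻¹) ∈ _
        rw [this]
        exact Subgroup.commutator_mem_commutator (h3 z) (Subgroup.mem_top g)
      · have a := hasFDerivAt_chart_conj g h1.inv.continuousAt (by simp [h2])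
          (hasFDerivAt_chart_inv h1 h2 h4)
        have b := hasFDerivAt_chart_mul h1.continuousAt ((contMDiffAt_const.mul h1.inv).mul
          (contMDiffAt_const (I' := 𝓘(ℝ, E)) (c := g⁻¹))).continuousAt h2 (by simp [h2]) h4 a
        convert! b using 1
        rw [pow_succ']
        ext v
        simp [sub_eq_add_neg]
  obtain ⟨φ, -, h2, h3, h4⟩ := key n
  have : (fun w => chartAt E (1 : G) (φ w)) = fun _ => chartAt E (1 : G) 1 := by
    ext w
    have := h3 w
    rw [hn, Subgroup.mem_bot] at this
    rw [this]
  rw [this] at h4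
  exact h4.unique (hasFDerivAt_const _ _)

/-- `ad X` is the limit of the difference quotients `(Ad - 1) / t` along a curve with velocity `X`.
Their `n`-th powers vanish, hence so does `(ad X) ^ n`. -/
theorem exists_pow_unitAd_eq_zero (hG : Group.IsNilpotent G) :
    ∃ n : ℕ, ∀ X : E, unitAd E G X ^ n = 0 := by
  obtain ⟨n, hn⟩ := exists_pow_one_sub_conjDeriv (E := E) hG
  refine ⟨n, fun X => ?_⟩
  let f : ℝ → (E →L[ℝ] E) := fun t =>
    conjDeriv (unitParam E G (unitCoord E G + t • X)) - ContinuousLinearMap.id ℝ E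
  have hf : HasDerivAt f (unitAd E G X) 0 := by
    have a : HasFDerivAt (fun z => conjDeriv (E := E) (unitParam E G z))
      (mixedDeriv E G - (mixedDeriv E G).flip) (unitCoord E G + (0 : ℝ) • X) := by
      simpa using hasFDerivAt_conjDeriv
    have b : HasDerivAt (fun t : ℝ => unitCoord E G + t • X) X 0 := by
      simpa using ((hasDerivAt_id (0 : ℝ)).smul_const X).const_add (unitCoord E G)
    exact (a.comp_hasDerivAt 0 b).sub_const _
  have h1 := (hasDerivAt_iff_tendsto_slope.1 hf).pow n
  refine tendsto_nhds_unique h1 ?_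
  refine (tendsto_const_nhds (x := (0 : E →L[ℝ] E))).congr fun t => ?_
  have hp : f t ^ n = 0 := by
    have := hn (unitParam E G (unitCoord E G + t • X))
    rw [show f t = -(ContinuousLinearMap.id ℝ E - conjDeriv
      (unitParam E G (unitCoord E G + t • X))) from (neg_sub _ _).symm, neg_pow, this, mul_zero]
  have h0 : f 0 = 0 := by simp [f]
  rw [slope, h0, vsub_eq_sub, sub_zero (f t), smul_pow, hp, smul_zero]

end Adjoint

/-! ### Nilpotency of the Lie algebra of the real subgroup -/

section Nilpotent

variable {E : Type*} [NormedAddCommGroup E] [NormedSpace ℝ E]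
  {G : Type*} [TopologicalSpace G] [ChartedSpace E G] [Group G] [LieGroup 𝓘(ℝ, E) ∞ G]
  {E₀ : Type*} [NormedAddCommGroup E₀] [NormedSpace ℝ E₀] [FiniteDimensional ℝ E₀]
  {G₀ : Type*} [TopologicalSpace G₀] [ChartedSpace E₀ G₀] [Group G₀] [LieGroup 𝓘(ℝ, E₀) ∞ G₀]

variable (E) in
/-- The differential at the identity of a homomorphism of Lie groups, on the Lie algebra. -/
def lieDeriv (ι : G₀ →* G) : GroupLieAlgebra 𝓘(ℝ, E₀) G₀ →ₗ[ℝ] E :=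
  (unitDeriv E E₀ ι).toLinearMap

theorem lieDeriv_bracket {ι : G₀ →* G} (hι : ContMDiff 𝓘(ℝ, E₀) 𝓘(ℝ, E) ∞ ι)
    (X Y : GroupLieAlgebra 𝓘(ℝ, E₀) G₀) :
    lieDeriv E ι ⁅X, Y⁆ = unitBracket E G (lieDeriv E ι X) (lieDeriv E ι Y) := by
  rw [groupLieAlgebra_bracket_eq]
  exact unitDeriv_bracket hι X Y

/-- An immersed Lie subgroup of a nilpotent Lie group has a nilpotent Lie algebra. -/
theorem lieRing_isNilpotent_of_immersion {ι : G₀ →* G} (hι : ContMDiff 𝓘(ℝ, E₀) 𝓘(ℝ, E) ∞ ι)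
    (hinj : Function.Injective (lieDeriv E (E₀ := E₀) ι)) (hG : Group.IsNilpotent G) :
    LieRing.IsNilpotent (GroupLieAlgebra 𝓘(ℝ, E₀) G₀) := by
  obtain ⟨n, hn⟩ := exists_pow_unitAd_eq_zero (E := E) hG
  have : FiniteDimensional ℝ (GroupLieAlgebra 𝓘(ℝ, E₀) G₀) := inferInstanceAs
    (FiniteDimensional ℝ E₀)
  -- Engel's theorem: it suffices that each `ad X` is nilpotent, and this is inherited through the
  -- injective differential, which intertwines the adjoint actions.
  rw [LieAlgebra.isNilpotent_iff_forall (R := ℝ)]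
  intro X
  refine ⟨n, ?_⟩
  have key : ∀ (k : ℕ) (Y : GroupLieAlgebra 𝓘(ℝ, E₀) G₀),
      lieDeriv E ι ((LieAlgebra.ad ℝ (GroupLieAlgebra 𝓘(ℝ, E₀) G₀) X ^ k) Y) =
        (unitAd E G (lieDeriv E ι X) ^ k) (lieDeriv E ι Y) := by
    intro k
    induction k with
    | zero => intro Y; rfl
    | succ k ih =>
      intro Y
      rw [pow_succ', pow_succ', Module.End.mul_apply, LieAlgebra.ad_apply,
        mul_apply_eq_comp, ← ih, unitAd_apply, ← lieDeriv_bracket hι]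
  ext Y
  apply hinj
  rw [key, hn, LinearMap.zero_apply, map_zero, zero_apply]

end Nilpotent

/-! ### Invariant means and amenability of nilpotent groups -/

section InvariantMean

/-- A real function is bounded. -/
def IsBddFun {α : Type*} (f : α → ℝ) : Prop := ∃ C, ∀ x, |f x| ≤ C

/-- A left invariant mean on a group: a linear functional on real functions which is positive and
left invariant on bounded functions, and normalized. -/
structure IsInvariantMean {G : Type*} [Group G] (M : (G → ℝ) →ₗ[ℝ] ℝ) : Prop where
  nonneg : ∀ f : G → ℝ, IsBddFun f → (∀ x, 0 ≤ f x) → 0 ≤ M f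
  one : M (fun _ => 1) = 1
  invariant : ∀ (h : G) (f : G → ℝ), IsBddFun f → M (fun g => f (h * g)) = M f

theorem isBddFun_const {α : Type*} (c : ℝ) : IsBddFun (fun _ : α => c) := ⟨|c|, fun _ => le_rfl⟩

theorem IsBddFun.sub {α : Type*} {f g : α → ℝ} (hf : IsBddFun f) (hg : IsBddFun g) :
    IsBddFun (fun x => f x - g x) := by
  obtain ⟨C, hC⟩ := hf
  obtain ⟨D, hD⟩ := hg
  exact ⟨C + D, fun x => (abs_sub _ _).trans (add_le_add (hC x) (hD x))⟩

theorem IsBddFun.comp {α β : Type*} {f : α → ℝ} (hf : IsBddFun f) (φ : β → α) :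
    IsBddFun (fun x => f (φ x)) := by
  obtain ⟨C, hC⟩ := hf
  exact ⟨C, fun x => hC _⟩

namespace IsInvariantMean

variable {G : Type*} [Group G] {M : (G → ℝ) →ₗ[ℝ] ℝ} (hM : IsInvariantMean M)
include hM

theorem map_const (c : ℝ) : M (fun _ => c) = c := by
  have : (fun _ : G => c) = c • (fun _ : G => (1 : ℝ)) := by ext; simp
  rw [this, map_smul, hM.one]; simp

theorem mono {f g : G → ℝ} (hf : IsBddFun f) (hg : IsBddFun g) (h : ∀ x, f x ≤ g x) :
    M f ≤ M g := by
  have := hM.nonneg (g - f) (hg.sub hf) fun x => sub_nonneg.2 (h x)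
  rw [map_sub] at this
  linarith

theorem le_of_forall_le {f : G → ℝ} (hf : IsBddFun f) {c : ℝ} (h : ∀ x, f x ≤ c) : M f ≤ c :=
  (hM.mono hf (isBddFun_const c) h).trans_eq (hM.map_const c)

theorem ge_of_forall_ge {f : G → ℝ} (hf : IsBddFun f) {c : ℝ} (h : ∀ x, c ≤ f x) : c ≤ M f :=
  (hM.map_const c).symm.trans_le (hM.mono (isBddFun_const c) hf h)

theorem abs_le {f : G → ℝ} {c : ℝ} (h : ∀ x, |f x| ≤ c) : |M f| ≤ c :=
  _root_.abs_le.2 ⟨hM.ge_of_forall_ge ⟨c, h⟩ fun x => (_root_.abs_le.1 (h x)).1,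
    hM.le_of_forall_le ⟨c, h⟩ fun x => (_root_.abs_le.1 (h x)).2⟩

end IsInvariantMean

/-- The bounded real functions on a type. -/
def bddFun (α : Type*) : Submodule ℝ (α → ℝ) where
  carrier := {f | IsBddFun f}
  add_mem' := by
    rintro f g ⟨C, hC⟩ ⟨D, hD⟩
    exact ⟨C + D, fun x => (abs_add_le _ _).trans (add_le_add (hC x) (hD x))⟩
  zero_mem' := isBddFun_const 0
  smul_mem' := by
    rintro c f ⟨C, hC⟩
    exact ⟨|c| * C, fun x => by
      simpa [abs_mul] using mul_le_mul_of_nonneg_left (hC x) (abs_nonneg c)⟩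

section Commutative

variable {G : Type*} [Group G]

/-- The numbers that bound some average of translates of `f`. -/
def averageBounds (f : G → ℝ) : Set ℝ :=
  {s | ∃ (n : ℕ) (φ : Fin n → G), 0 < n ∧ ∀ x, ∑ i, f (φ i * x) ≤ n * s}

theorem mem_averageBounds {f : G → ℝ} {C : ℝ} (h : ∀ x, f x ≤ C) : C ∈ averageBounds f :=
  ⟨1, fun _ => 1, one_pos, fun x => by simpa using h x⟩

theorem le_of_mem_averageBounds {f : G → ℝ} {C s : ℝ} (h : ∀ x, -C ≤ f x)
    (hs : s ∈ averageBounds f) : -C ≤ s := by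
  obtain ⟨n, φ, hn, hφ⟩ := hs
  have h1 : ∑ _i : Fin n, (-C) ≤ ∑ i, f (φ i * 1) := Finset.sum_le_sum fun i _ => h _
  have h2 := h1.trans (hφ 1)
  simp only [Finset.sum_const, Finset.card_univ, Fintype.card_fin, nsmul_eq_mul] at h2
  exact le_of_mul_le_mul_left h2 (by exact_mod_cast hn)

/-- Averaging over all products `φ i * ψ j` serves both functions: for `f` sum over `i` first, for
`g` commute the factors and sum over `j` first. This is the subadditivity needed for Hahn–Banach. -/
theorem add_mem_averageBounds (hcomm : ∀ a b : G, a * b = b * a) {f g : G → ℝ} {s t : ℝ}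
    (hs : s ∈ averageBounds f) (ht : t ∈ averageBounds g) :
    s + t ∈ averageBounds (fun x => f x + g x) := by
  obtain ⟨n, φ, hn, hφ⟩ := hs
  obtain ⟨m, ψ, hm, hψ⟩ := ht
  refine ⟨n * m, fun k => φ (finProdFinEquiv.symm k).1 * ψ (finProdFinEquiv.symm k).2,
    Nat.mul_pos hn hm, fun x => ?_⟩
  rw [← finProdFinEquiv.sum_comp]
  simp only [Equiv.symm_apply_apply, Fintype.sum_prod_type, Finset.sum_add_distrib]
  have h1 : ∑ i, ∑ j, f (φ i * ψ j * x) ≤ m * (n * s) := by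
    rw [Finset.sum_comm]
    refine (Finset.sum_le_sum (g := fun _ => n * s) fun j _ => ?_).trans_eq (by simp)
    simpa [mul_assoc] using hφ (ψ j * x)
  have h2 : ∑ i, ∑ j, g (φ i * ψ j * x) ≤ n * (m * t) := by
    refine (Finset.sum_le_sum (g := fun _ => m * t) fun i _ => ?_).trans_eq (by simp)
    simpa [mul_assoc, hcomm (φ i)] using hψ (φ i * x)
  push_cast
  nlinarith

theorem smul_mem_averageBounds {f : G → ℝ} {s c : ℝ} (hc : 0 < c) (hs : s ∈ averageBounds f) :
    c * s ∈ averageBounds (fun x => c * f x) := by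
  obtain ⟨n, φ, hn, hφ⟩ := hs
  refine ⟨n, φ, hn, fun x => ?_⟩
  rw [← Finset.mul_sum]
  nlinarith [mul_le_mul_of_nonneg_left (hφ x) hc.le]

/-- Commutative groups are amenable. -/
theorem exists_isInvariantMean_of_comm (hcomm : ∀ a b : G, a * b = b * a) :
    ∃ M : (G → ℝ) →ₗ[ℝ] ℝ, IsInvariantMean M := by
  let N : bddFun G → ℝ := fun f => sInf (averageBounds f.1)
  have hne : ∀ f : bddFun G, (averageBounds f.1).Nonempty := fun f => by
    obtain ⟨C, hC⟩ := f.2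
    exact ⟨C, mem_averageBounds fun x => (abs_le.1 (hC x)).2⟩
  have hbdd : ∀ f : bddFun G, BddBelow (averageBounds f.1) := fun f => by
    obtain ⟨C, hC⟩ := f.2
    exact ⟨-C, fun s hs => le_of_mem_averageBounds (fun x => (abs_le.1 (hC x)).1) hs⟩
  have hN : ∀ (f : bddFun G) (s : ℝ), s ∈ averageBounds f.1 → N f ≤ s :=
    fun f s hs => csInf_le (hbdd f) hs
  have hle : ∀ c : ℝ, 0 < c → ∀ f : bddFun G, N (c • f) ≤ c * N f := by
    intro c hc f
    rw [← div_le_iff₀' hc]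
    refine le_csInf (hne f) fun s hs => ?_
    rw [div_le_iff₀' hc]
    exact hN _ _ (smul_mem_averageBounds hc hs)
  -- Hahn–Banach, extending the zero functional on the zero subspace. Domination by `N` alone forces
  -- positivity, normalization and invariance.
  obtain ⟨M, -, hM⟩ := exists_extension_of_le_sublinear (E := bddFun G) ⊥ N
    (fun c hc f => le_antisymm (hle c hc f) (by
      have := hle c⁻¹ (inv_pos.2 hc) (c • f)
      rw [smul_smul, inv_mul_cancel₀ hc.ne', one_smul, inv_mul_eq_div, le_div_iff₀' hc] at this
      exact this))
    (fun f g => by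
      rw [← sub_le_iff_le_add]
      refine le_csInf (hne f) fun s hs => ?_
      rw [sub_le_comm]
      refine le_csInf (hne g) fun t ht => ?_
      rw [sub_le_iff_le_add']
      exact hN _ _ (add_mem_averageBounds hcomm hs ht))
    (by
      rintro ⟨x, hx⟩
      have hx' : x = 0 := (Submodule.mem_bot ℝ).1 hx
      subst hx'
      change (0 : ℝ) ≤ _
      refine le_csInf (hne 0) fun s hs => ?_
      have := le_of_mem_averageBounds (C := 0) (fun x => by simp) hs
      simpa using this)
  -- Any linear extension to unbounded functions will do, since positivity and invariance are only
  -- required on bounded ones.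
  obtain ⟨M', hM'⟩ := M.exists_extend
  have hext : ∀ (f : G → ℝ) (hf : IsBddFun f), M' f = M ⟨f, hf⟩ :=
    fun f hf => LinearMap.congr_fun hM' ⟨f, hf⟩
  have hub : ∀ (f : G → ℝ) (hf : IsBddFun f) (s : ℝ), s ∈ averageBounds f → M' f ≤ s :=
    fun f hf s hs => (hext f hf).trans_le ((hM _).trans (hN _ _ hs))
  have hnonneg : ∀ f : G → ℝ, IsBddFun f → (∀ x, 0 ≤ f x) → 0 ≤ M' f := by
    intro f hf h0
    have := hub (-f) ((bddFun G).neg_mem hf) 0 (mem_averageBounds fun x => by simpa using h0 x)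
    rw [map_neg] at this
    linarith
  have hle : ∀ (h : G) (f : G → ℝ), IsBddFun f → M' (fun g => f (h * g)) ≤ M' f := by
    intro h f hf
    have hd : IsBddFun (fun g => f (h * g) - f g) := (hf.comp _).sub hf
    have key : M' (fun g => f (h * g) - f g) ≤ 0 := by
      obtain ⟨C, hC⟩ := hf
      -- Averaging the difference over translates by `h ^ 0, …, h ^ n` telescopes to two boundary
      -- terms.
      have hCn : ∀ n : ℕ, M' (fun g => f (h * g) - f g) ≤ 2 * C / (n + 1 : ℕ) := by
        intro n
        refine hub _ hd _ ⟨n + 1, fun i => h ^ (i : ℕ), Nat.succ_pos n, fun x => ?_⟩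
        rw [Fin.sum_univ_eq_sum_range (fun i => f (h * (h ^ i * x)) - f (h ^ i * x)) (n + 1)]
        have e : ∀ i : ℕ, f (h * (h ^ i * x)) - f (h ^ i * x) =
            f (h ^ (i + 1) * x) - f (h ^ i * x) := fun i => by rw [pow_succ', mul_assoc]
        simp only [e]
        rw [Finset.sum_range_sub (fun i => f (h ^ i * x)), mul_div_cancel₀ _ (by positivity)]
        linarith [(abs_le.1 (hC (h ^ (n + 1) * x))).2, (abs_le.1 (hC (h ^ 0 * x))).1]
      have hlim : Filter.Tendsto (fun n : ℕ => 2 * C / (n + 1 : ℕ)) Filter.atTop (nhds 0) :=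
        (tendsto_const_div_atTop_nhds_zero_nat (2 * C)).comp (Filter.tendsto_add_atTop_nat 1)
      exact ge_of_tendsto' hlim hCn
    have e : (fun g => f (h * g) - f g) = (fun g => f (h * g)) - f := rfl
    rw [e, map_sub] at key
    linarith
  refine ⟨M', hnonneg, le_antisymm ?_ ?_, fun h f hf => le_antisymm (hle h f hf) ?_⟩
  · exact hub _ (isBddFun_const 1) 1 (mem_averageBounds fun _ => le_rfl)
  · have := hub (fun _ => -1) (isBddFun_const (-1)) (-1) (mem_averageBounds fun _ => le_rfl)
    have e : (fun _ : G => (-1 : ℝ)) = -fun _ => 1 := rfl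
    rw [e, map_neg] at this
    linarith
  · simpa using hle h⁻¹ (fun g => f (h * g)) (hf.comp _)

end Commutative

/-- Amenability passes to central extensions. -/
theorem exists_isInvariantMean_of_quotient_center {G : Type*} [Group G]
    (hQ : ∃ M : (G ⧸ Subgroup.center G → ℝ) →ₗ[ℝ] ℝ, IsInvariantMean M) :
    ∃ M : (G → ℝ) →ₗ[ℝ] ℝ, IsInvariantMean M := by
  obtain ⟨MQ, hMQ⟩ := hQ
  obtain ⟨MZ, hMZ⟩ := exists_isInvariantMean_of_comm (G := Subgroup.center G) fun a b =>
    Subtype.ext (a.2.comm b)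
  let A : (G → ℝ) →ₗ[ℝ] (G ⧸ Subgroup.center G → ℝ) := LinearMap.pi fun q =>
    MZ ∘ₗ LinearMap.funLeft ℝ ℝ (fun z : Subgroup.center G => q.out * (z : G))
  have hA : ∀ f q, A f q = MZ (fun z => f (q.out * (z : G))) := fun f q => rfl
  -- The average over a coset of the centre does not depend on the representative, by invariance of
  -- `MZ`.
  have hcoset : ∀ f : G → ℝ, IsBddFun f → ∀ g : G,
      A f (g : G ⧸ Subgroup.center G) = MZ (fun z => f (g * (z : G))) := by
    intro f hf g
    obtain ⟨z, hz⟩ := QuotientGroup.mk_out_eq_mul (Subgroup.center G) g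
    rw [hA, hz, ← hMZ.invariant z (fun z => f (g * (z : G))) (hf.comp _)]
    simp [mul_assoc]
  have hbdd : ∀ f : G → ℝ, IsBddFun f → IsBddFun (A f) := by
    rintro f ⟨C, hC⟩
    exact ⟨C, fun q => hMZ.abs_le fun z => hC _⟩
  refine ⟨MQ ∘ₗ A, fun f hf h0 => ?_, ?_, fun h f hf => ?_⟩
  · exact hMQ.nonneg _ (hbdd f hf) fun q => hMZ.nonneg _ (hf.comp _) fun z => h0 _
  · have : A (fun _ => 1) = fun _ => 1 := by ext q; rw [hA]; exact hMZ.one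
    rw [LinearMap.comp_apply, this, hMQ.one]
  · rw [LinearMap.comp_apply, LinearMap.comp_apply,
      ← hMQ.invariant (h : G ⧸ Subgroup.center G) (A f) (hbdd f hf)]
    congr 1
    ext q
    obtain ⟨g, rfl⟩ := QuotientGroup.mk_surjective q
    rw [← QuotientGroup.mk_mul, hcoset _ hf, hcoset _ (hf.comp _)]
    simp [mul_assoc]

/-- Nilpotent groups are amenable. -/
theorem exists_isInvariantMean_of_isNilpotent (G : Type*) [Group G] [Group.IsNilpotent G] :
    ∃ M : (G → ℝ) →ₗ[ℝ] ℝ, IsInvariantMean M := by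
  refine Group.nilpotent_center_quotient_ind (P := fun G _ _ =>
    ∃ M : (G → ℝ) →ₗ[ℝ] ℝ, IsInvariantMean M) G ?_ ?_
  · intro G _ _
    exact exists_isInvariantMean_of_comm fun a b => Subsingleton.elim _ _
  · intro G _ _ ih
    exact exists_isInvariantMean_of_quotient_center ih

end InvariantMean

/-! ### Complex Lie groups as real Lie groups -/

section RealStructure

open Filter Topology

theorem fderiv_real_smul {E F : Type*} [NormedAddCommGroup E] [NormedSpace ℂ E]
    [NormedAddCommGroup F] [NormedSpace ℂ F] {f : E → F} {z : E} (hf : DifferentiableAt ℂ f z)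
    (a : ℂ) (v : E) : fderiv ℝ f z (a • v) = a • fderiv ℝ f z v := by
  rw [(hf.hasFDerivAt.restrictScalars ℝ).fderiv]
  simp

variable {E : Type*} [NormedAddCommGroup E] [NormedSpace ℂ E]
  {F : Type*} [NormedAddCommGroup F] [NormedSpace ℂ F]
  {G : Type*} [TopologicalSpace G] [ChartedSpace E G] [Group G]

theorem ContMDiffAt.restrict_real {M N : Type*} [TopologicalSpace M] [ChartedSpace E M]
    [TopologicalSpace N] [ChartedSpace F N] {f : M → N} {x : M}
    (hf : ContMDiffAt 𝓘(ℂ, E) 𝓘(ℂ, F) ω f x) : ContMDiffAt 𝓘(ℝ, E) 𝓘(ℝ, F) ∞ f x := by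
  rw [contMDiffAt_iff] at hf ⊢
  refine ⟨hf.1, ?_⟩
  exact (hf.2.restrict_scalars ℝ).of_le (m := ∞) (by simp)

theorem ContMDiff.restrict_real {M N : Type*} [TopologicalSpace M] [ChartedSpace E M]
    [TopologicalSpace N] [ChartedSpace F N] {f : M → N}
    (hf : ContMDiff 𝓘(ℂ, E) 𝓘(ℂ, F) ω f) : ContMDiff 𝓘(ℝ, E) 𝓘(ℝ, F) ∞ f :=
  fun x => (hf x).restrict_real

theorem isManifold_real (M : Type*) [TopologicalSpace M] [ChartedSpace E M]
    [IsManifold 𝓘(ℂ, E) ω M] : IsManifold 𝓘(ℝ, E) ∞ M := by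
  apply isManifold_of_contDiffOn
  intro e e' he he'
  have h := (contDiffGroupoid ω 𝓘(ℂ, E)).compatible he he'
  replace h := (mem_groupoid_of_pregroupoid.1 h).1
  exact (h.restrict_scalars ℝ).of_le (m := ∞) (by simp)

theorem lieGroup_real [LieGroup 𝓘(ℂ, E) ω G] : LieGroup 𝓘(ℝ, E) ∞ G := by
  have := isManifold_real (E := E) G
  refine { contMDiff_mul := ?_, contMDiff_inv := ?_ }
  · have h := contMDiff_mul 𝓘(ℂ, E) ω (G := G)
    intro x
    have h2 := contMDiffAt_iff.1 (h x)
    rw [contMDiffAt_iff]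
    refine ⟨h2.1, ?_⟩
    have := (h2.2.restrict_scalars ℝ).of_le (m := ∞) (by simp)
    convert! this using 1
  · exact (contMDiff_inv 𝓘(ℂ, E) ω (G := G)).restrict_real

variable [LieGroup 𝓘(ℂ, E) ω G]

theorem holo_unitParam {z : E} (hz : z ∈ (chartAt E (1 : G)).target) :
    ContMDiffAt 𝓘(ℂ, E) 𝓘(ℂ, E) ω (unitParam E G) z :=
  contMDiffOn_chart_symm.contMDiffAt ((chartAt E (1 : G)).open_target.mem_nhds hz)

theorem holo_chart_comp (p : G) {φ : F → G} {z : F} (hφ : ContMDiffAt 𝓘(ℂ, F) 𝓘(ℂ, E) ω φ z)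
    (hz : φ z ∈ (chartAt E p).source) :
    DifferentiableAt ℂ (fun w => chartAt E p (φ w)) z :=
  (contMDiffAt_iff_contDiffAt.1 (ContMDiffAt.comp (g := chartAt E p) z
    (contMDiffOn_chart.contMDiffAt ((chartAt E p).open_source.mem_nhds hz)) hφ)).differentiableAt
    (by simp)

theorem leftFrame_smul {z : E} (hz : z ∈ (chartAt E (1 : G)).target) (a : ℂ) (v : E) :
    leftFrame E G z (a • v) = a • leftFrame E G z v :=
  fderiv_real_smul (holo_chart_comp (G := G) 1
    (φ := fun w => unitParam E G z * unitParam E G w)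
    (contMDiffAt_const.mul (holo_unitParam unitCoord_mem)) (by simpa using unitParam_mem hz)) a v

theorem rightFrame_smul {z : E} (hz : z ∈ (chartAt E (1 : G)).target) (a : ℂ) (v : E) :
    rightFrame E G z (a • v) = a • rightFrame E G z v :=
  fderiv_real_smul (holo_chart_comp (G := G) 1
    (φ := fun w => unitParam E G w * unitParam E G z)
    ((holo_unitParam unitCoord_mem).mul contMDiffAt_const) (by simpa using unitParam_mem hz)) a v

/-- The derivative of a family of complex linear maps is complex linear. -/
theorem hasFDerivAt_smul_of_eventually {f : E → (F →L[ℝ] F)} {f' : E →L[ℝ] F →L[ℝ] F} {z : E}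
    (hf : HasFDerivAt f f' z) (a : ℂ) (v : F) (h : ∀ᶠ w in 𝓝 z, f w (a • v) = a • f w v) (X : E) :
    f' X (a • v) = a • f' X v := by
  have h1 := hf.clm_apply (hasFDerivAt_const (a • v) z)
  have h2 := (hf.clm_apply (hasFDerivAt_const v z)).const_smul a
  have := DFunLike.congr_fun (h1.unique (h2.congr_of_eventuallyEq h)) X
  simpa using this

/-- Near the identity the left frame is pointwise complex linear, and its derivative inherits this
in the second slot. The right frame does the same for the first slot, so the bracket is complex
bilinear although all derivatives are real. -/
theorem mixedDeriv_smul_right (a : ℂ) (X Y : E) :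
    mixedDeriv E G X (a • Y) = a • mixedDeriv E G X Y := by
  have := lieGroup_real (E := E) (G := G)
  refine hasFDerivAt_smul_of_eventually hasFDerivAt_leftFrame a Y ?_ X
  filter_upwards [target_mem_nhds (E := E) (G := G)] with z hz using leftFrame_smul hz a Y

theorem mixedDeriv_smul_left (a : ℂ) (X Y : E) :
    mixedDeriv E G (a • X) Y = a • mixedDeriv E G X Y := by
  have := lieGroup_real (E := E) (G := G)
  refine hasFDerivAt_smul_of_eventually hasFDerivAt_rightFrame a X ?_ Y
  filter_upwards [target_mem_nhds (E := E) (G := G)] with z hz using rightFrame_smul hz a X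

theorem unitBracket_smul_right (a : ℂ) (X Y : E) :
    unitBracket E G X (a • Y) = a • unitBracket E G X Y := by
  rw [unitBracket, unitBracket, mixedDeriv_smul_right, mixedDeriv_smul_left, smul_sub]

theorem unitBracket_smul_left (a : ℂ) (X Y : E) :
    unitBracket E G (a • X) Y = a • unitBracket E G X Y := by
  rw [unitBracket, unitBracket, mixedDeriv_smul_right, mixedDeriv_smul_left, smul_sub]

theorem unitBracket_add_left (X X' Y : E) :
    unitBracket E G (X + X') Y = unitBracket E G X Y + unitBracket E G X' Y := by
  simp only [unitBracket, map_add, add_apply]; abel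

theorem unitBracket_add_right (X Y Y' : E) :
    unitBracket E G X (Y + Y') = unitBracket E G X Y + unitBracket E G X Y' := by
  simp only [unitBracket, map_add, add_apply]; abel

end RealStructure

/-! ### The Poincaré lemma on a simply connected Lie group -/

section Primitive

open Filter Topology

/-- On a simply connected space, locally defined functions which differ by locally constant
functions can be corrected by locally constant functions to a global function. -/
theorem exists_forall_eventually_sub_eq {X F : Type*} [TopologicalSpace X] [SimplyConnectedSpace X]
    [LocallyPathConnectedSpace X] [AddCommGroup F] (U : X → Set X) (hU : ∀ x, IsOpen (U x))
    (hx : ∀ x, x ∈ U x) (f : X → X → F)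
    (hf : ∀ i j, ∀ x ∈ U i ∩ U j, ∀ᶠ y in 𝓝 x, f i y - f j y = f i x - f j x) :
    ∃ s : X → F, ∀ i, ∀ x ∈ U i, ∀ᶠ y in 𝓝 x, s y - f i y = s x - f i x := by
  let : TopologicalSpace F := ⊥
  have : DiscreteTopology F := ⟨rfl⟩
  -- The differences `f i - f j` are locally constant, so translation by them glues copies of the
  -- discrete group `F` into a covering space of `X`.
  let Z : FiberBundleCore X X F :=
    { baseSet := U
      isOpen_baseSet := hU
      indexAt := id
      mem_baseSet_at := hx
      coordChange := fun i j x v => v + (f i x - f j x)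
      coordChange_self := fun i x _ v => by simp
      continuousOn_coordChange := fun i j => by
        rintro ⟨x, v⟩ ⟨hxU, -⟩
        apply ContinuousAt.continuousWithinAt
        have h1 : ContinuousAt (fun y => f i y - f j y) x :=
          continuousAt_const.congr ((hf i j x hxU).mono fun y hy => hy.symm)
        have h2 : ContinuousAt (fun p : X × F => f i p.1 - f j p.1) (x, v) :=
          ContinuousAt.comp (g := fun y => f i y - f j y) (f := Prod.fst) h1 continuousAt_fst
        have h3 : Continuous fun p : F × F => p.1 + p.2 := continuous_of_discreteTopology
        exact h3.continuousAt.comp (continuousAt_snd.prodMk h2)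
      coordChange_comp := fun i j k x _ v => by abel }
  have hcov : IsCoveringMap (Bundle.TotalSpace.proj : Z.TotalSpace → X) :=
    FiberBundle.isCoveringMap (F := F) (E := Z.Fiber)
  have hne : Nonempty X := inferInstance
  obtain ⟨a⟩ := hne
  -- Simple connectedness lifts the identity to a section; its fibre coordinate is the locally
  -- constant correction.
  obtain ⟨σ, ⟨-, hσ⟩, -⟩ := hcov.existsUnique_continuousMap_lifts (ContinuousMap.id X) a
    (⟨a, (0 : F)⟩ : Z.TotalSpace) rfl
  have hσ' : ∀ x, (σ x).proj = x := fun x => congrFun hσ x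
  have val : ∀ i y, ((Z.localTriv i) (σ y)).2 =
      (show F from (σ y).snd) + (f y y - f i y) := fun i y => by
    rw [FiberBundleCore.localTriv_apply]
    change _ + (f (σ y).proj (σ y).proj - f i (σ y).proj) = _
    rw [hσ' y]
  refine ⟨fun x => (show F from (σ x).snd) + f x x, fun i x hxi => ?_⟩
  have hc : ContinuousAt (fun y => ((Z.localTriv i) (σ y)).2) x := by
    have h1 : ContinuousAt (Z.localTriv i) (σ x) :=
      (Z.localTriv i).continuousAt ((Z.mem_localTriv_source i (σ x)).2 (by
        rw [← Z.baseSet_at, hσ' x]; exact hxi))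
    exact continuous_snd.continuousAt.comp (ContinuousAt.comp h1 σ.continuous.continuousAt)
  have := hc.eventually_mem (isOpen_discrete {((Z.localTriv i) (σ x)).2} |>.mem_nhds rfl)
  filter_upwards [this] with y hy
  have hy' : ((Z.localTriv i) (σ y)).2 = ((Z.localTriv i) (σ x)).2 := hy
  rw [val, val] at hy'
  rw [add_sub_assoc, add_sub_assoc, hy']

variable {E : Type*} [NormedAddCommGroup E] [NormedSpace ℝ E]
  {G : Type*} [TopologicalSpace G] [ChartedSpace E G] [Group G] [LieGroup 𝓘(ℝ, E) ∞ G]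
  {F : Type*} [NormedAddCommGroup F] [NormedSpace ℝ F]

variable (E G) in
/-- The left invariant coframe in the chart at the identity. -/
def coframe (z : E) : E →L[ℝ] E :=
  fderiv ℝ (fun w => chartAt E (1 : G) ((unitParam E G z)⁻¹ * unitParam E G w)) z

theorem contDiffAt_chart_inv_mul {z : E} (hz : z ∈ (chartAt E (1 : G)).target) :
    ContDiffAt ℝ ∞ (fun p : E × E => chartAt E (1 : G)
      ((unitParam E G p.1)⁻¹ * unitParam E G p.2)) (z, z) := by
  refine contDiffAt_unitChart_comp
    (φ := fun p : E × E => (unitParam E G p.1)⁻¹ * unitParam E G p.2) ?_ (by simp)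
  have A : ContMDiffAt 𝓘(ℝ, E × E) 𝓘(ℝ, E) ∞ (fun p : E × E => p.1) (z, z) :=
    contMDiffAt_iff_contDiffAt.2 contDiffAt_fst
  have B : ContMDiffAt 𝓘(ℝ, E × E) 𝓘(ℝ, E) ∞ (fun p : E × E => p.2) (z, z) :=
    contMDiffAt_iff_contDiffAt.2 contDiffAt_snd
  exact (ContMDiffAt.comp (g := unitParam E G) _ (contMDiffAt_unitParam hz) A).inv.mul
    (ContMDiffAt.comp (g := unitParam E G) _ (contMDiffAt_unitParam hz) B)

theorem contDiffAt_coframe {z : E} (hz : z ∈ (chartAt E (1 : G)).target) :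
    ContDiffAt ℝ ∞ (coframe E G) z := by
  have A : ContDiffAt ℝ ∞ (fderiv ℝ (fun p : E × E => chartAt E (1 : G)
      ((unitParam E G p.1)⁻¹ * unitParam E G p.2))) (z, z) :=
    (contDiffAt_chart_inv_mul hz).fderiv_right (m := ∞) (by simp)
  have B := A.comp (f := fun w : E => (w, w)) z (contDiffAt_id.prodMk contDiffAt_id)
  refine (B.clm_comp (contDiffAt_const (c := ContinuousLinearMap.inr ℝ E E))).congr_of_eventuallyEq
    ?_
  filter_upwards [(chartAt E (1 : G)).open_target.mem_nhds hz] with w hw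
  exact (HasFDerivAt.comp (f := fun e => (w, e)) w
    (((contDiffAt_chart_inv_mul hw).differentiableAt (by simp)).hasFDerivAt)
    (hasFDerivAt_prodMk_right (𝕜 := ℝ) w w)).fderiv

variable [FiniteDimensional ℝ E]

theorem coframe_unitCoord : coframe E G (unitCoord E G) = .id ℝ E := by
  have := leftFrame_comp_coframe (E := E) (G := G) unitCoord_mem
  rwa [leftFrame_unitCoord, ContinuousLinearMap.id_comp] at this

/-- Differentiate `coframe ∘ leftFrame = id` at the identity, where both factors are the identity.
-/
theorem hasFDerivAt_coframe : HasFDerivAt (coframe E G) (-mixedDeriv E G) (unitCoord E G) := by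
  have h1 := ((contDiffAt_coframe (E := E) (G := G) unitCoord_mem).differentiableAt
    (by simp)).hasFDerivAt
  have h2 := h1.clm_comp (hasFDerivAt_leftFrame (E := E) (G := G))
  have h3 := h2.unique ((hasFDerivAt_const (ContinuousLinearMap.id ℝ E)
    (unitCoord E G)).congr_of_eventuallyEq (by
      filter_upwards [target_mem_nhds (E := E) (G := G)] with z hz
      exact coframe_comp_leftFrame hz))
  convert! h1 using 1
  ext X Y
  have := DFunLike.congr_fun (DFunLike.congr_fun h3 X) Y
  simp only [coframe_unitCoord, leftFrame_unitCoord] at this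
  simp at this
  simpa using (eq_neg_of_add_eq_zero_right this).symm

/-- A function whose left derivative is `α`, read in a chart around a point. -/
theorem hasFDerivAt_comp_of_leftDeriv {f : G → F} {α : G → E →L[ℝ] F}
    (hf : ∀ g, HasFDerivAt (fun z => f (g * unitParam E G z)) (α g) (unitCoord E G)) (g : G) {z : E}
    (hz : z ∈ (chartAt E (1 : G)).target) :
    HasFDerivAt (fun w => f (g * unitParam E G w)) ((α (g * unitParam E G z)).comp (coframe E G z))
      z := by
  have h := fderiv_comp_eq_leftDeriv (φ := fun w => g * unitParam E G w)
    (hf (g * unitParam E G z)).differentiableAt (contMDiffAt_mul_unitParam g hz)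
  simp only [chart_mul_unitParam_comp] at h
  rwa [leftDeriv, (hf _).fderiv] at h

theorem contMDiff_of_comp_unitParam {f : G → F}
    (hf : ∀ g, ContDiffAt ℝ ∞ (fun w => f (g * unitParam E G w)) (unitCoord E G)) :
    ContMDiff 𝓘(ℝ, E) 𝓘(ℝ, F) ∞ f := by
  intro g
  have h1 : ContMDiffAt 𝓘(ℝ, E) 𝓘(ℝ, E) ∞ (fun h => chartAt E (1 : G) (g⁻¹ * h)) g :=
    ContMDiffAt.comp (g := chartAt E (1 : G)) g (contMDiffAt_unitChart (by simp))
      (contMDiffAt_const.mul contMDiffAt_id)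
  have hg : chartAt E (1 : G) (g⁻¹ * g) = unitCoord E G := by simp [unitCoord]
  refine (ContMDiffAt.comp (g := fun w => f (g * unitParam E G w)) g
    (by rw [hg]; exact contMDiffAt_iff_contDiffAt.2 (hf g)) h1).congr_of_eventuallyEq ?_
  filter_upwards [eventually_mul_unitParam_chart (E := E) g] with h hh
  simp [hh]

/-- In a translated chart the derivative of `f` is `α` composed with the coframe, which is smooth;
hence `f` is of class `n + 1` for every `n`. -/
theorem contMDiff_of_leftDeriv {f : G → F} {α : G → E →L[ℝ] F}
    (hα : ContMDiff 𝓘(ℝ, E) 𝓘(ℝ, E →L[ℝ] F) ∞ α)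
    (hf : ∀ g, HasFDerivAt (fun z => f (g * unitParam E G z)) (α g) (unitCoord E G)) :
    ContMDiff 𝓘(ℝ, E) 𝓘(ℝ, F) ∞ f := by
  refine contMDiff_of_comp_unitParam fun g => contDiffAt_infty.2 fun n => ?_
  refine ContDiffAt.of_le (n := (n + 1 : ℕ)) ?_ (by norm_cast; omega)
  push_cast
  refine contDiffAt_succ_iff_hasFDerivAt.2
    ⟨fun z => (α (g * unitParam E G z)).comp (coframe E G z),
      ⟨_, target_mem_nhds, fun z hz => hasFDerivAt_comp_of_leftDeriv hf g hz⟩, ?_⟩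
  exact ((contDiffAt_mul_unitParam hα g unitCoord_mem).clm_comp
    (contDiffAt_coframe unitCoord_mem)).of_le (by exact_mod_cast le_top)

/-- The form with left derivative coefficients `α`, in the chart at the point `g`. -/
def chartForm (α : G → E →L[ℝ] F) (g : G) (z : E) : E →L[ℝ] F :=
  (α (g * unitParam E G z)).comp (coframe E G z)

theorem contDiffAt_chartForm {α : G → E →L[ℝ] F} (hα : ContMDiff 𝓘(ℝ, E) 𝓘(ℝ, E →L[ℝ] F) ∞ α)
    (g : G) {z : E} (hz : z ∈ (chartAt E (1 : G)).target) :
    ContDiffAt ℝ ∞ (chartForm α g) z :=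
  (contDiffAt_mul_unitParam hα g hz).clm_comp (contDiffAt_coframe hz)

/-- The charts centred at `g` and at `g * unitParam E G z` differ by a left translation, and the
coframe is left invariant, so one expression is the pullback of the other. Closedness at any `z`
thus reduces to closedness at the centre of a chart. -/
theorem chartForm_eventuallyEq (α : G → E →L[ℝ] F) (g : G) {z : E}
    (hz : z ∈ (chartAt E (1 : G)).target) :
    ∀ᶠ w in 𝓝 z, chartForm α g w = (chartForm α (g * unitParam E G z)
      (chartAt E (1 : G) ((unitParam E G z)⁻¹ * unitParam E G w))).comp
      (fderiv ℝ (fun w => chartAt E (1 : G) ((unitParam E G z)⁻¹ * unitParam E G w)) w) := by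
  have hc : ContMDiffAt 𝓘(ℝ, E) 𝓘(ℝ, E) ∞ (fun w => (unitParam E G z)⁻¹ * unitParam E G w) z :=
    contMDiffAt_const.mul (contMDiffAt_unitParam hz)
  have h1 : ∀ᶠ w in 𝓝 z, (unitParam E G z)⁻¹ * unitParam E G w ∈ (chartAt E (1 : G)).source :=
    hc.continuousAt.eventually_mem (by simpa using source_mem_nhds (E := E))
  filter_upwards [h1.eventually_nhds, (chartAt E (1 : G)).open_target.mem_nhds hz] with w hw' hw
  have hw1 := hw'.self_of_nhds
  simp only [chartForm, unitParam_chart hw1]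
  rw [ContinuousLinearMap.comp_assoc]
  have e1 : g * unitParam E G z * ((unitParam E G z)⁻¹ * unitParam E G w) = g * unitParam E G w := by
    group
  rw [e1]
  congr 1
  set τ := fun w => chartAt E (1 : G) ((unitParam E G z)⁻¹ * unitParam E G w) with hτ
  have ht : DifferentiableAt ℝ τ w := (contDiffAt_unitChart_comp
    (contMDiffAt_const.mul (contMDiffAt_unitParam hw)) hw1).differentiableAt (by simp)
  have hτw : τ w ∈ (chartAt E (1 : G)).target := (chartAt E (1 : G)).map_source hw1
  have h2 : HasFDerivAt (fun u => chartAt E (1 : G) ((unitParam E G (τ w))⁻¹ * unitParam E G u))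
      (coframe E G (τ w)) (τ w) :=
    ((contDiffAt_unitChart_comp (contMDiffAt_const.mul (contMDiffAt_unitParam hτw))
      (by simp)).differentiableAt (by simp)).hasFDerivAt
  refine ((h2.comp w ht.hasFDerivAt).congr_of_eventuallyEq ?_).fderiv
  filter_upwards [hw'] with u hu
  simp only [hτ, Function.comp, unitParam_chart hu, unitParam_chart hw1]
  congr 1
  group

/-- Differentiating the coframe at the identity contributes the Maurer–Cartan term, which turns
`hcl` into symmetry there. Away from the centre one pulls back by the transition map `τ`, whose own
second derivative is symmetric. -/
theorem fderiv_chartForm_symm {α : G → E →L[ℝ] F} (hα : ContMDiff 𝓘(ℝ, E) 𝓘(ℝ, E →L[ℝ] F) ∞ α)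
    (hcl : ∀ g X Y, leftDeriv α g X Y - leftDeriv α g Y X = α g (unitBracket E G X Y))
    (g : G) {z : E} (hz : z ∈ (chartAt E (1 : G)).target) (X Y : E) :
    fderiv ℝ (chartForm α g) z X Y = fderiv ℝ (chartForm α g) z Y X := by
  have base : ∀ (h : G) (X Y : E), fderiv ℝ (chartForm α h) (unitCoord E G) X Y =
      leftDeriv α h X Y - α h (mixedDeriv E G X Y) := by
    intro h X Y
    have := ((hasFDerivAt_leftDeriv hα h).clm_comp (hasFDerivAt_coframe (E := E) (G := G))).fderiv
    rw [show chartForm α h = fun z => (α (h * unitParam E G z)).comp (coframe E G z) from rfl, this]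
    simp [coframe_unitCoord]
    abel
  set τ := fun w => chartAt E (1 : G) ((unitParam E G z)⁻¹ * unitParam E G w) with hτ
  have hτs : ContDiffAt ℝ ∞ τ z := contDiffAt_unitChart_comp
    (contMDiffAt_const.mul (contMDiffAt_unitParam hz)) (by simp)
  have hτz : τ z = unitCoord E G := by simp [hτ, unitCoord]
  have h1 : HasFDerivAt (chartForm α (g * unitParam E G z))
      (fderiv ℝ (chartForm α (g * unitParam E G z)) (unitCoord E G)) (τ z) := by
    rw [hτz]
    exact ((contDiffAt_chartForm hα _ unitCoord_mem).differentiableAt (by simp)).hasFDerivAt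
  have h2 := (h1.comp z (hτs.differentiableAt (by simp)).hasFDerivAt).clm_comp
    ((hτs.fderiv_right (m := ∞) (by simp)).differentiableAt (by simp)).hasFDerivAt
  have h3 := (h2.congr_of_eventuallyEq (chartForm_eventuallyEq α g hz)).fderiv
  have hs : IsSymmSndFDerivAt ℝ τ z := hτs.isSymmSndFDerivAt (by simp; exact ENat.LEInfty.out)
  rw [h3]
  simp only [add_apply, ContinuousLinearMap.comp_apply, ContinuousLinearMap.compL_apply,
    ContinuousLinearMap.flip_apply, base, hs.eq X Y, Function.comp]
  congr 1
  have := hcl (g * unitParam E G z) (fderiv ℝ τ z X) (fderiv ℝ τ z Y)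
  rw [unitBracket, map_sub] at this
  exact sub_eq_sub_iff_sub_eq_sub.1 this

/-- The Poincaré lemma on a simply connected Lie group, in terms of left invariant frames. -/
theorem exists_primitive [SimplyConnectedSpace G] [CompleteSpace F] {α : G → E →L[ℝ] F}
    (hα : ContMDiff 𝓘(ℝ, E) 𝓘(ℝ, E →L[ℝ] F) ∞ α)
    (hcl : ∀ g X Y, leftDeriv α g X Y - leftDeriv α g Y X = α g (unitBracket E G X Y)) :
    ∃ f : G → F, ContMDiff 𝓘(ℝ, E) 𝓘(ℝ, F) ∞ f ∧ ∀ g, leftDeriv f g = α g := by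
  have : IsTopologicalGroup G := topologicalGroup_of_lieGroup 𝓘(ℝ, E) ∞
  have : LocallyPathConnectedSpace G := ChartedSpace.locallyPathConnectedSpace E G
  obtain ⟨r, hr, hball⟩ := Metric.mem_nhds_iff.1 (target_mem_nhds (E := E) (G := G))
  -- Local primitives come from the Poincaré lemma on a ball. Where two of them are defined their
  -- difference has zero left derivative, so the covering space argument glues them.
  have hP : ∀ g : G, ∃ f : E → F, ∀ z ∈ Metric.ball (unitCoord E G) r,
      HasFDerivAt f (chartForm α g z) z := fun g =>
    (convex_ball _ _).exists_forall_hasFDerivAt_of_fderiv_symmetric Metric.isOpen_ball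
      (fun z hz => ((contDiffAt_chartForm hα g (hball hz)).differentiableAt
        (by simp)).differentiableWithinAt)
      (fun z hz X Y => fderiv_chartForm_symm hα hcl g (hball hz) X Y)
  choose P hP using hP
  let V : Set G := (chartAt E (1 : G)).source ∩
    chartAt E (1 : G) ⁻¹' (Metric.ball (unitCoord E G) r)
  have hV : IsOpen V := (chartAt E (1 : G)).isOpen_inter_preimage Metric.isOpen_ball
  let U : G → Set G := fun g => (fun h => g⁻¹ * h) ⁻¹' V
  have hU : ∀ g, IsOpen (U g) := fun g => hV.preimage (by fun_prop)
  let f : G → G → F := fun g h => P g (chartAt E (1 : G) (g⁻¹ * h))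
  have hf : ∀ g, ∀ h ∈ U g, HasFDerivAt (fun z => f g (h * unitParam E G z)) (α h)
      (unitCoord E G) := by
    rintro g h ⟨h1, h2⟩
    set z := chartAt E (1 : G) (g⁻¹ * h) with hz
    have hzt : z ∈ (chartAt E (1 : G)).target := (chartAt E (1 : G)).map_source h1
    have hpz : unitParam E G z = g⁻¹ * h := unitParam_chart h1
    have a : HasFDerivAt (fun w => localMul E G (z, w)) (leftFrame E G z) (unitCoord E G) :=
      DifferentiableAt.hasFDerivAt (((localMul_contDiffAt_left hzt).comp (unitCoord E G)
        (contDiffAt_const.prodMk contDiffAt_id)).differentiableAt (by simp))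
    have b : HasFDerivAt (P g) (chartForm α g z) (localMul E G (z, unitCoord E G)) := by
      rw [localMul_unitCoord_right hzt]; exact hP g z h2
    have c := b.comp (unitCoord E G) a
    have e : (chartForm α g z).comp (leftFrame E G z) = α h := by
      rw [chartForm, ContinuousLinearMap.comp_assoc, coframe, coframe_comp_leftFrame hzt, hpz,
        ContinuousLinearMap.comp_id, mul_inv_cancel_left]
    rw [e] at c
    refine c.congr_of_eventuallyEq (Eventually.of_forall fun w => ?_)
    simp only [f, Function.comp, localMul, hpz, mul_assoc]
  obtain ⟨s, hs⟩ := exists_forall_eventually_sub_eq U hU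
    (fun g => by simpa [U, V, unitCoord] using hr) f (by
      intro i j x hx
      refine eventually_eq_of_leftDeriv_eq_zero (E := E) (f := fun y => f i y - f j y)
        ((hU i).inter (hU j)) (fun g hg => ?_) hx
      have := (hf i g hg.1).sub (hf j g hg.2)
      rw [sub_self] at this
      exact this)
  have hd : ∀ g, HasFDerivAt (fun z => s (g * unitParam E G z)) (α g) (unitCoord E G) := by
    intro g
    have hg : g ∈ U g := by simpa [U, V, unitCoord] using hr
    refine ((hf g g hg).add_const (s g - f g g)).congr_of_eventuallyEq ?_
    filter_upwards [(tendsto_mul_unitParam (E := E) g).eventually (hs g g hg)] with z hz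
    rw [← hz]; abel
  exact ⟨s, contMDiff_of_leftDeriv hα hd, fun g => (hd g).fderiv⟩

end Primitive

/-! ### Integrating triangular representations and additive functionals -/

section Representation

open Filter Topology

variable {E : Type*} [NormedAddCommGroup E] [NormedSpace ℝ E]
  {G : Type*} [TopologicalSpace G] [ChartedSpace E G] [Group G] [LieGroup 𝓘(ℝ, E) ∞ G]
  {J : Type*} [Fintype J]

/-- Uniqueness for triangular linear systems on a connected Lie group. -/
theorem eq_zero_of_triangular_system [PreconnectedSpace G] {wt : J → ℕ} {r : E → J → J → ℂ}
    (hr : ∀ X b a, r X b a ≠ 0 → wt a < wt b) {W : J → G → ℂ} {W' : J → G → E →L[ℝ] ℂ}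
    (hW : ∀ b g, HasFDerivAt (fun z => W b (g * unitParam E G z)) (W' b g) (unitCoord E G))
    (hW' : ∀ b g X, W' b g X = ∑ c, W c g * r X c b) (h1 : ∀ b, W b 1 = 0) (b : J) (g : G) :
    W b g = 0 := by
  obtain ⟨N, hN⟩ : ∃ N, ∀ b, wt b < N :=
    ⟨Finset.univ.sup wt + 1, fun b => Nat.lt_succ_of_le (Finset.le_sup (Finset.mem_univ b))⟩
  -- Descending induction on the weight: the derivative of `W b` only involves `W c` with `wt b < wt
  -- c`.
  have key : ∀ n b, N ≤ wt b + n → ∀ g, W b g = 0 := by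
    intro n
    induction n with
    | zero => intro b hb; have := hN b; omega
    | succ n ih =>
      intro b hb g
      rw [← h1 b]
      refine eq_of_leftDeriv_eq_zero (E := E) (fun g => ?_) g 1
      convert! hW b g using 1
      ext X
      rw [hW', eq_comm]
      refine Finset.sum_eq_zero fun c _ => ?_
      by_cases hc : r X c b = 0
      · simp [hc]
      · rw [ih c (by have := hr X c b hc; omega) g, zero_mul]
  exact key N b (by omega) g

variable [FiniteDimensional ℝ E] [DecidableEq J]

/-- A strictly triangular representation of the Lie algebra of a simply connected Lie group
integrates to a unitriangular matrix valued function. -/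
theorem exists_integral_representation [SimplyConnectedSpace G] {wt : J → ℕ}
    {ρ : J → J → E →L[ℝ] ℂ} (hρ : ∀ b a, ρ b a ≠ 0 → wt a < wt b)
    (hbr : ∀ X Y a b, ρ a b (unitBracket E G X Y) =
      ∑ c, (ρ a c X * ρ c b Y - ρ a c Y * ρ c b X)) :
    ∃ A : J → J → G → ℂ, (∀ a b, ContMDiff 𝓘(ℝ, E) 𝓘(ℝ, ℂ) ∞ (A a b)) ∧
      (∀ a b, ¬ wt b < wt a → ∀ g, A a b g = if a = b then 1 else 0) ∧
      (∀ a b, A a b 1 = if a = b then 1 else 0) ∧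
      ∀ a b g X, leftDeriv (A a b) g X = ∑ c, A a c g * ρ c b X := by
  -- The system `dA = A ρ` is solved by induction on the level `wt a - wt b`. The right side for an
  -- entry uses only entries of lower level, so each step is a single application of the Poincaré
  -- lemma; entries above level `n` are not yet constrained.
  have key : ∀ n : ℕ, ∃ A : J → J → G → ℂ, (∀ a b, ContMDiff 𝓘(ℝ, E) 𝓘(ℝ, ℂ) ∞ (A a b)) ∧
      (∀ a b, ¬ wt b < wt a → ∀ g, A a b g = if a = b then 1 else 0) ∧
      ∀ a b, wt a ≤ wt b + n → A a b 1 = (if a = b then 1 else 0) ∧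
        ∀ g X, leftDeriv (A a b) g X = ∑ c, A a c g * ρ c b X := by
    intro n
    induction n with
    | zero =>
      refine ⟨fun a b _ => if a = b then 1 else 0, fun a b => contMDiff_const,
        fun a b _ g => rfl, fun a b hab => ⟨rfl, fun g X => ?_⟩⟩
      rw [leftDeriv, fderiv_const_apply]
      simp only [ite_mul, one_mul, zero_mul, Finset.sum_ite_eq, Finset.mem_univ, if_true]
      by_cases h : ρ a b = 0
      · rw [h]
      · exact absurd (hρ a b h) (by omega)
    | succ n ih =>
      obtain ⟨A, hA1, hA2, hA3⟩ := ih
      have hprim : ∀ a b, wt a = wt b + (n + 1) → ∃ f : G → ℂ,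
          ContMDiff 𝓘(ℝ, E) 𝓘(ℝ, ℂ) ∞ f ∧
          ∀ g, leftDeriv f g = ∑ c, A a c g • ρ c b := by
        intro a b hab
        have hsm : ContMDiff 𝓘(ℝ, E) 𝓘(ℝ, E →L[ℝ] ℂ) ∞ (fun g => ∑ c, A a c g • ρ c b) :=
          contMDiff_of_comp_unitParam fun g => ContDiffAt.sum fun c _ =>
            (contDiffAt_mul_unitParam (hA1 a c) g unitCoord_mem).smul contDiffAt_const
        have hd : ∀ g X Y, leftDeriv (fun g => ∑ c, A a c g • ρ c b) g X Y =
            ∑ c, (∑ d, A a d g * ρ d c X) * ρ c b Y := by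
          intro g X Y
          have : HasFDerivAt (fun z => ∑ c, A a c (g * unitParam E G z) • ρ c b)
              (∑ c, (leftDeriv (A a c) g).smulRight (ρ c b)) (unitCoord E G) :=
            HasFDerivAt.fun_sum fun c _ =>
              (hasFDerivAt_leftDeriv (hA1 a c) g).smul_const (ρ c b)
          rw [leftDeriv, this.fderiv]
          simp only [sum_apply, ContinuousLinearMap.smulRight_apply, smul_apply, smul_eq_mul]
          refine Finset.sum_congr rfl fun c _ => ?_
          by_cases hc : ρ c b = 0
          · simp [hc]
          · rw [(hA3 a c (by have := hρ c b hc; omega)).2]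
        -- Closedness of `A ρ` is exactly the bracket relation `hbr`, given the equations already
        -- solved.
        refine exists_primitive hsm fun g X Y => ?_
        rw [hd, hd]
        simp only [sum_apply, smul_apply, smul_eq_mul, hbr, Finset.mul_sum,
          Finset.sum_mul, ← Finset.sum_sub_distrib]
        rw [Finset.sum_comm]
        exact Finset.sum_congr rfl fun c _ => Finset.sum_congr rfl fun d _ => by ring
      choose f hf1 hf2 using hprim
      -- Subtracting the value at `1` normalizes the new entries to vanish at the identity.
      let A' : J → J → G → ℂ := fun a b => if h : wt a = wt b + (n + 1) then
        fun g => f a b h g - f a b h 1 else A a b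
      have hA'n : ∀ a b, wt a ≠ wt b + (n + 1) → A' a b = A a b := fun a b h => dif_neg h
      have hA'p : ∀ a b, ∀ h : wt a = wt b + (n + 1), A' a b = fun g => f a b h g - f a b h 1 :=
        fun a b h => dif_pos h
      have hsum : ∀ a b g X, wt a ≤ wt b + (n + 1) →
          ∑ c, A' a c g * ρ c b X = ∑ c, A a c g * ρ c b X := by
        intro a b g X hab
        refine Finset.sum_congr rfl fun c _ => ?_
        by_cases hc : ρ c b = 0
        · simp [hc]
        · rw [hA'n a c (by have := hρ c b hc; omega)]
      refine ⟨A', fun a b => ?_, fun a b h g => ?_, fun a b hab => ?_⟩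
      · by_cases h : wt a = wt b + (n + 1)
        · rw [hA'p a b h]
          exact (hf1 a b h).sub contMDiff_const
        · rw [hA'n a b h]; exact hA1 a b
      · rw [hA'n a b (by omega)]; exact hA2 a b h g
      · by_cases h : wt a = wt b + (n + 1)
        · refine ⟨?_, fun g X => ?_⟩
          · rw [hA'p a b h, if_neg (by rintro rfl; omega)]; exact sub_self _
          · rw [hsum a b g X hab, hA'p a b h, leftDeriv,
              ((hasFDerivAt_leftDeriv (hf1 a b h) g).sub_const _).fderiv, hf2]
            simp
        · refine ⟨?_, fun g X => ?_⟩
          · rw [hA'n a b h]; exact (hA3 a b (by omega)).1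
          · rw [hsum a b g X hab, hA'n a b h]; exact (hA3 a b (by omega)).2 g X
  obtain ⟨A, h1, h2, h3⟩ := key (Finset.univ.sup wt)
  have hle : ∀ a b, wt a ≤ wt b + Finset.univ.sup wt := fun a b =>
    (Finset.le_sup (Finset.mem_univ a)).trans (Nat.le_add_left _ _)
  exact ⟨A, h1, h2, fun a b => (h3 a b (hle a b)).1, fun a b => (h3 a b (hle a b)).2⟩

/-- As functions of `h`, both sides solve the same triangular system and agree at `1`. -/
theorem integral_representation_mul [PreconnectedSpace G] {wt : J → ℕ} {ρ : J → J → E →L[ℝ] ℂ}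
    (hρ : ∀ b a, ρ b a ≠ 0 → wt a < wt b) {A : J → J → G → ℂ}
    (hA : ∀ a b, ContMDiff 𝓘(ℝ, E) 𝓘(ℝ, ℂ) ∞ (A a b))
    (hA1 : ∀ a b, A a b 1 = if a = b then 1 else 0)
    (hA' : ∀ a b g X, leftDeriv (A a b) g X = ∑ c, A a c g * ρ c b X) (a b : J) (g h : G) :
    A a b (g * h) = ∑ c, A a c g * A c b h := by
  rw [← sub_eq_zero]
  refine eq_zero_of_triangular_system (E := E) (wt := wt) (r := fun X b a => ρ b a X)
    (fun X b a h => hρ b a fun h' => h (by simp [h']))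
    (W := fun b h => A a b (g * h) - ∑ c, A a c g * A c b h)
    (W' := fun b h => leftDeriv (A a b) (g * h) - ∑ c, A a c g • leftDeriv (A c b) h)
    (fun b h => ?_) (fun b h X => ?_) (fun b => by simp [hA1]) b h
  · have e := hasFDerivAt_leftDeriv (hA a b) (g * h)
    simp only [mul_assoc] at e ⊢
    exact e.sub (HasFDerivAt.fun_sum (u := Finset.univ) fun c _ =>
      (hasFDerivAt_leftDeriv (hA c b) h).const_mul (A a c g))
  · simp only [sub_apply, sum_apply, smul_apply, smul_eq_mul, hA', sub_mul,
      Finset.sum_sub_distrib, Finset.sum_mul, Finset.mul_sum]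
    rw [Finset.sum_comm]
    simp only [mul_assoc]

/-- Along `G₀` the system has real coefficients, so the imaginary parts solve it with zero initial
value. -/
theorem integral_representation_real {E₀ : Type*} [NormedAddCommGroup E₀] [NormedSpace ℝ E₀]
    {G₀ : Type*} [TopologicalSpace G₀] [ChartedSpace E₀ G₀] [Group G₀] [LieGroup 𝓘(ℝ, E₀) ∞ G₀]
    [PreconnectedSpace G₀] {ι : G₀ →* G} (hι : ContMDiff 𝓘(ℝ, E₀) 𝓘(ℝ, E) ∞ ι)
    {wt : J → ℕ} {ρ : J → J → E →L[ℝ] ℂ}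
    (hρ : ∀ b a, ρ b a ≠ 0 → wt a < wt b)
    (hreal : ∀ b a X, (ρ b a (unitDeriv E E₀ ι X)).im = 0) {A : J → J → G → ℂ}
    (hA : ∀ a b, ContMDiff 𝓘(ℝ, E) 𝓘(ℝ, ℂ) ∞ (A a b))
    (hA1 : ∀ a b, A a b 1 = if a = b then 1 else 0)
    (hA' : ∀ a b g X, leftDeriv (A a b) g X = ∑ c, A a c g * ρ c b X) (a b : J) (g : G₀) :
    (A a b (ι g)).im = 0 := by
  have := eq_zero_of_triangular_system (E := E₀) (G := G₀) (wt := wt)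
    (r := fun X b a => ρ b a (unitDeriv E E₀ ι X))
    (fun X b a h => hρ b a fun h' => h (by simp [h']))
    (W := fun b h => ((A a b (ι h)).im : ℂ))
    (W' := fun b h => (Complex.ofRealCLM.comp Complex.imCLM).comp
      ((leftDeriv (A a b) (ι h)).comp (unitDeriv E E₀ ι)))
    (fun b h => ?_) (fun b h X => ?_) (fun b => ?_) b g
  · exact_mod_cast this
  · have e := hasFDerivAt_comp_hom hι (differentiableAt_mul_unitParam (hA a b) (ι h))
    simp only [map_mul]
    exact (Complex.ofRealCLM.comp Complex.imCLM).hasFDerivAt.comp (unitCoord E₀ G₀) e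
  · simp only [ContinuousLinearMap.comp_apply, hA', Complex.imCLM_apply, Complex.ofRealCLM_apply,
      Complex.im_sum, Complex.mul_im, hreal, mul_zero, zero_add, Complex.ofReal_sum,
      Complex.ofReal_mul]
    refine Finset.sum_congr rfl fun c _ => ?_
    congr 1
    exact Complex.ext (by simp) (by simp [hreal])
  · rw [map_one, hA1]; split_ifs <;> simp

/-- A left invariant 1-form that kills brackets is closed. Left invariance makes `w (g * g') - w g'`
constant in `g'`; the term `w 1` appears because `w` is not normalized. -/
theorem exists_additive_primitive [SimplyConnectedSpace G] {lam : E →L[ℝ] ℂ}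
    (h : ∀ X Y, lam (unitBracket E G X Y) = 0) :
    ∃ w : G → ℂ, ContMDiff 𝓘(ℝ, E) 𝓘(ℝ, ℂ) ∞ w ∧ (∀ g, leftDeriv w g = lam) ∧
      ∀ g g', w (g * g') = w g + w g' - w 1 := by
  obtain ⟨w, h1, h2⟩ := exists_primitive (G := G) (α := fun _ => lam) contMDiff_const
    (fun g X Y => by simp [leftDeriv, h])
  refine ⟨w, h1, h2, fun g g' => ?_⟩
  have := eq_of_leftDeriv_eq_zero (E := E) (f := fun g' => w (g * g') - w g') (fun g' => by
    have e := (hasFDerivAt_leftDeriv h1 (g * g')).sub (hasFDerivAt_leftDeriv h1 g')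
    rw [h2, h2, sub_self] at e
    simp only [← mul_assoc]
    exact e) g' 1
  simp only [mul_one] at this
  linear_combination this

end Representation

/-! ### Birkhoff's theorem: faithful strictly triangular representations -/

section NilpotentRepresentation

variable {k : Type*} [Field k] {H V : Type*} [LieRing H] [LieAlgebra k H] [AddCommGroup V]
  [Module k V]

/-- The action on sequences of the coinduced representation, for an extension of a Lie algebra by a
derivation `d`, which acts itself by the shift. -/
def seqAction (ρ : H →ₗ[k] V →ₗ[k] V) (d : H →ₗ[k] H) : ℕ → H → (ℕ → V) → V
  | 0, y, f => ρ y (f 0)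
  | n + 1, y, f => seqAction ρ d n (d y) f + seqAction ρ d n y (fun i => f (i + 1))

variable (ρ : H →ₗ[k] V →ₗ[k] V) (d : H →ₗ[k] H)

theorem seqAction_succ (n : ℕ) (y : H) (f : ℕ → V) : seqAction ρ d (n + 1) y f =
    seqAction ρ d n (d y) f + seqAction ρ d n y (fun i => f (i + 1)) := rfl

theorem seqAction_add_left (n : ℕ) (y y' : H) (f : ℕ → V) :
    seqAction ρ d n (y + y') f = seqAction ρ d n y f + seqAction ρ d n y' f := by
  induction n generalizing y y' f with
  | zero => simp [seqAction]
  | succ n ih => simp only [seqAction_succ, map_add, ih]; abel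

theorem seqAction_smul_left (n : ℕ) (c : k) (y : H) (f : ℕ → V) :
    seqAction ρ d n (c • y) f = c • seqAction ρ d n y f := by
  induction n generalizing y f with
  | zero => simp [seqAction]
  | succ n ih => simp only [seqAction_succ, map_smul, ih, smul_add]

theorem seqAction_add_right (n : ℕ) (y : H) (f f' : ℕ → V) :
    seqAction ρ d n y (fun i => f i + f' i) = seqAction ρ d n y f + seqAction ρ d n y f' := by
  induction n generalizing y f f' with
  | zero => simp [seqAction]
  | succ n ih =>
    simp only [seqAction_succ, ih]; abel

theorem seqAction_smul_right (n : ℕ) (c : k) (y : H) (f : ℕ → V) :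
    seqAction ρ d n y (fun i => c • f i) = c • seqAction ρ d n y f := by
  induction n generalizing y f with
  | zero => simp [seqAction]
  | succ n ih => simp only [seqAction_succ, ih, smul_add]

theorem seqAction_sub_left (n : ℕ) (y y' : H) (f : ℕ → V) :
    seqAction ρ d n (y - y') f = seqAction ρ d n y f - seqAction ρ d n y' f := by
  rw [sub_eq_add_neg, seqAction_add_left, ← neg_one_smul k y', seqAction_smul_left, neg_one_smul,
    sub_eq_add_neg]

/-- The recursion says that the commutator of the shift with the action of `y` is the action of `d
y`. With the Leibniz rule, the bracket relation propagates from index `0`, where it is that of `ρ`.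
-/
theorem seqAction_lie {ρ : H →ₗ[k] V →ₗ[k] V} {d : H →ₗ[k] H}
    (hρ : ∀ y y' v, ρ ⁅y, y'⁆ v = ρ y (ρ y' v) - ρ y' (ρ y v))
    (hd : ∀ y y', d ⁅y, y'⁆ = ⁅d y, y'⁆ + ⁅y, d y'⁆) (n : ℕ) (y y' : H) (f : ℕ → V) :
    seqAction ρ d n ⁅y, y'⁆ f = seqAction ρ d n y (fun i => seqAction ρ d i y' f) -
      seqAction ρ d n y' (fun i => seqAction ρ d i y f) := by
  induction n generalizing y y' f with
  | zero => simp [seqAction, hρ]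
  | succ n ih =>
    simp only [seqAction_succ, hd, seqAction_add_left, seqAction_add_right, ih]
    abel

/-- A nonzero entry at index `m` comes from an entry at some index `m - j`, with `d` applied `j`
times and the weight strictly raised. For nilpotent `d` this bounds `j` and lets the sequences be
truncated. -/
theorem seqAction_ne_zero {J : Type*} [Fintype J] [DecidableEq J] {ρ : H →ₗ[k] (J → k) →ₗ[k] (J → k)}
    {d : H →ₗ[k] H} {wt : J → ℕ} (hρ : ∀ y b a, ρ y (Pi.single a 1) b ≠ 0 → wt a < wt b)
    (m : ℕ) (y : H) (f : ℕ → J → k) (b : J) (h : seqAction ρ d m y f b ≠ 0) :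
    ∃ j n a, m = n + j ∧ f n a ≠ 0 ∧ wt a < wt b ∧ (d ^ j) y ≠ 0 := by
  induction m generalizing y f with
  | zero =>
    have hf : ρ y (f 0) b = ∑ a, f 0 a * ρ y (Pi.single a 1) b := by
      conv_lhs => rw [pi_eq_sum_univ' (f 0)]
      simp
    rw [seqAction, hf] at h
    obtain ⟨a, -, ha⟩ := Finset.exists_ne_zero_of_sum_ne_zero h
    refine ⟨0, 0, a, rfl, left_ne_zero_of_mul ha, hρ y b a (right_ne_zero_of_mul ha), ?_⟩
    rintro h0
    simp only [pow_zero, Module.End.one_apply] at h0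
    exact right_ne_zero_of_mul ha (by simp [h0])
  | succ m ih =>
    rw [seqAction_succ, Pi.add_apply] at h
    by_cases h1 : seqAction ρ d m (d y) f b = 0
    · rw [h1, zero_add] at h
      obtain ⟨j, n, a, h2, h3, h4, h5⟩ := ih y _ h
      exact ⟨j, n + 1, a, by omega, h3, h4, h5⟩
    · obtain ⟨j, n, a, h2, h3, h4, h5⟩ := ih (d y) f h1
      exact ⟨j + 1, n, a, by omega, h3, h4, by rwa [pow_succ, Module.End.mul_apply]⟩

/-- The extended action on truncated sequences. -/
theorem exists_strict_representation_of_extension {L : Type*} [LieRing L] [LieAlgebra k L]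
    (φ : L →ₗ[k] k) (p : L →ₗ[k] H) (d : H →ₗ[k] H) {D : ℕ} (hD : d ^ D = 0)
    (hd : ∀ y y', d ⁅y, y'⁆ = ⁅d y, y'⁆ + ⁅y, d y'⁆)
    (hφ : ∀ z z' : L, φ ⁅z, z'⁆ = 0)
    (hp : ∀ z z' : L, p ⁅z, z'⁆ = φ z • d (p z') - φ z' • d (p z) + ⁅p z, p z'⁆)
    (hinj : ∀ z, φ z = 0 → p z = 0 → z = 0)
    {J : Type} [Fintype J] [DecidableEq J] {wt : J → ℕ} (ρ : H →ₗ[k] (J → k) →ₗ[k] (J → k))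
    (hρ : ∀ y b a, ρ y (Pi.single a 1) b ≠ 0 → wt a < wt b)
    (hρl : ∀ y y' v, ρ ⁅y, y'⁆ v = ρ y (ρ y' v) - ρ y' (ρ y v)) (hρi : ∀ y, ρ y = 0 → y = 0)
    (hJ : Nonempty J) :
    ∃ (J' : Type) (_ : Fintype J') (_ : DecidableEq J') (wt' : J' → ℕ)
      (R : L →ₗ[k] (J' → k) →ₗ[k] (J' → k)), Nonempty J' ∧
      (∀ y b a, R y (Pi.single a 1) b ≠ 0 → wt' a < wt' b) ∧
      (∀ y y' v, R ⁅y, y'⁆ v = R y (R y' v) - R y' (R y v)) ∧ ∀ y, R y = 0 → y = 0 := by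
  classical
  -- The `φ` component of `z` acts by the shift, its component `p z` in `H` by the coinduced action.
  let act : L → (ℕ → J → k) → ℕ → J → k := fun z f n => φ z • f (n + 1) + seqAction ρ d n (p z) f
  have act_lie : ∀ z z' f, act ⁅z, z'⁆ f = act z (act z' f) - act z' (act z f) := by
    intro z z' f
    funext n
    simp only [act, Pi.sub_apply, hφ, hp, seqAction_add_left, seqAction_add_right,
      seqAction_smul_left, seqAction_sub_left, seqAction_lie hρl hd, seqAction_succ, smul_add, zero_smul]
    rw [seqAction_smul_right ρ d n (φ z') (p z) (fun i => f (i + 1)),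
      seqAction_smul_right ρ d n (φ z) (p z') (fun i => f (i + 1)), smul_comm (φ z') (φ z)]
    abel
  -- Each application of `ρ` raises the weight by at least one and the index by less than `D`, so
  -- sequences supported in indices up to `D * wt a + 1` are preserved. The `+ 1` guarantees an
  -- index `1`, on which the shift is visible.
  let N : J → ℕ := fun a => D * wt a + 1
  have d_lt : ∀ {j : ℕ} {y : H}, (d ^ j) y ≠ 0 → j < D := by
    intro j y h
    by_contra hj
    push Not at hj
    obtain ⟨i, rfl⟩ := Nat.exists_eq_add_of_le hj
    rw [add_comm, pow_add, hD, mul_zero] at h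
    exact h rfl
  let C : ℕ := Finset.univ.sup N
  have hC : ∀ a, N a ≤ C := fun a => Finset.le_sup (f := N) (Finset.mem_univ a)
  -- sources of a nonzero value
  have act_ne : ∀ z f m b, act z f m b ≠ 0 → ∃ n a, f n a ≠ 0 ∧
      ((n ≤ N a → m ≤ N b) ∧ (n ≤ N a → (D + 1) * wt a + C - n < (D + 1) * wt b + C - m)) := by
    intro z f m b h
    by_cases h1 : seqAction ρ d m (p z) f b = 0
    · have h2 : f (m + 1) b ≠ 0 := by
        intro h3
        apply h
        simp [act, h1, h3]
      have := hC b
      exact ⟨m + 1, b, h2, fun h => by omega, fun h => by omega⟩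
    · obtain ⟨j, n, a, h2, h3, h4, h5⟩ := seqAction_ne_zero hρ m (p z) f b h1
      have hj := d_lt h5
      have h6 : D * wt a + D ≤ D * wt b := by
        calc D * wt a + D = D * (wt a + 1) := by ring
          _ ≤ D * wt b := Nat.mul_le_mul_left D h4
      have := hC a
      refine ⟨n, a, h3, fun h => ?_, fun h => ?_⟩
      · simp only [N] at h ⊢; omega
      · rw [add_mul, add_mul]; simp only [N] at h this; omega
  let J' : Type := Σ a : J, Fin (N a + 1)
  let ext : (J' → k) →ₗ[k] (ℕ → J → k) :=
    { toFun := fun v n a => if h : n < N a + 1 then v ⟨a, ⟨n, h⟩⟩ else 0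
      map_add' := fun v w => by
        funext n a
        by_cases h : n < N a + 1
        · simp only [Pi.add_apply, dif_pos h]
        · simp only [Pi.add_apply, dif_neg h, add_zero]
      map_smul' := fun c v => by
        funext n a
        by_cases h : n < N a + 1
        · simp only [Pi.smul_apply, dif_pos h, RingHom.id_apply]
        · simp only [Pi.smul_apply, dif_neg h, smul_zero] }
  have ext_val : ∀ v (i : J'), ext v i.2 i.1 = v i := fun v i => dif_pos i.2.2
  have ext_out : ∀ v n a, ¬ n < N a + 1 → ext v n a = 0 := fun v n a h => dif_neg h
  let R : L →ₗ[k] (J' → k) →ₗ[k] (J' → k) := LinearMap.mk₂ k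
    (fun z v i => act z (ext v) i.2 i.1)
    (fun z z' v => by
      funext i
      simp only [act, map_add, seqAction_add_left, add_smul, Pi.add_apply]
      abel)
    (fun c z v => by
      funext i
      simp only [act, map_smul, seqAction_smul_left, smul_eq_mul, Pi.add_apply,
        Pi.smul_apply, mul_add, mul_assoc])
    (fun z v w => by
      funext i
      simp only [act, map_add, Pi.add_apply, smul_add]
      rw [show (ext v + ext w) = fun i => ext v i + ext w i from rfl, seqAction_add_right]
      simp only [Pi.add_apply]
      abel)
    (fun c z v => by
      funext i
      simp only [act, map_smul, Pi.add_apply, Pi.smul_apply]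
      rw [show (c • ext v) = fun i => c • ext v i from rfl, seqAction_smul_right]
      simp only [Pi.smul_apply, smul_eq_mul]
      ring)
  have R_apply : ∀ z v (i : J'), R z v i = act z (ext v) i.2 i.1 := fun _ _ _ => rfl
  have ext_R : ∀ z v, ext (R z v) = act z (ext v) := by
    intro z v
    funext m b
    by_cases h : m < N b + 1
    · exact ext_val _ ⟨b, ⟨m, h⟩⟩
    · rw [ext_out _ _ _ h]
      by_contra h0
      obtain ⟨n, a, h1, h2, -⟩ := act_ne z (ext v) m b (Ne.symm h0)
      have : n < N a + 1 := by
        by_contra h3; exact h1 (ext_out _ _ _ h3)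
      have := h2 (by omega)
      omega
  -- The shift lowers the index, which raises the new weight. An application of `ρ` gains at least
  -- `D + 1` from the old weight and loses less than `D` from the index. The constant `C` keeps the
  -- subtraction from truncating.
  refine ⟨J', inferInstance, inferInstance, fun i => (D + 1) * wt i.1 + C - i.2, R,
    ⟨⟨hJ.some, 0⟩⟩, fun z b a h => ?_, fun z z' v => ?_, fun z h => ?_⟩
  · rw [R_apply] at h
    obtain ⟨n, a', h1, -, h2⟩ := act_ne _ _ _ _ h
    have hn : n < N a' + 1 := by
      by_contra h3; exact h1 (ext_out _ _ _ h3)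
    have h3 : (Pi.single a (1 : k) : J' → k) ⟨a', ⟨n, hn⟩⟩ ≠ 0 := by
      rw [← ext_val (Pi.single a (1 : k)) ⟨a', ⟨n, hn⟩⟩]; exact h1
    have h4 : (⟨a', ⟨n, hn⟩⟩ : J') = a := by
      by_contra h5
      exact h3 (Pi.single_eq_of_ne h5 1)
    subst h4
    exact h2 (by omega)
  · funext i
    rw [Pi.sub_apply, R_apply, R_apply, R_apply, ext_R, ext_R, act_lie]
    rfl
  -- The entry at index `1` is moved to index `0` by the shift alone, which detects `φ z`. Once `φ z
  -- = 0`, sequences supported at index `0` detect `ρ (p z)`.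
  · have hφz : φ z = 0 := by
      let a := hJ.some
      have h1 : (R z (Pi.single ⟨a, ⟨1, by simp [N]⟩⟩ 1)) ⟨a, 0⟩ = 0 := by rw [h]; rfl
      rw [R_apply] at h1
      have h2 : ext (Pi.single (⟨a, ⟨1, by simp [N]⟩⟩ : J') (1 : k)) 0 = 0 := by
        funext b
        have := ext_val (Pi.single (⟨a, ⟨1, by simp [N]⟩⟩ : J') (1 : k)) ⟨b, 0⟩
        rw [Pi.single_eq_of_ne (by
          intro h
          have h' := congrArg (fun i : J' => (i.2 : ℕ)) h
          simp at h')] at this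
        exact this
      have h3 : ext (Pi.single (⟨a, ⟨1, by simp [N]⟩⟩ : J') (1 : k)) 1 a = 1 := by
        have := ext_val (Pi.single (⟨a, ⟨1, by simp [N]⟩⟩ : J') (1 : k)) ⟨a, ⟨1, by simp [N]⟩⟩
        rw [Pi.single_eq_same] at this
        exact this
      change φ z * (ext (Pi.single (⟨a, ⟨1, by simp [N]⟩⟩ : J') (1 : k)) 1 a) +
        ρ (p z) (ext (Pi.single (⟨a, ⟨1, by simp [N]⟩⟩ : J') (1 : k)) 0) a = 0 at h1
      rw [h2, h3, map_zero] at h1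
      simpa using h1
    refine hinj z hφz (hρi _ ?_)
    ext a b
    have h1 : (R z (Pi.single ⟨a, 0⟩ 1)) ⟨b, 0⟩ = 0 := by rw [h]; rfl
    rw [R_apply] at h1
    have h2 : ext (Pi.single (⟨a, 0⟩ : J') (1 : k)) 0 = Pi.single a 1 := by
      funext c
      have := ext_val (Pi.single (⟨a, 0⟩ : J') (1 : k)) ⟨c, 0⟩
      by_cases hc : c = a
      · subst hc
        rw [Pi.single_eq_same] at this ⊢
        exact this
      · rw [Pi.single_eq_of_ne (by
          intro h
          exact hc (congrArg (fun i : J' => i.1) h))] at this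
        rw [Pi.single_eq_of_ne hc]
        exact this
    change φ z * _ + ρ (p z) (ext (Pi.single (⟨a, 0⟩ : J') (1 : k)) 0) b = 0 at h1
    rw [hφz, zero_mul, zero_add, h2] at h1
    simpa using h1

/-- A finite-dimensional nilpotent Lie algebra has a faithful representation by strictly triangular
matrices. -/
theorem exists_strict_representation_aux (n : ℕ) : ∀ (L : Type*) [LieRing L] [LieAlgebra k L]
    [FiniteDimensional k L] [LieRing.IsNilpotent L], Module.finrank k L = n →
    ∃ (J : Type) (_ : Fintype J) (_ : DecidableEq J) (wt : J → ℕ)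
      (R : L →ₗ[k] (J → k) →ₗ[k] (J → k)), Nonempty J ∧
      (∀ y b a, R y (Pi.single a 1) b ≠ 0 → wt a < wt b) ∧
      (∀ y y' v, R ⁅y, y'⁆ v = R y (R y' v) - R y' (R y v)) ∧ ∀ y, R y = 0 → y = 0 := by
  induction n with
  | zero =>
    intro L _ _ _ _ hn
    have := Module.finrank_zero_iff.1 hn
    exact ⟨Unit, inferInstance, inferInstance, fun _ => 0, 0, inferInstance, by simp, by simp,
      fun y _ => Subsingleton.elim _ _⟩
  | succ n ih =>
    intro L _ _ _ _ hn
    have : Nontrivial L := Module.nontrivial_of_finrank_pos (R := k) (by omega)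
    have hlt := LieAlgebra.derivedSeries_lt_top_of_solvable k L
    have hlt' : (LieAlgebra.derivedSeries k L 1).toSubmodule < ⊤ := by
      refine lt_top_iff_ne_top.2 fun h => hlt.ne ?_
      rwa [← LieSubmodule.toSubmodule_eq_top]
    -- A nonzero nilpotent algebra is not perfect, so it has an ideal `ker φ` of codimension one;
    -- `L` is the extension of this ideal by the nilpotent derivation `ad x`.
    obtain ⟨φ, hφ0, hφ⟩ := Submodule.exists_le_ker_of_lt_top _ hlt'
    have hφl : ∀ z z' : L, φ ⁅z, z'⁆ = 0 := fun z z' => hφ (by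
      rw [LieSubmodule.mem_toSubmodule, LieAlgebra.derivedSeries_def,
        LieAlgebra.derivedSeriesOfIdeal_succ, LieAlgebra.derivedSeriesOfIdeal_zero]
      exact LieSubmodule.lie_mem_lie (LieSubmodule.mem_top z) (LieSubmodule.mem_top z'))
    obtain ⟨x, hx⟩ : ∃ x, φ x = 1 := by
      obtain ⟨u, hu⟩ : ∃ u, φ u ≠ 0 := by
        by_contra! h; exact hφ0 (LinearMap.ext h)
      exact ⟨(φ u)⁻¹ • u, by simp [hu]⟩
    let h : LieSubalgebra k L :=
      { LinearMap.ker φ with lie_mem' := fun {a b} _ _ => hφl a b }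
    have mem_h : ∀ z, z ∈ h ↔ φ z = 0 := fun z => Iff.rfl
    have hnil : LieRing.IsNilpotent h :=
      Function.Injective.lieAlgebra_isNilpotent (R := k) (f := h.incl) Subtype.val_injective
    have hfr : Module.finrank k h = n := by
      have := LinearMap.finrank_range_add_finrank_ker φ
      rw [LinearMap.range_eq_top.2 (LinearMap.surjective hφ0), finrank_top, Module.finrank_self,
        hn] at this
      have h2 : Module.finrank k h = Module.finrank k (LinearMap.ker φ) := rfl
      omega
    obtain ⟨J, _, _, wt, ρ, hJ, h1, h2, h3⟩ := ih h hfr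
    let d : h →ₗ[k] h :=
      { toFun := fun y => ⟨⁅x, (y : L)⁆, hφl x y⟩
        map_add' := fun y y' => Subtype.ext (by simp)
        map_smul' := fun c y => Subtype.ext (by simp) }
    let p : L →ₗ[k] h :=
      { toFun := fun z => ⟨z - φ z • x, by rw [mem_h]; simp [hx]⟩
        map_add' := fun y y' => Subtype.ext (by simp [add_smul]; abel)
        map_smul' := fun c y => Subtype.ext (by simp [smul_sub, mul_smul]) }
    obtain ⟨D, hD⟩ := (LieAlgebra.isNilpotent_iff_forall (R := k)).1 ‹LieRing.IsNilpotent L› x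
    have hdpow : ∀ j (y : h), (((d ^ j) y : h) : L) = (LieAlgebra.ad k L x ^ j) y := by
      intro j
      induction j with
      | zero => intro y; rfl
      | succ j ihj =>
        intro y
        rw [pow_succ, pow_succ, Module.End.mul_apply, Module.End.mul_apply, ihj]
        rfl
    refine exists_strict_representation_of_extension φ p d (D := D) ?_ ?_ hφl ?_ ?_ ρ h1 h2 h3 hJ
    · ext y
      rw [hdpow, hD]; rfl
    · intro y y'
      apply Subtype.ext
      exact leibniz_lie x (y : L) (y' : L)
    · intro z z'
      apply Subtype.ext
      change ⁅z, z'⁆ - φ ⁅z, z'⁆ • x = φ z • ⁅x, z' - φ z' • x⁆ - φ z' • ⁅x, z - φ z • x⁆ +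
        ⁅z - φ z • x, z' - φ z' • x⁆
      rw [hφl]
      simp only [lie_sub, sub_lie, lie_smul, smul_lie, lie_self, smul_zero, sub_zero, zero_smul]
      rw [← lie_skew x z]
      simp only [smul_neg]
      abel
    · intro z hz hz'
      have := congrArg Subtype.val hz'
      change z - φ z • x = 0 at this
      rwa [hz, zero_smul, sub_zero] at this

/-- **Birkhoff's theorem**, in terms of matrix coefficients. -/
theorem exists_strict_representation (L : Type*) [LieRing L] [LieAlgebra k L]
    [FiniteDimensional k L] [LieRing.IsNilpotent L] :
    ∃ (J : Type) (_ : Fintype J) (_ : DecidableEq J) (wt : J → ℕ) (ρ : J → J → L →ₗ[k] k),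
      (∀ b a, ρ b a ≠ 0 → wt a < wt b) ∧
      (∀ x y a b, ρ a b ⁅x, y⁆ = ∑ c, (ρ a c x * ρ c b y - ρ a c y * ρ c b x)) ∧
      ∀ x, (∀ a b, ρ a b x = 0) → x = 0 := by
  obtain ⟨J, _, _, wt, R, -, h1, h2, h3⟩ := exists_strict_representation_aux (k := k) _ L rfl
  have hR : ∀ x v a, R x v a = ∑ c, v c * R x (Pi.single c 1) a := by
    intro x v a
    conv_lhs => rw [pi_eq_sum_univ' v]
    simp
  refine ⟨J, inferInstance, inferInstance, wt,
    fun b a => (LinearMap.proj b).comp (R.flip (Pi.single a 1)), fun b a h => ?_,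
    fun x y a b => ?_, fun x h => h3 x ?_⟩
  · obtain ⟨x, hx⟩ : ∃ x, R x (Pi.single a 1) b ≠ 0 := by
      by_contra! h'; exact h (LinearMap.ext h')
    exact h1 x b a hx
  · simp only [LinearMap.comp_apply, LinearMap.flip_apply, LinearMap.proj_apply, h2, Pi.sub_apply]
    rw [hR x (R y _), hR y (R x _), ← Finset.sum_sub_distrib]
    exact Finset.sum_congr rfl fun c _ => by ring
  · ext a b
    exact h b a

end NilpotentRepresentation

/-! ### Second order jets of functions of one real variable -/

section Jets

open Filter Topology

/-- The function `g` has value `x`, derivative `y` and second derivative `z` at `0`. -/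
def IsTwoJet (g : ℝ → ℝ) (x y z : ℝ) : Prop :=
  g 0 = x ∧ ∃ g' : ℝ → ℝ, (∀ᶠ t in 𝓝 0, HasDerivAt g (g' t) t) ∧ g' 0 = y ∧ HasDerivAt g' z 0

theorem IsTwoJet.const (c : ℝ) : IsTwoJet (fun _ => c) c 0 0 :=
  ⟨rfl, fun _ => 0, Eventually.of_forall fun t => hasDerivAt_const t c, rfl, hasDerivAt_const 0 0⟩

theorem IsTwoJet.add {g h : ℝ → ℝ} {x y z x' y' z' : ℝ} (hg : IsTwoJet g x y z)
    (hh : IsTwoJet h x' y' z') : IsTwoJet (fun t => g t + h t) (x + x') (y + y') (z + z') := by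
  obtain ⟨rfl, g', h1, rfl, h2⟩ := hg
  obtain ⟨rfl, h', h3, rfl, h4⟩ := hh
  exact ⟨rfl, fun t => g' t + h' t, (h1.and h3).mono fun t ht => ht.1.add ht.2, rfl, h2.add h4⟩

theorem IsTwoJet.mul {g h : ℝ → ℝ} {x y z x' y' z' : ℝ} (hg : IsTwoJet g x y z)
    (hh : IsTwoJet h x' y' z') :
    IsTwoJet (fun t => g t * h t) (x * x') (y * x' + x * y') (z * x' + 2 * (y * y') + x * z') := by
  obtain ⟨rfl, g', h1, rfl, h2⟩ := hg
  obtain ⟨rfl, h', h3, rfl, h4⟩ := hh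
  refine ⟨rfl, fun t => g' t * h t + g t * h' t, (h1.and h3).mono fun t ht => ht.1.mul ht.2, rfl, ?_⟩
  convert! (h2.mul h3.self_of_nhds).add (h1.self_of_nhds.mul h4) using 1
  ring

theorem IsTwoJet.sum {κ : Type*} (s : Finset κ) {g : κ → ℝ → ℝ} {x y z : κ → ℝ}
    (h : ∀ i, IsTwoJet (g i) (x i) (y i) (z i)) :
    IsTwoJet (fun t => ∑ i ∈ s, g i t) (∑ i ∈ s, x i) (∑ i ∈ s, y i) (∑ i ∈ s, z i) := by
  classical
  induction s using Finset.induction_on with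
  | empty => simpa using IsTwoJet.const 0
  | insert i s hi ih =>
    simp only [Finset.sum_insert hi]
    exact (h i).add ih

theorem IsTwoJet.comp {g : ℝ → ℝ} {x y z : ℝ} (hg : IsTwoJet g x y z) {φ φ' φ'' : ℝ → ℝ}
    (h1 : ∀ t, HasDerivAt φ (φ' t) t) (h2 : ∀ t, HasDerivAt φ' (φ'' t) t) :
    IsTwoJet (fun t => φ (g t)) (φ x) (φ' x * y) (φ'' x * y ^ 2 + φ' x * z) := by
  obtain ⟨rfl, g', h3, rfl, h4⟩ := hg
  refine ⟨rfl, fun t => φ' (g t) * g' t, h3.mono fun t ht => (h1 _).comp t ht, rfl, ?_⟩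
  convert! ((h2 _).comp 0 h3.self_of_nhds).mul h4 using 1
  simp only [Function.comp]
  ring

theorem IsTwoJet.unique {g : ℝ → ℝ} {x y z x' y' z' : ℝ} (h : IsTwoJet g x y z)
    (h' : IsTwoJet g x' y' z') : x = x' ∧ y = y' ∧ z = z' := by
  obtain ⟨rfl, g', h1, rfl, h2⟩ := h
  obtain ⟨rfl, g'', h3, rfl, h4⟩ := h'
  have h5 : g' =ᶠ[𝓝 0] g'' := (h1.and h3).mono fun t ht => ht.1.unique ht.2
  exact ⟨rfl, h5.self_of_nhds, h2.unique (h4.congr_of_eventuallyEq h5)⟩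

theorem isTwoJet_of_contDiffAt {E : Type*} [NormedAddCommGroup E] [NormedSpace ℝ E] {f : E → ℝ}
    {x : E} (hf : ContDiffAt ℝ ∞ f x) (v : E) :
    IsTwoJet (fun t : ℝ => f (x + t • v)) (f x) (fderiv ℝ f x v)
      (fderiv ℝ (fderiv ℝ f) x v v) := by
  have hl : ∀ t : ℝ, HasDerivAt (fun t : ℝ => x + t • v) v t := fun t => by
    simpa using ((hasDerivAt_id t).smul_const v).const_add x
  have h0 : x + (0 : ℝ) • v = x := by simp
  refine ⟨by simp, fun t => fderiv ℝ f (x + t • v) v, ?_, by simp, ?_⟩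
  · have h1 : ∀ᶠ y in 𝓝 x, DifferentiableAt ℝ f y :=
      ((hf.of_le (m := 1) (by simp)).eventually (by simp)).mono fun y hy =>
        hy.differentiableAt (by simp)
    have h2 : Tendsto (fun t : ℝ => x + t • v) (𝓝 0) (𝓝 x) := by
      have := (hl 0).continuousAt.tendsto
      rwa [h0] at this
    filter_upwards [h2.eventually h1] with t ht
    exact ht.hasFDerivAt.comp_hasDerivAt t (hl t)
  · have h1 : HasFDerivAt (fderiv ℝ f) (fderiv ℝ (fderiv ℝ f) x) (x + (0 : ℝ) • v) := by
      rw [h0]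
      exact ((hf.fderiv_right (m := ∞) (by simp)).differentiableAt (by simp)).hasFDerivAt
    have h2 := h1.comp_hasDerivAt (0 : ℝ) (hl 0)
    have h3 := h2.clm_apply (hasDerivAt_const (0 : ℝ) v)
    simpa using h3

end Jets

/-! ### The nested exponential function of triangular matrices and its Laplacian -/

section Exhaustion

/-- A smooth convex function comparable with the absolute value. -/
def softAbs (u : ℝ) : ℝ := Real.sqrt (1 + u ^ 2)

theorem one_le_softAbs (u : ℝ) : 1 ≤ softAbs u := by
  rw [softAbs, Real.one_le_sqrt]; nlinarith [sq_nonneg u]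

theorem softAbs_sq (u : ℝ) : softAbs u ^ 2 = 1 + u ^ 2 := Real.sq_sqrt (by positivity)

theorem abs_le_softAbs (u : ℝ) : |u| ≤ softAbs u :=
  Real.abs_le_sqrt (by linarith)

theorem hasDerivAt_softAbs (u : ℝ) : HasDerivAt softAbs (u / softAbs u) u := by
  have h := ((hasDerivAt_pow 2 u).const_add 1).sqrt (by positivity)
  convert! h using 1
  rw [← softAbs]
  have := one_le_softAbs u
  field_simp
  norm_num
  ring

theorem hasDerivAt_softAbs' (u : ℝ) :
    HasDerivAt (fun u => u / softAbs u) (1 / softAbs u ^ 3) u := by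
  have h1 := one_le_softAbs u
  have h := (hasDerivAt_id u).div (hasDerivAt_softAbs u) (by positivity)
  convert! h using 1
  have := softAbs_sq u
  field_simp
  simp only [id]
  nlinarith

theorem contDiff_softAbs : ContDiff ℝ ∞ softAbs :=
  (contDiff_const.add (contDiff_id.pow 2)).sqrt fun u => by positivity

variable {J : Type*} [Fintype J]

/-- An exhaustion function on triangular matrices, built level by level. -/
def levelFun (K : ℝ) (wt : J → ℕ) : ℕ → (J → J → ℝ) → ℝ
  | 0, _ => 0
  | d + 1, u => Real.exp (K * levelFun K wt d u) +
      ∑ a, ∑ b, if wt a = wt b + (d + 1) then softAbs (u a b) else 0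

theorem levelFun_nonneg (K : ℝ) (wt : J → ℕ) (d : ℕ) (u : J → J → ℝ) : 0 ≤ levelFun K wt d u := by
  cases d with
  | zero => exact le_rfl
  | succ d =>
    refine add_nonneg (Real.exp_pos _).le (Finset.sum_nonneg fun a _ => Finset.sum_nonneg fun b _ => ?_)
    split_ifs
    · exact zero_le_one.trans (one_le_softAbs _)
    · exact le_rfl

theorem softAbs_le_levelFun (K : ℝ) {wt : J → ℕ} {d : ℕ} (u : J → J → ℝ) {a b : J}
    (h : wt a = wt b + (d + 1)) : softAbs (u a b) ≤ levelFun K wt (d + 1) u := by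
  have hnn : ∀ a b, 0 ≤ if wt a = wt b + (d + 1) then softAbs (u a b) else 0 := by
    intro a b
    split_ifs
    · exact zero_le_one.trans (one_le_softAbs _)
    · exact le_rfl
  have h1 : softAbs (u a b) ≤ ∑ b, if wt a = wt b + (d + 1) then softAbs (u a b) else 0 := by
    refine le_trans (by rw [if_pos h]) (Finset.single_le_sum (f := fun b =>
      if wt a = wt b + (d + 1) then softAbs (u a b) else 0) (fun b _ => hnn a b) (Finset.mem_univ b))
  have h2 := Finset.single_le_sum (f := fun a => ∑ b, if wt a = wt b + (d + 1) then
    softAbs (u a b) else 0) (fun a _ => Finset.sum_nonneg fun b _ => hnn a b) (Finset.mem_univ a)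
  have := Real.exp_pos (K * levelFun K wt d u)
  rw [levelFun]
  linarith

theorem levelFun_le_succ {K : ℝ} (hK : 1 ≤ K) (wt : J → ℕ) (d : ℕ) (u : J → J → ℝ) :
    levelFun K wt d u ≤ levelFun K wt (d + 1) u := by
  have h0 := levelFun_nonneg K wt d u
  have h1 : levelFun K wt d u ≤ Real.exp (K * levelFun K wt d u) := by
    have := Real.add_one_le_exp (K * levelFun K wt d u)
    nlinarith
  refine h1.trans (le_add_of_nonneg_right (Finset.sum_nonneg fun a _ =>
    Finset.sum_nonneg fun b _ => ?_))
  split_ifs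
  · exact zero_le_one.trans (one_le_softAbs _)
  · exact le_rfl

/-- All entries of level at most `d` are controlled by the function of level `d`, so error terms
polynomial in them can be absorbed by its exponential. -/
theorem abs_le_levelFun {K : ℝ} (hK : 1 ≤ K) {wt : J → ℕ} (d : ℕ) {u : J → J → ℝ}
    (hu : ∀ a b, u a b ≠ 0 → wt b < wt a) {a b : J} (h : wt a ≤ wt b + d) :
    |u a b| ≤ levelFun K wt d u := by
  induction d with
  | zero =>
    have : u a b = 0 := by
      by_contra h'; have := hu a b h'; omega
    rw [this, abs_zero]; exact levelFun_nonneg K wt 0 u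
  | succ d ih =>
    rcases Nat.lt_or_ge (wt b + d) (wt a) with h1 | h1
    · exact (abs_le_softAbs _).trans (softAbs_le_levelFun K u (by omega))
    · exact (ih h1).trans (levelFun_le_succ hK wt d u)

theorem contDiff_levelFun (K : ℝ) (wt : J → ℕ) (d : ℕ) : ContDiff ℝ ∞ (levelFun K wt d) := by
  induction d with
  | zero => exact contDiff_const
  | succ d ih =>
    refine ContDiff.add (Real.contDiff_exp.comp (contDiff_const.mul ih))
      (ContDiff.sum fun a _ => ContDiff.sum fun b _ => ?_)
    by_cases h : wt a = wt b + (d + 1)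
    · simp only [if_pos h]
      exact contDiff_softAbs.comp ((contDiff_apply_apply ℝ ℝ a b).of_le le_top)
    · simp only [if_neg h]; exact contDiff_const

/-- The contribution of the entries of level at most `d`. -/
def levelNorm (wt : J → ℕ) (r s : J → J → ℝ) (d : ℕ) : ℝ :=
  ∑ a, ∑ b, if wt a ≤ wt b + d then r a b ^ 2 + s a b ^ 2 else 0

theorem levelNorm_nonneg (wt : J → ℕ) (r s : J → J → ℝ) (d : ℕ) : 0 ≤ levelNorm wt r s d :=
  Finset.sum_nonneg fun a _ => Finset.sum_nonneg fun b _ => by split_ifs <;> positivity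

theorem le_levelNorm (wt : J → ℕ) (r s : J → J → ℝ) {d : ℕ} {a b : J} (h : wt a ≤ wt b + d) :
    r a b ^ 2 + s a b ^ 2 ≤ levelNorm wt r s d := by
  have hnn : ∀ a b, 0 ≤ if wt a ≤ wt b + d then r a b ^ 2 + s a b ^ 2 else 0 := by
    intro a b; split_ifs <;> positivity
  have h1 : r a b ^ 2 + s a b ^ 2 ≤ ∑ b, if wt a ≤ wt b + d then r a b ^ 2 + s a b ^ 2 else 0 := by
    refine le_trans (by rw [if_pos h]) (Finset.single_le_sum (f := fun b =>
      if wt a ≤ wt b + d then r a b ^ 2 + s a b ^ 2 else 0) (fun b _ => hnn a b) (Finset.mem_univ b))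
  exact h1.trans (Finset.single_le_sum (f := fun a => ∑ b, if wt a ≤ wt b + d then
    r a b ^ 2 + s a b ^ 2 else 0) (fun a _ => Finset.sum_nonneg fun b _ => hnn a b)
    (Finset.mem_univ a))

theorem levelNorm_succ (wt : J → ℕ) (r s : J → J → ℝ) (d : ℕ) :
    levelNorm wt r s (d + 1) = levelNorm wt r s d +
      ∑ a, ∑ b, if wt a = wt b + (d + 1) then r a b ^ 2 + s a b ^ 2 else 0 := by
  simp only [levelNorm, ← Finset.sum_add_distrib]
  refine Finset.sum_congr rfl fun a _ => Finset.sum_congr rfl fun b _ => ?_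
  rcases lt_trichotomy (wt a) (wt b + (d + 1)) with h | h | h
  · rw [if_pos h.le, if_pos (by omega), if_neg h.ne, add_zero]
  · rw [if_pos h.le, if_neg (by omega), if_pos h, zero_add]
  · rw [if_neg (by omega), if_neg (by omega), if_neg (by omega), add_zero]

theorem abs_sum_le_card_mul {f : J → ℝ} {B : ℝ} (h : ∀ c, |f c| ≤ B) :
    |∑ c, f c| ≤ Fintype.card J * B := by
  refine (Finset.abs_sum_le_sum_abs _ _).trans ((Finset.sum_le_card_nsmul _ _ B fun c _ => h c).trans ?_)
  rw [nsmul_eq_mul, Finset.card_univ]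

/-- The estimate for one matrix coefficient. -/
theorem softAbs_laplacian_ge {n f S u p p' l x y r s F : ℝ} (hp : p = s - x)
    (hp' : p' = r + y) (hx : x ^ 2 ≤ n ^ 2 * f ^ 2 * S) (hy : y ^ 2 ≤ n ^ 2 * f ^ 2 * S)
    (hl : |l| ≤ 4 * n * S + 4 * n ^ 2 * f * S) (hF : softAbs u ≤ F) :
    1 / 2 * Real.exp (-3 * F) * (r ^ 2 + s ^ 2) -
        (2 * n ^ 2 * f ^ 2 + 4 * n + 4 * n ^ 2 * f) * S ≤
      1 / softAbs u ^ 3 * (p ^ 2 + p' ^ 2) + u / softAbs u * l := by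
  have h1 := one_le_softAbs u
  have hq1 : 1 / softAbs u ^ 3 ≤ 1 := by
    rw [div_le_one (by positivity)]; exact one_le_pow₀ h1
  -- The second derivative of `softAbs` decays like its inverse cube; since `softAbs u ≤ F ≤ exp F`,
  -- it stays above `exp (-3 * F)`.
  have hq2 : Real.exp (-3 * F) ≤ 1 / softAbs u ^ 3 := by
    have h2 : softAbs u ^ 3 ≤ Real.exp (3 * F) := by
      have h3 : softAbs u ≤ Real.exp F := by
        have := Real.add_one_le_exp F; linarith
      calc softAbs u ^ 3 ≤ Real.exp F ^ 3 := by gcongr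
        _ = Real.exp (3 * F) := by rw [← Real.exp_nat_mul]; norm_num
    rw [neg_mul, Real.exp_neg, ← one_div]
    exact one_div_le_one_div_of_le (by positivity) h2
  have hu : |u / softAbs u| ≤ 1 := by
    rw [abs_div, abs_of_pos (by linarith : 0 < softAbs u), div_le_one (by linarith)]
    exact abs_le_softAbs u
  have hul : -|l| ≤ u / softAbs u * l := by
    have : |u / softAbs u * l| ≤ |l| := by
      rw [abs_mul]; nlinarith [abs_nonneg l]
    linarith [neg_abs_le (u / softAbs u * l)]
  have hpp : (r ^ 2 + s ^ 2) / 2 - (x ^ 2 + y ^ 2) ≤ p ^ 2 + p' ^ 2 := by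
    rw [hp, hp']; nlinarith [sq_nonneg (s - 2 * x), sq_nonneg (r + 2 * y)]
  have hq0 : 0 ≤ 1 / softAbs u ^ 3 := by positivity
  have h3 : 1 / softAbs u ^ 3 * ((r ^ 2 + s ^ 2) / 2 - (x ^ 2 + y ^ 2)) ≤
      1 / softAbs u ^ 3 * (p ^ 2 + p' ^ 2) := mul_le_mul_of_nonneg_left hpp hq0
  have h4 : Real.exp (-3 * F) * (r ^ 2 + s ^ 2) ≤ 1 / softAbs u ^ 3 * (r ^ 2 + s ^ 2) :=
    mul_le_mul_of_nonneg_right hq2 (by positivity)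
  have h5 : 1 / softAbs u ^ 3 * (x ^ 2 + y ^ 2) ≤ x ^ 2 + y ^ 2 :=
    mul_le_of_le_one_left (by positivity) hq1
  linarith

/-- Induction on the level. A new entry contributes `exp (-3F)(r² + s²)/2` up to errors. Strict
triangularity forces the products in these errors to involve only entries of lower level, so they
are bounded by a polynomial in `f` times the lower norm `S`. The Laplacian of `exp (K f)` is at
least `K exp (K f) · exp (-3f) S / 2` by induction, and this absorbs them when `K` is large. -/
theorem levelFun_laplacian_ge {wt : J → ℕ} {U U' : J → J → ℝ → ℝ} {u u₁ u₂ u₁' u₂' r s : J → J → ℝ}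
    (hU : ∀ a b, IsTwoJet (U a b) (u a b) (u₁ a b) (u₂ a b))
    (hU' : ∀ a b, IsTwoJet (U' a b) (u a b) (u₁' a b) (u₂' a b))
    (hu : ∀ a b, u a b ≠ 0 → wt b < wt a) (hr : ∀ a b, r a b ≠ 0 → wt b < wt a)
    (hs : ∀ a b, s a b ≠ 0 → wt b < wt a)
    (h₁ : ∀ a b, u₁ a b = s a b - ∑ c, u a c * r c b)
    (h₁' : ∀ a b, u₁' a b = r a b + ∑ c, u a c * s c b)
    (h₂ : ∀ a b, u₂ a b + u₂' a b = 2 * (∑ c, r a c * s c b - ∑ c, s a c * r c b +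
      ∑ c, ∑ e, u a c * (r c e * r e b + s c e * s e b)))
    {K : ℝ} (hK : K = 20 * (Fintype.card J) ^ 4 + 5) (d : ℕ) :
    ∃ f₁ f₂ f₁' f₂', IsTwoJet (fun t => levelFun K wt d fun a b => U a b t) (levelFun K wt d u) f₁ f₂ ∧
      IsTwoJet (fun t => levelFun K wt d fun a b => U' a b t) (levelFun K wt d u) f₁' f₂' ∧
      1 / 2 * Real.exp (-3 * levelFun K wt d u) * levelNorm wt r s d ≤ f₂ + f₂' := by
  have hK1 : (5 : ℝ) ≤ K := by rw [hK]; linarith [pow_nonneg (Nat.cast_nonneg (α := ℝ) (Fintype.card J)) 4]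
  induction d with
  | zero =>
    refine ⟨0, 0, 0, 0, IsTwoJet.const 0, IsTwoJet.const 0, ?_⟩
    have : levelNorm wt r s 0 = 0 := by
      refine Finset.sum_eq_zero fun a _ => Finset.sum_eq_zero fun b _ => ?_
      split_ifs with h
      · have h1 : r a b = 0 := by
          by_contra h'; have := hr a b h'; omega
        have h2 : s a b = 0 := by
          by_contra h'; have := hs a b h'; omega
        simp [h1, h2]
      · rfl
    simp [this]
  | succ d ih =>
    obtain ⟨f₁, f₂, f₁', f₂', hf, hf', hge⟩ := ih
    set f := levelFun K wt d u with hfdef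
    set S := levelNorm wt r s d with hS
    have hexp : ∀ {g : ℝ → ℝ} {x y z : ℝ}, IsTwoJet g x y z → IsTwoJet (fun t => Real.exp (K * g t))
        (Real.exp (K * x)) (Real.exp (K * x) * K * y)
        (Real.exp (K * x) * K * K * y ^ 2 + Real.exp (K * x) * K * z) := by
      intro g x y z hg
      have e : ∀ t, HasDerivAt (fun t => Real.exp (K * t)) (Real.exp (K * t) * K) t := fun t => by
        simpa using ((hasDerivAt_id t).const_mul K).exp
      exact hg.comp e fun t => (e t).mul_const K
    have hsoft : ∀ {V : J → J → ℝ → ℝ} {v₁ v₂ : J → J → ℝ},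
        (∀ a b, IsTwoJet (V a b) (u a b) (v₁ a b) (v₂ a b)) → ∀ a b,
        IsTwoJet (fun t => if wt a = wt b + (d + 1) then softAbs (V a b t) else 0)
          (if wt a = wt b + (d + 1) then softAbs (u a b) else 0)
          (if wt a = wt b + (d + 1) then u a b / softAbs (u a b) * v₁ a b else 0)
          (if wt a = wt b + (d + 1) then 1 / softAbs (u a b) ^ 3 * v₁ a b ^ 2 +
            u a b / softAbs (u a b) * v₂ a b else 0) := by
      intro V v₁ v₂ hV a b
      by_cases h : wt a = wt b + (d + 1)
      · simp only [if_pos h]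
        exact (hV a b).comp hasDerivAt_softAbs hasDerivAt_softAbs'
      · simp only [if_neg h]
        exact IsTwoJet.const 0
    refine ⟨_, _, _, _,
      (hexp hf).add (IsTwoJet.sum _ fun a => IsTwoJet.sum _ fun b => hsoft hU a b),
      (hexp hf').add (IsTwoJet.sum _ fun a => IsTwoJet.sum _ fun b => hsoft hU' a b), ?_⟩
    set F := levelFun K wt (d + 1) u with hFdef
    set n : ℝ := (Fintype.card J : ℝ) with hn
    have hn0 : 0 ≤ n := Nat.cast_nonneg _
    have hn12 : n ≤ n ^ 2 := by
      rw [hn]; exact_mod_cast Nat.le_self_pow two_ne_zero _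
    have hf0 : 0 ≤ f := levelFun_nonneg K wt d u
    have hS0 : 0 ≤ S := levelNorm_nonneg wt r s d
    have hfu : ∀ {a b}, wt a ≤ wt b + d → |u a b| ≤ f := fun h =>
      abs_le_levelFun (by linarith) d hu h
    have hSr : ∀ {a b}, wt a ≤ wt b + d → |r a b| ≤ Real.sqrt S := fun {a b} h =>
      Real.abs_le_sqrt (by nlinarith [le_levelNorm wt r s h, sq_nonneg (s a b)])
    have hSs : ∀ {a b}, wt a ≤ wt b + d → |s a b| ≤ Real.sqrt S := fun {a b} h =>
      Real.abs_le_sqrt (by nlinarith [le_levelNorm wt r s h, sq_nonneg (r a b)])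
    have hsq : Real.sqrt S * Real.sqrt S = S := Real.mul_self_sqrt hS0
    -- products of entries
    have h2 : ∀ {x y : J → J → ℝ}, (∀ a b, x a b ≠ 0 → wt b < wt a) →
        (∀ a b, y a b ≠ 0 → wt b < wt a) → ∀ {B C : ℝ}, 0 ≤ B → 0 ≤ C →
        (∀ {a b}, wt a ≤ wt b + d → |x a b| ≤ B) → (∀ {a b}, wt a ≤ wt b + d → |y a b| ≤ C) →
        ∀ {a b}, wt a ≤ wt b + (d + 1) → ∀ c, |x a c * y c b| ≤ B * C := by
      intro x y hx hy B C hB hC hxB hyC a b hab c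
      by_cases h : x a c = 0
      · simp only [h, zero_mul, abs_zero]; positivity
      by_cases h' : y c b = 0
      · simp only [h', mul_zero, abs_zero]; positivity
      have := hx a c h
      have := hy c b h'
      rw [abs_mul]
      exact mul_le_mul (hxB (by omega)) (hyC (by omega)) (abs_nonneg _) hB
    have h3 : ∀ {x : J → J → ℝ}, (∀ a b, x a b ≠ 0 → wt b < wt a) →
        (∀ {a b}, wt a ≤ wt b + d → |x a b| ≤ Real.sqrt S) →
        ∀ {a b}, wt a ≤ wt b + (d + 1) → ∀ c e, |u a c * (x c e * x e b)| ≤ f * S := by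
      intro x hx hxB a b hab c e
      by_cases h : u a c = 0
      · simp only [h, zero_mul, abs_zero]; positivity
      by_cases h' : x c e = 0
      · simp only [h', zero_mul, mul_zero, abs_zero]; positivity
      by_cases h'' : x e b = 0
      · simp only [h'', mul_zero, abs_zero]; positivity
      have := hu a c h
      have := hx c e h'
      have := hx e b h''
      rw [abs_mul, abs_mul, ← hsq]
      exact mul_le_mul (hfu (by omega)) (mul_le_mul (hxB (by omega)) (hxB (by omega)) (abs_nonneg _)
        (Real.sqrt_nonneg _)) (by positivity) hf0
    have hsum2 : ∀ {g : J → ℝ} {B : ℝ}, (∀ c, |g c| ≤ f * Real.sqrt S) →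
        (∑ c, g c) ^ 2 ≤ n ^ 2 * f ^ 2 * S := by
      intro g B hg
      have := abs_sum_le_card_mul hg
      rw [← hn] at this
      calc (∑ c, g c) ^ 2 = |∑ c, g c| ^ 2 := (sq_abs _).symm
        _ ≤ (n * (f * Real.sqrt S)) ^ 2 := by gcongr
        _ = n ^ 2 * f ^ 2 * (Real.sqrt S * Real.sqrt S) := by ring
        _ = n ^ 2 * f ^ 2 * S := by rw [hsq]
    set err := (2 * n ^ 2 * f ^ 2 + 4 * n + 4 * n ^ 2 * f) * S with herr
    have herr0 : 0 ≤ err := by positivity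
    have hentry : ∀ a b, (1 / 2 * Real.exp (-3 * F)) *
          (if wt a = wt b + (d + 1) then r a b ^ 2 + s a b ^ 2 else 0) - err ≤
        (if wt a = wt b + (d + 1) then 1 / softAbs (u a b) ^ 3 * u₁ a b ^ 2 +
            u a b / softAbs (u a b) * u₂ a b else 0) +
        (if wt a = wt b + (d + 1) then 1 / softAbs (u a b) ^ 3 * u₁' a b ^ 2 +
            u a b / softAbs (u a b) * u₂' a b else 0) := by
      intro a b
      by_cases h : wt a = wt b + (d + 1)
      · simp only [if_pos h]
        have hl : |u₂ a b + u₂' a b| ≤ 4 * n * S + 4 * n ^ 2 * f * S := by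
          rw [h₂, abs_mul, abs_two]
          have e1 := abs_sum_le_card_mul (h2 hr hs (Real.sqrt_nonneg S) (Real.sqrt_nonneg S) hSr hSs
            h.le)
          have e2 := abs_sum_le_card_mul (h2 hs hr (Real.sqrt_nonneg S) (Real.sqrt_nonneg S) hSs hSr
            h.le)
          have e3 : |∑ c, ∑ e, u a c * (r c e * r e b + s c e * s e b)| ≤ n * (n * (2 * (f * S))) := by
            refine abs_sum_le_card_mul fun c => abs_sum_le_card_mul fun e => ?_
            rw [mul_add]
            refine (abs_add_le _ _).trans ?_
            have := h3 hr hSr h.le c e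
            have := h3 hs hSs h.le c e
            linarith
          rw [← hn, hsq] at e1 e2
          have e4 := abs_add_le (∑ c, r a c * s c b - ∑ c, s a c * r c b)
            (∑ c, ∑ e, u a c * (r c e * r e b + s c e * s e b))
          have e5 := abs_sub (∑ c, r a c * s c b) (∑ c, s a c * r c b)
          nlinarith
        have := softAbs_laplacian_ge (u := u a b) (F := F) (h₁ a b) (h₁' a b)
          (hsum2 (B := 0) (h2 hu hr hf0 (Real.sqrt_nonneg S) hfu hSr h.le))
          (hsum2 (B := 0) (h2 hu hs hf0 (Real.sqrt_nonneg S) hfu hSs h.le)) hl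
          (softAbs_le_levelFun K u h)
        linarith
      · simp only [if_neg h]
        linarith
    have hsum := Finset.sum_le_sum fun a (_ : a ∈ Finset.univ) => Finset.sum_le_sum
      fun b (_ : b ∈ Finset.univ) => hentry a b
    simp only [Finset.sum_add_distrib, Finset.sum_sub_distrib, ← Finset.mul_sum, Finset.sum_const,
      Finset.card_univ, nsmul_eq_mul, ← hn] at hsum
    rw [levelNorm_succ, ← hS]
    -- the main term
    have hmain : err * n ^ 2 + 1 / 2 * Real.exp (-3 * F) * S ≤
        Real.exp (K * f) * K * (f₂ + f₂') := by
      have e0 : Real.exp (K * f) * K * (1 / 2 * Real.exp (-3 * f) * S) ≤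
          Real.exp (K * f) * K * (f₂ + f₂') := by gcongr
      refine le_trans ?_ e0
      have e1 : Real.exp (K * f) * K * (1 / 2 * Real.exp (-3 * f) * S) =
          K / 2 * Real.exp ((K - 3) * f) * S := by
        rw [show (K - 3) * f = K * f + -3 * f by ring, Real.exp_add]; ring
      have e2 : Real.exp f ^ 2 ≤ Real.exp ((K - 3) * f) := by
        rw [← Real.exp_nat_mul]
        apply Real.exp_le_exp.2
        push_cast
        nlinarith
      have e3 : f ≤ Real.exp f := by linarith [Real.add_one_le_exp f]
      have e4 : 1 ≤ Real.exp f := Real.one_le_exp hf0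
      have e5 : Real.exp (-3 * F) ≤ 1 := Real.exp_le_one_iff.2 (by
        nlinarith [levelFun_nonneg K wt (d + 1) u])
      rw [e1]
      set y := Real.exp f
      -- This bound fixes the choice of `K`: one needs `K / 2 ≥ 10 n⁴ + 1/2` to absorb the errors
      -- together with the required lower-level term, and `K - 3 ≥ 2` for the exponential to
      -- dominate `y ^ 2`.
      have e6 : err * n ^ 2 ≤ 10 * n ^ 4 * y ^ 2 * S := by
        have i1 : f ^ 2 ≤ y ^ 2 := by gcongr
        have i2 : f ≤ y ^ 2 := by nlinarith
        have i3 : 1 ≤ y ^ 2 := one_le_pow₀ e4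
        have i4 : n ≤ n ^ 2 * y ^ 2 := by nlinarith
        have i5 : n ^ 2 * f ^ 2 ≤ n ^ 2 * y ^ 2 := by gcongr
        have i6 : n ^ 2 * f ≤ n ^ 2 * y ^ 2 := by gcongr
        calc err * n ^ 2 = (2 * (n ^ 2 * f ^ 2) + 4 * n + 4 * (n ^ 2 * f)) * (S * n ^ 2) := by
              rw [herr]; ring
          _ ≤ (2 * (n ^ 2 * y ^ 2) + 4 * (n ^ 2 * y ^ 2) + 4 * (n ^ 2 * y ^ 2)) * (S * n ^ 2) := by
              gcongr
          _ = 10 * n ^ 4 * y ^ 2 * S := by ring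
      have e7 : 1 / 2 * Real.exp (-3 * F) * S ≤ 1 / 2 * y ^ 2 * S := by
        have i3 : 1 ≤ y ^ 2 := one_le_pow₀ e4
        gcongr
        linarith
      have e8 : (10 * n ^ 4 + 1 / 2) * y ^ 2 * S ≤ K / 2 * Real.exp ((K - 3) * f) * S := by
        have i0 : 10 * n ^ 4 + 1 / 2 ≤ K / 2 := by rw [hK]; linarith
        gcongr
      linarith
    -- The squared first derivatives produced by the exponential have the right sign and are
    -- dropped.
    have hsq1 : 0 ≤ Real.exp (K * f) * K * K * f₁ ^ 2 := by positivity
    have hsq2 : 0 ≤ Real.exp (K * f) * K * K * f₁' ^ 2 := by positivity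
    rw [mul_add (Real.exp (K * f) * K)] at hmain
    rw [mul_add (1 / 2 * Real.exp (-3 * F))]
    generalize (∑ a, ∑ b, if wt a = wt b + (d + 1) then 1 / softAbs (u a b) ^ 3 * u₁ a b ^ 2 +
      u a b / softAbs (u a b) * u₂ a b else 0) = X at hsum ⊢
    generalize (∑ a, ∑ b, if wt a = wt b + (d + 1) then 1 / softAbs (u a b) ^ 3 * u₁' a b ^ 2 +
      u a b / softAbs (u a b) * u₂' a b else 0) = X' at hsum ⊢
    generalize (1 / 2 * Real.exp (-3 * F) * ∑ a, ∑ b, if wt a = wt b + (d + 1) then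
      r a b ^ 2 + s a b ^ 2 else 0) = Z at hsum ⊢
    have hn2 : n * (n * err) = err * n ^ 2 := by ring
    rw [hn2] at hsum
    linarith only [hsum, hmain, hsq1, hsq2]

end Exhaustion

/-! ### Unitriangular matrices and their inverses -/

section Triangular

variable {J : Type*} [Fintype J] [DecidableEq J] {R : Type*} [CommRing R]

/-- The entries of `M` vanish unless the weight rises by at least `k`. -/
def IsTriangular (wt : J → ℕ) (k : ℕ) (M : Matrix J J R) : Prop :=
  ∀ a b, M a b ≠ 0 → wt b + k ≤ wt a

variable {wt : J → ℕ}

theorem IsTriangular.mul {k l : ℕ} {M N : Matrix J J R} (hM : IsTriangular wt k M)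
    (hN : IsTriangular wt l N) : IsTriangular wt (k + l) (M * N) := by
  intro a b h
  rw [Matrix.mul_apply] at h
  obtain ⟨c, -, hc⟩ := Finset.exists_ne_zero_of_sum_ne_zero h
  have h1 := hM a c (left_ne_zero_of_mul hc)
  have h2 := hN c b (right_ne_zero_of_mul hc)
  omega

theorem IsTriangular.one : IsTriangular wt 0 (1 : Matrix J J R) := by
  intro a b h
  by_cases hab : a = b
  · simp [hab]
  · exact absurd (Matrix.one_apply_ne hab) h

theorem IsTriangular.pow {k : ℕ} {M : Matrix J J R} (hM : IsTriangular wt k M) (n : ℕ) :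
    IsTriangular wt (k * n) (M ^ n) := by
  induction n with
  | zero => simpa using IsTriangular.one
  | succ n ih => rw [pow_succ, mul_add, mul_one]; exact ih.mul hM

theorem IsTriangular.mono {k l : ℕ} (hkl : k ≤ l) {M : Matrix J J R} (hM : IsTriangular wt l M) :
    IsTriangular wt k M := fun a b h => by have := hM a b h; omega

theorem IsTriangular.sum {κ : Type*} (s : Finset κ) {k : ℕ} {M : κ → Matrix J J R}
    (hM : ∀ i, IsTriangular wt k (M i)) : IsTriangular wt k (∑ i ∈ s, M i) := by
  intro a b h
  rw [Matrix.sum_apply] at h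
  obtain ⟨i, -, hi⟩ := Finset.exists_ne_zero_of_sum_ne_zero h
  exact hM i a b hi

theorem IsTriangular.eq_zero {k : ℕ} (hk : ∀ a, wt a < k) {M : Matrix J J R}
    (hM : IsTriangular wt k M) : M = 0 := by
  ext a b
  by_contra h
  have := hM a b h
  have := hk a
  omega

variable (wt) in
/-- The inverse of a unitriangular matrix, as a polynomial. -/
def triInv (P : Matrix J J R) : Matrix J J R :=
  ∑ k ∈ Finset.range (Finset.univ.sup wt + 1), (1 - P) ^ k

/-- The Neumann series terminates: each factor `1 - P` raises the weight, so a power beyond the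
largest weight vanishes. -/
theorem mul_triInv {P : Matrix J J R} (hP : IsTriangular wt 1 (1 - P)) : P * triInv wt P = 1 := by
  have h1 : (1 - P) ^ (Finset.univ.sup wt + 1) = 0 :=
    IsTriangular.eq_zero (wt := wt) (k := 1 * (Finset.univ.sup wt + 1))
      (fun a => by have := Finset.le_sup (f := wt) (Finset.mem_univ a); omega) (hP.pow _)
  have h2 := mul_neg_geom_sum (1 - P) (Finset.univ.sup wt + 1)
  rw [h1, sub_sub_cancel, sub_zero] at h2
  exact h2

theorem triInv_mul {P : Matrix J J R} (hP : IsTriangular wt 1 (1 - P)) : triInv wt P * P = 1 :=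
  mul_eq_one_comm.1 (mul_triInv hP)

theorem isTriangular_triInv {P : Matrix J J R} (hP : IsTriangular wt 1 (1 - P)) :
    IsTriangular wt 0 (triInv wt P) :=
  IsTriangular.sum _ fun k => (hP.pow k).mono (Nat.zero_le _)

/-- The complex matrix `A` is unitriangular. -/
def IsUnitriangular (wt : J → ℕ) (A : J → J → R) : Prop :=
  ∀ a b, ¬ wt b < wt a → A a b = if a = b then 1 else 0

theorem IsUnitriangular.one_sub {A : J → J → R} (hA : IsUnitriangular wt A) :
    IsTriangular wt 1 (1 - Matrix.of A) := by
  intro a b h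
  by_contra h'
  apply h
  rw [Matrix.sub_apply, Matrix.of_apply, hA a b (by omega), Matrix.one_apply, sub_self]

end Triangular

/-! ### The slope of a complex unitriangular matrix and its plurisubharmonic function -/

section Slope

variable {J : Type*} [Fintype J] [DecidableEq J] {wt : J → ℕ}

/-- The real part of a complex matrix. -/
def reMat (A : J → J → ℂ) : Matrix J J ℝ := Matrix.of fun a b => (A a b).re

/-- The imaginary part of a complex matrix. -/
def imMat (A : J → J → ℂ) : Matrix J J ℝ := Matrix.of fun a b => (A a b).im

variable (wt) in
/-- The product `(Im A) (Re A)⁻¹` for a unitriangular complex matrix `A`. -/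
def slopeMat (A : J → J → ℂ) : Matrix J J ℝ := imMat A * triInv wt (reMat A)

theorem IsUnitriangular.reMat {A : J → J → ℂ} (hA : IsUnitriangular wt A) :
    IsTriangular wt 1 (1 - reMat A) := by
  refine IsUnitriangular.one_sub (A := fun a b => (A a b).re) fun a b h => ?_
  change (A a b).re = _
  rw [hA a b h]
  split_ifs <;> simp

theorem IsUnitriangular.imMat {A : J → J → ℂ} (hA : IsUnitriangular wt A) :
    IsTriangular wt 1 (imMat A) := by
  intro a b h
  by_contra h'
  apply h
  change (A a b).im = 0
  rw [hA a b (by omega)]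
  split_ifs <;> simp

theorem slopeMat_mul_reMat {A : J → J → ℂ} (hA : IsUnitriangular wt A) :
    slopeMat wt A * reMat A = imMat A := by
  rw [slopeMat, mul_assoc, triInv_mul hA.reMat, mul_one]

theorem isTriangular_slopeMat {A : J → J → ℂ} (hA : IsUnitriangular wt A) :
    IsTriangular wt 1 (slopeMat wt A) := hA.imMat.mul (isTriangular_triInv hA.reMat)

/-- The slope is invariant under right multiplication by real matrices. -/
theorem slopeMat_mul_real {A C A' : J → J → ℂ} (hA : IsUnitriangular wt A)
    (hA' : IsUnitriangular wt A') (hC : ∀ a b, (C a b).im = 0)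
    (h : ∀ a b, A' a b = ∑ c, A a c * C c b) : slopeMat wt A' = slopeMat wt A := by
  have h1 : reMat A' = reMat A * reMat C := by
    ext a b
    simp [reMat, Matrix.mul_apply, h, Complex.mul_re, hC]
  have h2 : imMat A' = imMat A * reMat C := by
    ext a b
    simp [imMat, reMat, Matrix.mul_apply, h, Complex.mul_im, hC]
  calc slopeMat wt A' = imMat A' * triInv wt (reMat A') := rfl
    _ = slopeMat wt A * (reMat A' * triInv wt (reMat A')) := by
      rw [h2, ← slopeMat_mul_reMat hA, h1]; simp only [mul_assoc]
    _ = slopeMat wt A := by rw [mul_triInv hA'.reMat, mul_one]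

section Smooth

variable {E : Type*} [NormedAddCommGroup E] [NormedSpace ℝ E] {z : E}

/-- A matrix valued function with smooth coefficients. -/
def SmoothEntriesAt (M : E → Matrix J J ℝ) (z : E) : Prop :=
  ∀ a b, ContDiffAt ℝ ∞ (fun y => M y a b) z

theorem SmoothEntriesAt.mul {M N : E → Matrix J J ℝ} (hM : SmoothEntriesAt M z)
    (hN : SmoothEntriesAt N z) : SmoothEntriesAt (fun y => M y * N y) z := by
  intro a b
  simp only [Matrix.mul_apply]
  exact ContDiffAt.sum fun c _ => (hM a c).mul (hN c b)

theorem smoothEntriesAt_const (M : Matrix J J ℝ) : SmoothEntriesAt (fun _ : E => M) z :=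
  fun _ _ => contDiffAt_const

theorem SmoothEntriesAt.pow {M : E → Matrix J J ℝ} (hM : SmoothEntriesAt M z) (n : ℕ) :
    SmoothEntriesAt (fun y => M y ^ n) z := by
  induction n with
  | zero => simpa using smoothEntriesAt_const 1
  | succ n ih => simp only [pow_succ]; exact ih.mul hM

theorem SmoothEntriesAt.triInv {M : E → Matrix J J ℝ} (hM : SmoothEntriesAt M z) :
    SmoothEntriesAt (fun y => triInv wt (M y)) z := by
  intro a b
  simp only [_root_.triInv, Matrix.sum_apply]
  refine ContDiffAt.sum fun k _ => ?_
  exact SmoothEntriesAt.pow (M := fun y => 1 - M y)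
    (fun a b => (contDiffAt_const (c := (1 : Matrix J J ℝ) a b)).sub (hM a b)) k a b

theorem smoothEntriesAt_slopeMat {A : E → J → J → ℂ}
    (hA : ∀ a b, ContDiffAt ℝ ∞ (fun y => A y a b) z) :
    SmoothEntriesAt (fun y => slopeMat wt (A y)) z := by
  have h1 : SmoothEntriesAt (fun y => imMat (A y)) z := fun a b =>
    Complex.imCLM.contDiff.contDiffAt.comp z (hA a b)
  have h2 : SmoothEntriesAt (fun y => reMat (A y)) z := fun a b =>
    Complex.reCLM.contDiff.contDiffAt.comp z (hA a b)
  exact h1.mul h2.triInv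

theorem contDiffAt_levelFun_slopeMat {A : E → J → J → ℂ} (K : ℝ) (d : ℕ)
    (hA : ∀ a b, ContDiffAt ℝ ∞ (fun y => A y a b) z) :
    ContDiffAt ℝ ∞ (fun y => levelFun K wt d (slopeMat wt (A y))) z :=
  (contDiff_levelFun K wt d).contDiffAt.comp z (f := fun y => fun a b => slopeMat wt (A y) a b)
    (contDiffAt_pi.2 fun a => contDiffAt_pi.2 fun b => smoothEntriesAt_slopeMat hA a b)

end Smooth

section Laplacian

open Filter Topology

variable {E : Type*} [NormedAddCommGroup E] [NormedSpace ℂ E] {z : E}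

/-- The function `f` is smooth with complex linear derivative near `z`. -/
def IsHoloAt {F : Type*} [NormedAddCommGroup F] [NormedSpace ℂ F] (f : E → F) (z : E) : Prop :=
  ContDiffAt ℝ ∞ f z ∧ ∀ᶠ y in 𝓝 z, ∀ v, fderiv ℝ f y (Complex.I • v) = Complex.I • fderiv ℝ f y v

/-- The Laplacian along the complex line spanned by `v`. -/
def lineLaplacian (f : E → ℝ) (z v : E) : ℝ :=
  fderiv ℝ (fderiv ℝ f) z v v + fderiv ℝ (fderiv ℝ f) z (Complex.I • v) (Complex.I • v)

theorem IsHoloAt.fderiv_fderiv_smul {f : E → ℂ} (hf : IsHoloAt f z) (X v : E) :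
    fderiv ℝ (fderiv ℝ f) z X (Complex.I • v) = Complex.I • fderiv ℝ (fderiv ℝ f) z X v := by
  have hd := ((hf.1.fderiv_right (m := ∞) (by simp)).differentiableAt (by simp)).hasFDerivAt
  have h1 := hd.clm_apply (hasFDerivAt_const (Complex.I • v) z)
  have h2 := (hd.clm_apply (hasFDerivAt_const v z)).const_smul Complex.I
  have := DFunLike.congr_fun (h1.unique (h2.congr_of_eventuallyEq
    (hf.2.mono fun y hy => hy v))) X
  simpa using this

/-- By symmetry the second derivative is complex linear in both slots, and `i² = -1`. Hence real and
imaginary parts of holomorphic functions are pluriharmonic. -/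
theorem IsHoloAt.fderiv_fderiv {f : E → ℂ} (hf : IsHoloAt f z) (v : E) :
    fderiv ℝ (fderiv ℝ f) z (Complex.I • v) (Complex.I • v) = - fderiv ℝ (fderiv ℝ f) z v v := by
  have hs : IsSymmSndFDerivAt ℝ f z := hf.1.isSymmSndFDerivAt (by simp; exact ENat.LEInfty.out)
  rw [hf.fderiv_fderiv_smul, hs.eq, hf.fderiv_fderiv_smul, smul_smul, Complex.I_mul_I, neg_one_smul]

theorem fderiv_continuousLinearMap_comp {F H : Type*} [NormedAddCommGroup F] [NormedSpace ℝ F]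
    [NormedAddCommGroup H] [NormedSpace ℝ H] (L : F →L[ℝ] H) {f : E → F} (hf : ContDiffAt ℝ ∞ f z) :
    fderiv ℝ (fun y => L (f y)) z = L.comp (fderiv ℝ f z) :=
  (L.hasFDerivAt.comp z (hf.differentiableAt (by simp)).hasFDerivAt).fderiv

theorem fderiv_fderiv_continuousLinearMap_comp {F H : Type*} [NormedAddCommGroup F] [NormedSpace ℝ F]
    [NormedAddCommGroup H] [NormedSpace ℝ H] (L : F →L[ℝ] H) {f : E → F} (hf : ContDiffAt ℝ ∞ f z)
    (v w : E) : fderiv ℝ (fderiv ℝ (fun y => L (f y))) z v w = L (fderiv ℝ (fderiv ℝ f) z v w) := by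
  have h1 : fderiv ℝ (fun y => L (f y)) =ᶠ[𝓝 z] fun y => L.comp (fderiv ℝ f y) := by
    have h2 : ∀ᶠ y in 𝓝 z, DifferentiableAt ℝ f y :=
      ((hf.of_le (m := 1) (by simp)).eventually (by simp)).mono fun y hy =>
        hy.differentiableAt (by simp)
    filter_upwards [h2] with y hy using (L.hasFDerivAt.comp y hy.hasFDerivAt).fderiv
  have hd := ((hf.fderiv_right (m := ∞) (by simp)).differentiableAt (by simp)).hasFDerivAt
  rw [h1.fderiv_eq, ((hasFDerivAt_const L z).clm_comp hd).fderiv]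
  simp

theorem IsHoloAt.re_jets {f : E → ℂ} (hf : IsHoloAt f z) (v : E) :
    ∃ p q p₂ q₂ : ℝ, fderiv ℝ f z v = p + q * Complex.I ∧
      IsTwoJet (fun t : ℝ => (f (z + t • v)).re) (f z).re p p₂ ∧
      IsTwoJet (fun t : ℝ => (f (z + t • v)).im) (f z).im q q₂ ∧
      IsTwoJet (fun t : ℝ => (f (z + t • (Complex.I • v))).re) (f z).re (-q) (-p₂) ∧
      IsTwoJet (fun t : ℝ => (f (z + t • (Complex.I • v))).im) (f z).im p (-q₂) := by
  have hre : ContDiffAt ℝ ∞ (fun y => (f y).re) z := Complex.reCLM.contDiff.contDiffAt.comp z hf.1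
  have him : ContDiffAt ℝ ∞ (fun y => (f y).im) z := Complex.imCLM.contDiff.contDiffAt.comp z hf.1
  have r1 : ∀ v, fderiv ℝ (fun y => (f y).re) z v = (fderiv ℝ f z v).re := fun v =>
    DFunLike.congr_fun (fderiv_continuousLinearMap_comp Complex.reCLM hf.1) v
  have i1 : ∀ v, fderiv ℝ (fun y => (f y).im) z v = (fderiv ℝ f z v).im := fun v =>
    DFunLike.congr_fun (fderiv_continuousLinearMap_comp Complex.imCLM hf.1) v
  have r2 : ∀ v, fderiv ℝ (fderiv ℝ (fun y => (f y).re)) z v v =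
    (fderiv ℝ (fderiv ℝ f) z v v).re := fun v => fderiv_fderiv_continuousLinearMap_comp Complex.reCLM hf.1 v v
  have i2 : ∀ v, fderiv ℝ (fderiv ℝ (fun y => (f y).im)) z v v =
    (fderiv ℝ (fderiv ℝ f) z v v).im := fun v => fderiv_fderiv_continuousLinearMap_comp Complex.imCLM hf.1 v v
  have hI := hf.2.self_of_nhds v
  refine ⟨(fderiv ℝ f z v).re, (fderiv ℝ f z v).im, (fderiv ℝ (fderiv ℝ f) z v v).re,
    (fderiv ℝ (fderiv ℝ f) z v v).im, (Complex.re_add_im _).symm, ?_, ?_, ?_, ?_⟩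
  · have := isTwoJet_of_contDiffAt hre v
    rwa [r1, r2] at this
  · have := isTwoJet_of_contDiffAt him v
    rwa [i1, i2] at this
  · have := isTwoJet_of_contDiffAt hre (Complex.I • v)
    rw [r1, r2, hI, hf.fderiv_fderiv] at this
    simpa using this
  · have := isTwoJet_of_contDiffAt him (Complex.I • v)
    rw [i1, i2, hI, hf.fderiv_fderiv] at this
    simpa using this

/-- The exhaustion function of the slope of a holomorphic unitriangular matrix is plurisubharmonic,
strictly so along directions in which the matrix varies. -/
theorem lineLaplacian_levelFun_slopeMat {A : E → J → J → ℂ}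
    (hA : ∀ a b, IsHoloAt (fun y => A y a b) z) (htri : ∀ y, IsUnitriangular wt (A y)) {K : ℝ}
    (hK : K = 20 * (Fintype.card J) ^ 4 + 5) (v : E) :
    0 ≤ lineLaplacian (fun y => levelFun K wt (Finset.univ.sup wt) (slopeMat wt (A y))) z v ∧
    (lineLaplacian (fun y => levelFun K wt (Finset.univ.sup wt) (slopeMat wt (A y))) z v = 0 →
      ∀ a b, fderiv ℝ (fun y => A y a b) z v = 0) := by
  have hAs : ∀ a b, ContDiffAt ℝ ∞ (fun y => A y a b) z := fun a b => (hA a b).1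
  choose p q p₂ q₂ hpq hP hQ hP' hQ' using fun a b => (hA a b).re_jets v
  let u : Matrix J J ℝ := slopeMat wt (A z)
  let P : Matrix J J ℝ := reMat (A z)
  let M : Matrix J J ℝ := triInv wt P
  have hPM : P * M = 1 := mul_triInv (htri z).reMat
  have hMP : M * P = 1 := triInv_mul (htri z).reMat
  have hU := fun a b => isTwoJet_of_contDiffAt (smoothEntriesAt_slopeMat (wt := wt) hAs a b) v
  have hU' := fun a b => isTwoJet_of_contDiffAt (smoothEntriesAt_slopeMat (wt := wt) hAs a b)
    (Complex.I • v)
  let u₁ : Matrix J J ℝ := Matrix.of fun a b => fderiv ℝ (fun y => slopeMat wt (A y) a b) z v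
  let u₂ : Matrix J J ℝ := Matrix.of fun a b =>
    fderiv ℝ (fderiv ℝ (fun y => slopeMat wt (A y) a b)) z v v
  let u₁' : Matrix J J ℝ := Matrix.of fun a b =>
    fderiv ℝ (fun y => slopeMat wt (A y) a b) z (Complex.I • v)
  let u₂' : Matrix J J ℝ := Matrix.of fun a b =>
    fderiv ℝ (fderiv ℝ (fun y => slopeMat wt (A y) a b)) z (Complex.I • v) (Complex.I • v)
  -- The jets of the slope are found by comparing jets in `slope * Re A = Im A` along `v` and `i v`,
  -- where those of `Re A` and `Im A` obey the Cauchy–Riemann equations.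
  have hprod : ∀ a b w, (fun t : ℝ => ∑ c, slopeMat wt (A (z + t • w)) a c * (A (z + t • w) c b).re) =
      fun t : ℝ => (A (z + t • w) a b).im := by
    intro a b w
    funext t
    exact congrFun (congrFun (slopeMat_mul_reMat (htri (z + t • w))) a) b
  have j1 : ∀ a b, (u₁ * P + u * Matrix.of p) a b = q a b ∧
      (u₂ * P + (2 : ℝ) • (u₁ * Matrix.of p) + u * Matrix.of p₂) a b = q₂ a b := by
    intro a b
    have h := (IsTwoJet.sum Finset.univ fun c => (hU a c).mul (hP c b))
    rw [hprod a b v] at h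
    obtain ⟨-, h1, h2⟩ := h.unique (hQ a b)
    refine ⟨h1 ▸ ?_, h2 ▸ ?_⟩
    · simp only [Matrix.add_apply, Matrix.mul_apply, ← Finset.sum_add_distrib]; rfl
    · simp only [Matrix.add_apply, Matrix.mul_apply, Matrix.smul_apply, smul_eq_mul, Finset.mul_sum,
        ← Finset.sum_add_distrib]; rfl
  have j2 : ∀ a b, (u₁' * P - u * Matrix.of q) a b = p a b ∧
      (u₂' * P - (2 : ℝ) • (u₁' * Matrix.of q) - u * Matrix.of p₂) a b = - q₂ a b := by
    intro a b
    have h := (IsTwoJet.sum Finset.univ fun c => (hU' a c).mul (hP' c b))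
    rw [hprod a b (Complex.I • v)] at h
    obtain ⟨-, h1, h2⟩ := h.unique (hQ' a b)
    refine ⟨h1 ▸ ?_, h2 ▸ ?_⟩
    · simp only [Matrix.sub_apply, Matrix.mul_apply, ← Finset.sum_sub_distrib]
      exact Finset.sum_congr rfl fun c _ => by
        simp only [u₁', u, P, reMat, Matrix.of_apply]; ring
    · simp only [Matrix.sub_apply, Matrix.mul_apply, Matrix.smul_apply, smul_eq_mul, Finset.mul_sum,
        ← Finset.sum_sub_distrib]
      exact Finset.sum_congr rfl fun c _ => by
        simp only [u₁', u₂', u, P, reMat, Matrix.of_apply]; ring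
  let pm : Matrix J J ℝ := Matrix.of p
  let qm : Matrix J J ℝ := Matrix.of q
  have k1 : u₁ * P + u * pm = qm := by ext a b; exact (j1 a b).1
  have k1' : u₁' * P - u * qm = pm := by ext a b; exact (j2 a b).1
  have k2 : (u₂ + u₂') * P + (2 : ℝ) • (u₁ * pm - u₁' * qm) = 0 := by
    ext a b
    have h1 := (j1 a b).2
    have h2 := (j2 a b).2
    simp only [Matrix.add_apply, Matrix.sub_apply, Matrix.smul_apply, Matrix.zero_apply, add_mul,
      smul_eq_mul] at h1 h2 ⊢
    change _ + _ + 2 * ((u₁ * Matrix.of p) a b - (u₁' * Matrix.of q) a b) = 0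
    linarith
  -- Multiplying the derivatives by `(Re A)⁻¹` on the right eliminates `A`: only the slope `u` and
  -- the matrices `r`, `s` remain in the first derivatives and the Laplacian.
  let r : Matrix J J ℝ := pm * M
  let s : Matrix J J ℝ := qm * M
  have l1 : u₁ = s - u * r := by
    have : u₁ * P * M + u * pm * M = qm * M := by rw [← add_mul, k1]
    rw [mul_assoc, hPM, mul_one, mul_assoc] at this
    exact eq_sub_of_add_eq this
  have l1' : u₁' = r + u * s := by
    have : u₁' * P * M - u * qm * M = pm * M := by rw [← sub_mul, k1']
    rw [mul_assoc, hPM, mul_one, mul_assoc] at this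
    exact eq_add_of_sub_eq this
  have l2 : u₂ + u₂' = (2 : ℝ) • (r * s - s * r + u * (r * r + s * s)) := by
    have h1 : (u₂ + u₂') * P * M + (2 : ℝ) • (u₁ * (pm * M) - u₁' * (qm * M)) = 0 := by
      have := congrArg (· * M) k2
      simpa only [add_mul, Matrix.smul_mul, sub_mul, zero_mul, mul_assoc] using this
    rw [mul_assoc, hPM, mul_one] at h1
    rw [eq_neg_of_add_eq_zero_left h1, ← smul_neg, neg_sub]
    congr 1
    change u₁' * s - u₁ * r = _
    rw [l1, l1']
    noncomm_ring
  have tp : ∀ a b, ¬ wt b < wt a → p a b = 0 ∧ q a b = 0 := by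
    intro a b h
    have h1 : fderiv ℝ (fun y => A y a b) z v = 0 := by
      rw [show (fun y => A y a b) = fun _ => if a = b then (1 : ℂ) else 0 from
        funext fun y => htri y a b h]
      simp
    have h2 := hpq a b
    rw [h1] at h2
    have h3 := congrArg Complex.re h2
    have h4 := congrArg Complex.im h2
    simp at h3 h4
    exact ⟨h3.symm, h4.symm⟩
  have tri_p : IsTriangular wt 1 pm := fun a b h => by
    by_contra h'; exact h (tp a b (by omega)).1
  have tri_q : IsTriangular wt 1 qm := fun a b h => by
    by_contra h'; exact h (tp a b (by omega)).2
  have tri_r : IsTriangular wt 1 r := tri_p.mul (isTriangular_triInv (htri z).reMat)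
  have tri_s : IsTriangular wt 1 s := tri_q.mul (isTriangular_triInv (htri z).reMat)
  obtain ⟨f₁, f₂, f₁', f₂', hf, hf', hge⟩ := levelFun_laplacian_ge (wt := wt)
    (U := fun a b t => slopeMat wt (A (z + t • v)) a b)
    (U' := fun a b t => slopeMat wt (A (z + t • (Complex.I • v))) a b)
    (u := u) (u₁ := u₁) (u₂ := u₂) (u₁' := u₁') (u₂' := u₂') (r := r) (s := s) hU hU'
    (fun a b h => isTriangular_slopeMat (htri z) a b h) (fun a b h => tri_r a b h)
    (fun a b h => tri_s a b h)
    (fun a b => by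
      conv_lhs => rw [l1]
      rw [Matrix.sub_apply, Matrix.mul_apply])
    (fun a b => by
      conv_lhs => rw [l1']
      rw [Matrix.add_apply, Matrix.mul_apply])
    (fun a b => by
      rw [← Matrix.add_apply, l2]
      simp only [Matrix.smul_apply, smul_eq_mul, Matrix.add_apply, Matrix.sub_apply,
        Matrix.mul_apply, Finset.mul_sum, ← Finset.sum_add_distrib]) hK (Finset.univ.sup wt)
  have hfs := contDiffAt_levelFun_slopeMat (wt := wt) K (Finset.univ.sup wt) hAs
  obtain ⟨-, -, e1⟩ := hf.unique (isTwoJet_of_contDiffAt hfs v)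
  obtain ⟨-, -, e2⟩ := hf'.unique (isTwoJet_of_contDiffAt hfs (Complex.I • v))
  have hL : lineLaplacian (fun y => levelFun K wt (Finset.univ.sup wt) (slopeMat wt (A y))) z v =
      f₂ + f₂' := by rw [lineLaplacian, e1, e2]
  rw [hL]
  have hnn := levelNorm_nonneg wt r s (Finset.univ.sup wt)
  have hpos := Real.exp_pos (-3 * levelFun K wt (Finset.univ.sup wt) u)
  refine ⟨le_trans (by positivity) hge, fun h0 a b => ?_⟩
  rw [h0] at hge
  -- The largest weight bounds every level, so this norm sees all entries of `r` and `s`; its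
  -- vanishing recovers `p = q = 0`.
  have hz : levelNorm wt r s (Finset.univ.sup wt) = 0 := by
    refine le_antisymm ?_ hnn
    by_contra hlt
    push Not at hlt
    have : 0 < 1 / 2 * Real.exp (-3 * levelFun K wt (Finset.univ.sup wt) u) *
      levelNorm wt r s (Finset.univ.sup wt) := by positivity
    linarith
  have hrs : ∀ a b, r a b = 0 ∧ s a b = 0 := by
    intro a b
    have hle : wt a ≤ wt b + Finset.univ.sup wt :=
      (Finset.le_sup (f := wt) (Finset.mem_univ a)).trans (Nat.le_add_left _ _)
    have := le_levelNorm wt r s hle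
    rw [hz] at this
    exact ⟨by nlinarith [sq_nonneg (r a b), sq_nonneg (s a b)],
      by nlinarith [sq_nonneg (r a b), sq_nonneg (s a b)]⟩
  have hr0 : r = 0 := by ext a b; exact (hrs a b).1
  have hs0 : s = 0 := by ext a b; exact (hrs a b).2
  have hp0 : pm = 0 := by
    have : r * P = pm := by rw [mul_assoc, hMP, mul_one]
    rw [← this, hr0, zero_mul]
  have hq0 : qm = 0 := by
    have : s * P = qm := by rw [mul_assoc, hMP, mul_one]
    rw [← this, hs0, zero_mul]
  have hp1 : p a b = 0 := congrFun (congrFun hp0 a) b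
  have hq1 : q a b = 0 := congrFun (congrFun hq0 a) b
  rw [hpq, hp1, hq1]
  simp

end Laplacian

end Slope

/-! ### Kähler forms from local potentials -/

section Potential

open Filter Topology ContinuousAlternatingMap

variable {E : Type*} [NormedAddCommGroup E] [NormedSpace ℂ E]

theorem IsHoloAt.of_contDiffAt {F : Type*} [NormedAddCommGroup F] [NormedSpace ℂ F] {f : E → F}
    {z : E} (hf : ContDiffAt ℂ ω f z) : IsHoloAt f z :=
  ⟨(hf.restrict_scalars ℝ).of_le (by simp), (hf.eventually (by simp)).mono fun y hy v =>
    fderiv_real_smul (hy.differentiableAt (by simp)) Complex.I v⟩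

variable (E) in
/-- Multiplication by `i`, as a real linear map. -/
def mulI : E →L[ℝ] E := (Complex.I • ContinuousLinearMap.id ℂ E).restrictScalars ℝ

/-- The form `-dᶜ f` of a function. -/
def potentialForm (f : E → ℝ) (y : E) : E [⋀^Fin 1]→L[ℝ] ℝ :=
  -ofSubsingletonLIE (𝕜 := ℝ) (E := E) (F := ℝ) (0 : Fin 1) ((fderiv ℝ f y).comp (mulI E))

theorem potentialForm_apply (f : E → ℝ) (y : E) (v : Fin 1 → E) :
    potentialForm f y v = -fderiv ℝ f y (Complex.I • v 0) := rfl

theorem contDiffAt_potentialForm {f : E → ℝ} {y : E} (hf : ContDiffAt ℝ ∞ f y) :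
    ContDiffAt ℝ ∞ (potentialForm f) y :=
  ((ofSubsingletonLIE (𝕜 := ℝ) (E := E) (F := ℝ) (0 : Fin 1)).toContinuousLinearEquiv.contDiff.contDiffAt.comp y
    ((hf.fderiv_right (m := ∞) (by simp)).clm_comp contDiffAt_const)).neg

/-- The form `-d dᶜ f` of a function. -/
def kahlerPotentialForm (f : E → ℝ) (y : E) : E [⋀^Fin 2]→L[ℝ] ℝ := extDeriv (potentialForm f) y

theorem contDiffAt_kahlerPotentialForm {f : E → ℝ} {y : E} (hf : ContDiffAt ℝ ∞ f y) :
    ContDiffAt ℝ ∞ (kahlerPotentialForm f) y :=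
  ContDiffAt.comp (g := alternatizeUncurryFinCLM ℝ E ℝ (n := 1)) y
    (ContinuousLinearMap.contDiff _).contDiffAt ((contDiffAt_potentialForm hf).fderiv_right (m := ∞) (by simp))

theorem extDeriv_kahlerPotentialForm {f : E → ℝ} {y : E} (hf : ContDiffAt ℝ ∞ f y) :
    extDeriv (kahlerPotentialForm f) y = 0 :=
  extDeriv_extDeriv_apply (contDiffAt_potentialForm hf)
    (by simp; exact ENat.LEInfty.out)

theorem kahlerPotentialForm_apply {f : E → ℝ} {y : E} (hf : ContDiffAt ℝ ∞ f y) (v w : E) :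
    kahlerPotentialForm f y ![v, w] =
      fderiv ℝ (fderiv ℝ f) y w (Complex.I • v) - fderiv ℝ (fderiv ℝ f) y v (Complex.I • w) := by
  have hd := ((hf.fderiv_right (m := ∞) (by simp)).differentiableAt (by simp)).hasFDerivAt
  have h1 : ∀ u : E, fderiv ℝ (fun y => -fderiv ℝ f y (Complex.I • u)) y =
      -(fderiv ℝ (fderiv ℝ f) y).flip (Complex.I • u) := by
    intro u
    rw [((hd.clm_apply (hasFDerivAt_const (Complex.I • u) y)).fun_neg).fderiv]
    ext X
    simp
  rw [kahlerPotentialForm, extDeriv_apply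
    ((contDiffAt_potentialForm hf).differentiableAt (by simp))]
  simp only [potentialForm_apply]
  refine (Fin.sum_univ_two _).trans ?_
  have e1 : (fun x => -fderiv ℝ f x (Complex.I • Fin.removeNth (0 : Fin 2) ![v, w] 0)) =
    fun x => -fderiv ℝ f x (Complex.I • w) := rfl
  have e2 : (fun x => -fderiv ℝ f x (Complex.I • Fin.removeNth (1 : Fin 2) ![v, w] 0)) =
    fun x => -fderiv ℝ f x (Complex.I • v) := rfl
  rw [e1, e2, h1, h1]
  simp
  ring

theorem kahlerPotentialForm_congr {f g : E → ℝ} {y : E} (h : f =ᶠ[𝓝 y] g) :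
    kahlerPotentialForm f y = kahlerPotentialForm g y := by
  refine Filter.EventuallyEq.extDeriv_eq ?_
  filter_upwards [h.fderiv (𝕜 := ℝ)] with u hu
  simp [potentialForm, hu]

/-- Pluriharmonicity; this is why potentials only need to match up to real parts of holomorphic
functions. -/
theorem kahlerPotentialForm_re {h : E → ℂ} {y : E} (hh : IsHoloAt h y) :
    kahlerPotentialForm (fun u => (h u).re) y = 0 := by
  have hre : ContDiffAt ℝ ∞ (fun y => (h y).re) y := Complex.reCLM.contDiff.contDiffAt.comp y hh.1
  have hs : IsSymmSndFDerivAt ℝ h y := hh.1.isSymmSndFDerivAt (by simp; exact ENat.LEInfty.out)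
  ext v
  have e : v = ![v 0, v 1] := by ext i; fin_cases i <;> rfl
  have r2 : ∀ v w, fderiv ℝ (fderiv ℝ (fun y => (h y).re)) y v w =
    (fderiv ℝ (fderiv ℝ h) y v w).re := fun v w =>
      fderiv_fderiv_continuousLinearMap_comp Complex.reCLM hh.1 v w
  rw [e, kahlerPotentialForm_apply hre, r2, r2, hh.fderiv_fderiv_smul, hh.fderiv_fderiv_smul,
    hs.eq, sub_self]
  rfl

/-- Holomorphic maps commute with `dᶜ` and pullback commutes with `d`, while the pluriharmonic term
contributes nothing. -/
theorem kahlerPotentialForm_comp_add_re {f : E → ℝ} {T : E → E} {h : E → ℂ} {y : E}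
    (hf : ContDiffAt ℝ ∞ f (T y)) (hT : IsHoloAt T y) (hh : IsHoloAt h y) :
    kahlerPotentialForm (fun u => f (T u) + (h u).re) y =
      (kahlerPotentialForm f (T y)).compContinuousLinearMap (fderiv ℝ T y) := by
  have hre : ContDiffAt ℝ ∞ (fun y => (h y).re) y := Complex.reCLM.contDiff.contDiffAt.comp y hh.1
  have hfT : ContDiffAt ℝ ∞ (fun y => f (T y)) y := hf.comp y hT.1
  have hTd : ∀ᶠ u in 𝓝 y, DifferentiableAt ℝ T u :=
    ((hT.1.of_le (m := 1) (by simp)).eventually (by simp)).mono fun y hy =>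
      hy.differentiableAt (by simp)
  have hfd : ∀ᶠ u in 𝓝 y, DifferentiableAt ℝ f (T u) :=
    hT.1.continuousAt.eventually (((hf.of_le (m := 1) (by simp)).eventually (by simp)).mono
      fun y hy => hy.differentiableAt (by simp))
  have hrd : ∀ᶠ u in 𝓝 y, DifferentiableAt ℝ (fun u => (h u).re) u :=
    ((hre.of_le (m := 1) (by simp)).eventually (by simp)).mono fun y hy =>
      hy.differentiableAt (by simp)
  have e1 : potentialForm (fun u => f (T u) + (h u).re) =ᶠ[𝓝 y] fun u =>
      (potentialForm f (T u)).compContinuousLinearMap (fderiv ℝ T u) +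
        potentialForm (fun u => (h u).re) u := by
    filter_upwards [hTd, hfd, hrd, hT.2] with u h1 h2 h3 h4
    have h5 : fderiv ℝ (fun u => f (T u)) u = (fderiv ℝ f (T u)).comp (fderiv ℝ T u) :=
      (h2.hasFDerivAt.comp u h1.hasFDerivAt).fderiv
    have h6 : fderiv ℝ (fun u => f (T u) + (h u).re) u =
        (fderiv ℝ f (T u)).comp (fderiv ℝ T u) + fderiv ℝ (fun u => (h u).re) u := by
      rw [← h5]
      exact fderiv_fun_add (h2.comp u h1) h3
    ext v
    rw [potentialForm_apply, h6, ContinuousAlternatingMap.add_apply, potentialForm_apply,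
      ContinuousAlternatingMap.compContinuousLinearMap_apply, potentialForm_apply]
    simp [h4]
    ring
  have d1 : DifferentiableAt ℝ (fun u =>
      (potentialForm f (T u)).compContinuousLinearMap (fderiv ℝ T u)) y :=
    ((((contDiffAt_potentialForm hf).differentiableAt (by simp)).comp y
      (hT.1.differentiableAt (by simp))).hasFDerivAt.continuousAlternatingMapCompContinuousLinearMap
      ((hT.1.fderiv_right (m := ∞) (by simp)).differentiableAt (by simp)).hasFDerivAt).differentiableAt
  rw [kahlerPotentialForm, e1.extDeriv_eq, extDeriv_fun_add d1
    ((contDiffAt_potentialForm hre).differentiableAt (by simp)),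
    extDeriv_pullback ((contDiffAt_potentialForm hf).differentiableAt (by simp)) hT.1
      (by simp; exact ENat.LEInfty.out)]
  rw [show extDeriv (potentialForm fun u => (h u).re) y = 0 from kahlerPotentialForm_re hh, add_zero]
  rfl

theorem kahlerPotentialForm_invariant {f : E → ℝ} {y : E} (hf : ContDiffAt ℝ ∞ f y) (v w : E) :
    kahlerPotentialForm f y ![Complex.I • v, Complex.I • w] = kahlerPotentialForm f y ![v, w] := by
  have hs : IsSymmSndFDerivAt ℝ f y := hf.isSymmSndFDerivAt (by simp; exact ENat.LEInfty.out)
  rw [kahlerPotentialForm_apply hf, kahlerPotentialForm_apply hf, smul_smul, smul_smul,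
    Complex.I_mul_I, neg_one_smul, neg_one_smul, map_neg, map_neg, hs.eq w, hs.eq v]
  ring

theorem kahlerPotentialForm_self {f : E → ℝ} {y : E} (hf : ContDiffAt ℝ ∞ f y) (v : E) :
    kahlerPotentialForm f y ![v, Complex.I • v] = lineLaplacian f y v := by
  rw [kahlerPotentialForm_apply hf, smul_smul, Complex.I_mul_I, neg_one_smul, map_neg,
    lineLaplacian]
  ring

variable {M : Type*} [TopologicalSpace M] [ChartedSpace E M]

section Form

variable [IsManifold 𝓘(ℂ, E) ω M]

theorem contDiffAt_transition (a b : M) {y : E} (hy : y ∈ (chartAt E a).target)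
    (hb : (chartAt E a).symm y ∈ (chartAt E b).source) :
    ContDiffAt ℂ ω (fun u => chartAt E b ((chartAt E a).symm u)) y :=
  contMDiffAt_iff_contDiffAt.1 (ContMDiffAt.comp (g := chartAt E b) y
    (contMDiffOn_chart.contMDiffAt ((chartAt E b).open_source.mem_nhds hb))
    (contMDiffOn_chart_symm.contMDiffAt ((chartAt E a).open_target.mem_nhds hy)))

/-- Tangent vectors at a point are read in the preferred chart there, so differentiating an inverse
chart means differentiating a transition map. -/
theorem mfderiv_chart_symm (a : M) {y : E} (hy : y ∈ (chartAt E a).target) :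
    mfderiv 𝓘(ℝ, E) 𝓘(ℝ, E) ((chartAt E a).symm : E → M) y =
      fderiv ℝ (fun u => chartAt E ((chartAt E a).symm y) ((chartAt E a).symm u)) y := by
  have := isManifold_real (E := E) M
  have h : MDifferentiableAt 𝓘(ℝ, E) 𝓘(ℝ, E) ((chartAt E a).symm : E → M) y :=
    ((contMDiffOn_chart_symm (n := ∞)).contMDiffAt
      ((chartAt E a).open_target.mem_nhds hy)).mdifferentiableAt (by simp)
  rw [h.mfderiv]
  simp only [mfld_simps, fderivWithin_univ]
  rfl

theorem formInChart_chartAt (η : ∀ x : M, TangentSpace 𝓘(ℝ, E) x [⋀^Fin 2]→L[ℝ] ℝ) (a : M) {y : E}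
    (hy : y ∈ (chartAt E a).target) : formInChart η (chartAt E a) y =
      ContinuousAlternatingMap.compContinuousLinearMap (M := E) (M' := E)
        (show E [⋀^Fin 2]→L[ℝ] ℝ from η ((chartAt E a).symm y))
        (fderiv ℝ (fun u => chartAt E ((chartAt E a).symm y) ((chartAt E a).symm u)) y) := by
  rw [formInChart]
  congr 1
  exact mfderiv_chart_symm a hy

/-- Local potentials which differ by real parts of holomorphic functions define a Kähler form. -/
theorem isKahlerOpen_of_potential (hatlas : ∀ e ∈ atlas E M, ∃ a, e = chartAt E a)
    (pot : M → E → ℝ)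
    (hsmooth : ∀ a, ∀ y ∈ (chartAt E a).target, ContDiffAt ℝ ∞ (pot a) y)
    (hcompat : ∀ a b, ∀ y ∈ (chartAt E a).target, (chartAt E a).symm y ∈ (chartAt E b).source →
      ∃ h : E → ℂ, IsHoloAt h y ∧ ∀ᶠ u in 𝓝 y,
        pot a u = pot b (chartAt E b ((chartAt E a).symm u)) + (h u).re)
    (hpos : ∀ a, ∀ y ∈ (chartAt E a).target, ∀ v ≠ 0, 0 < lineLaplacian (pot a) y v) :
    IsKahlerOpen (E := E) (Set.univ : Set M) := by
  -- Each point uses the potential of its own preferred chart; `hη` shows that every other chart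
  -- gives the same form.
  let η : ∀ x : M, TangentSpace 𝓘(ℝ, E) x [⋀^Fin 2]→L[ℝ] ℝ := fun x =>
    (kahlerPotentialForm (pot x) (chartAt E x x) : E [⋀^Fin 2]→L[ℝ] ℝ)
  have hη : ∀ a, ∀ y ∈ (chartAt E a).target,
      formInChart η (chartAt E a) y = kahlerPotentialForm (pot a) y := by
    intro a y hy
    rw [formInChart_chartAt η a hy]
    set x := (chartAt E a).symm y with hx
    obtain ⟨h, hh, hev⟩ := hcompat a x y hy (mem_chart_source E x)
    rw [kahlerPotentialForm_congr hev]
    exact (kahlerPotentialForm_comp_add_re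
      (T := fun u => chartAt E x ((chartAt E a).symm u))
      (hsmooth x _ (by rw [← hx]; exact mem_chart_target E x))
      (IsHoloAt.of_contDiffAt (contDiffAt_transition a x hy (mem_chart_source E x))) hh).symm
  have hxs : ∀ x : M, ContDiffAt ℝ ∞ (pot x) (chartAt E x x) := fun x =>
    hsmooth x _ (mem_chart_target E x)
  refine ⟨η, ⟨?_, ?_, ?_, ?_⟩⟩
  · rintro e he y ⟨hy, -⟩
    obtain ⟨a, rfl⟩ := hatlas e he
    refine ((contDiffAt_kahlerPotentialForm (hsmooth a y hy)).congr_of_eventuallyEq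
      ?_).contDiffWithinAt
    filter_upwards [(chartAt E a).open_target.mem_nhds hy] with u hu using hη a u hu
  · rintro e he y ⟨hy, -⟩
    obtain ⟨a, rfl⟩ := hatlas e he
    rw [Filter.EventuallyEq.extDeriv_eq (ω₂ := kahlerPotentialForm (pot a))]
    · exact extDeriv_kahlerPotentialForm (hsmooth a y hy)
    · filter_upwards [(chartAt E a).open_target.mem_nhds hy] with u hu using hη a u hu
  · intro x _ v w
    exact kahlerPotentialForm_invariant (hxs x) v w
  · intro x _ v hv
    have := kahlerPotentialForm_self (hxs x) v
    exact lt_of_lt_of_eq (hpos x _ (mem_chart_target E x) v hv) this.symm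

end Form

end Potential

/-! ### Charts of the quotient and descent of potentials -/

section QuotientCharts

open Filter Topology

variable {E : Type*} [NormedAddCommGroup E] [NormedSpace ℂ E]
  {G : Type*} [TopologicalSpace G] [ChartedSpace E G] [Group G] [LieGroup 𝓘(ℂ, E) ω G]
  {Γ : Subgroup G} (hΓ : IsDiscrete (Γ : Set G))

/-- The point of `G` around which the preferred chart of `G ⧸ Γ` at `q` is defined. -/
def quotientLift (q : G ⧸ Γ) : G :=
  (QuotientGroup.mk_surjective (s := Γ)).hasRightInverse.choose q

theorem quotient_chartAt (q : G ⧸ Γ) :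
    letI : ChartedSpace E (G ⧸ Γ) := quotientChartedSpace hΓ
    chartAt E q = ((isLocalHomeomorph_quotientMk E hΓ).localInverseAt (quotientLift q)).trans
      (chartAt E (quotientLift q)) := rfl

theorem quotient_chartAt_symm (q : G ⧸ Γ) (y : E) :
    letI : ChartedSpace E (G ⧸ Γ) := quotientChartedSpace hΓ
    (chartAt E q).symm y = QuotientGroup.mk ((chartAt E (quotientLift q)).symm y) :=
  congrFun ((isLocalHomeomorph_quotientMk E hΓ).localInverseAt_symm (x := quotientLift q)) _

theorem mem_target_of_mem_quotient_target {q : G ⧸ Γ} {y : E}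
    (hy : letI : ChartedSpace E (G ⧸ Γ) := quotientChartedSpace hΓ
      y ∈ (chartAt E q).target) : y ∈ (chartAt E (quotientLift q)).target := by
  rw [quotient_chartAt, OpenPartialHomeomorph.trans_target] at hy
  exact hy.1

/-- Near a point, the composition of a chart of `G ⧸ Γ` with the projection is the composition of a
chart of `G` with a right translation by an element of `Γ`. -/
theorem exists_eventually_quotient_chartAt_mk {q : G ⧸ Γ} {g : G}
    (hg : letI : ChartedSpace E (G ⧸ Γ) := quotientChartedSpace hΓ
      (QuotientGroup.mk g : G ⧸ Γ) ∈ (chartAt E q).source) :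
    letI : ChartedSpace E (G ⧸ Γ) := quotientChartedSpace hΓ
    ∃ γ ∈ Γ, ∀ᶠ h in 𝓝 g, chartAt E q (QuotientGroup.mk h : G ⧸ Γ) =
      chartAt E (quotientLift q) (h * γ) ∧ h * γ ∈ (chartAt E (quotientLift q)).source := by
  have : IsTopologicalGroup G := topologicalGroup_of_lieGroup 𝓘(ℂ, E) ω
  have hloc := isLocalHomeomorph_quotientMk E hΓ
  rw [quotient_chartAt, OpenPartialHomeomorph.trans_source] at hg
  obtain ⟨hg1, hg2⟩ := hg
  set s := (isLocalHomeomorph_quotientMk E hΓ).localInverseAt (quotientLift q) with hs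
  have hmk : (QuotientGroup.mk (s (QuotientGroup.mk g)) : G ⧸ Γ) = QuotientGroup.mk g :=
    hloc.apply_localInverseAt_of_mem hg1
  have hγ : g⁻¹ * s (QuotientGroup.mk g) ∈ Γ := QuotientGroup.eq.1 hmk.symm
  set γ := g⁻¹ * s (QuotientGroup.mk g) with hγdef
  have hxγ : g * γ = s (QuotientGroup.mk g) := by simp [hγdef]
  have hcont : ContinuousAt (fun x : G => x * γ) g := by fun_prop
  have h1 : ∀ᶠ x in 𝓝 g, x * γ ∈ s.target := by
    apply hcont.eventually_mem
    refine s.open_target.mem_nhds ?_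
    rw [hxγ]
    exact s.map_source hg1
  have h2 : ∀ᶠ x in 𝓝 g, (QuotientGroup.mk x : G ⧸ Γ) ∈ s.source :=
    (hloc.continuous.continuousAt).eventually_mem (s.open_source.mem_nhds hg1)
  have h3 : ∀ᶠ x in 𝓝 g, x * γ ∈ (chartAt E (quotientLift q)).source := by
    apply hcont.eventually_mem
    refine (chartAt E (quotientLift q)).open_source.mem_nhds ?_
    rw [hxγ]
    exact hg2
  refine ⟨γ, hγ, ?_⟩
  filter_upwards [h1, h2, h3] with x hx1 hx2 hx3
  have : s (QuotientGroup.mk x) = x * γ := by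
    apply hloc.injOn_localInverseAt_target (x := quotientLift q) (s.map_source hx2) hx1
    rw [hloc.apply_localInverseAt_of_mem hx2]
    exact QuotientGroup.eq.2 (by simpa using hγ)
  refine ⟨?_, hx3⟩
  rw [quotient_chartAt, OpenPartialHomeomorph.coe_trans, Function.comp_apply, this]

/-- A function on `G`, invariant under `Γ` up to real parts of holomorphic functions and strictly
plurisubharmonic, is the potential of a Kähler form on `G ⧸ Γ`. -/
theorem isKahlerCRS_of_potential {Φ : G → ℝ} (hΦ : ContMDiff 𝓘(ℝ, E) 𝓘(ℝ, ℝ) ∞ Φ)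
    (hinv : ∀ γ ∈ Γ, ∃ H : G → ℂ, (∀ p, ∀ y ∈ (chartAt E p).target,
      IsHoloAt (fun u => H ((chartAt E p).symm u)) y) ∧ ∀ g, Φ g = Φ (g * γ) + (H g).re)
    (hpos : ∀ p : G, ∀ y ∈ (chartAt E p).target, ∀ v ≠ 0,
      0 < lineLaplacian (fun u => Φ ((chartAt E p).symm u)) y v) : IsKahlerCRS E hΓ := by
  let : ChartedSpace E (G ⧸ Γ) := quotientChartedSpace hΓ
  have : IsManifold 𝓘(ℂ, E) ω (G ⧸ Γ) := quotient_isManifold hΓ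
  have := lieGroup_real (E := E) (G := G)
  have := isManifold_real (E := E) G
  refine isKahlerOpen_of_potential (M := G ⧸ Γ) (fun e he => ?_)
    (fun a u => Φ ((chartAt E (quotientLift a)).symm u)) (fun a y hy => ?_) (fun a b y hy hb => ?_)
    (fun a y hy v hv => ?_)
  · obtain ⟨a, ha⟩ := he
    exact ⟨a, ha.symm⟩
  · have hy' := mem_target_of_mem_quotient_target hΓ hy
    exact contDiffAt_comp_of_contMDiff hΦ (contMDiffOn_chart_symm.contMDiffAt
      ((chartAt E (quotientLift a)).open_target.mem_nhds hy'))
  · have hy' := mem_target_of_mem_quotient_target hΓ hy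
    rw [quotient_chartAt_symm] at hb
    obtain ⟨γ, hγ, hev⟩ := exists_eventually_quotient_chartAt_mk hΓ hb
    obtain ⟨H, hH1, hH2⟩ := hinv γ hγ
    refine ⟨_, hH1 _ y hy', ?_⟩
    filter_upwards [((chartAt E (quotientLift a)).continuousAt_symm hy').eventually hev] with u hu
    rw [quotient_chartAt_symm, hu.1, (chartAt E (quotientLift b)).left_inv hu.2]
    exact hH2 _
  · exact hpos _ y (mem_target_of_mem_quotient_target hΓ hy) v hv

end QuotientCharts

/-! ### The global potential -/

section Construction

open Filter Topology

variable {E : Type*} [NormedAddCommGroup E] [NormedSpace ℂ E]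
  {G : Type*} [TopologicalSpace G] [ChartedSpace E G] [Group G] [LieGroup 𝓘(ℂ, E) ω G]

/-- The left invariant coframe in the chart at `p`. -/
def chartCoframe (p : G) (y : E) : E →L[ℝ] E :=
  fderiv ℝ (fun w => chartAt E (1 : G) (((chartAt E p).symm y)⁻¹ * (chartAt E p).symm w)) y

theorem chartCoframe_smul (p : G) {y : E} (hy : y ∈ (chartAt E p).target) (a : ℂ) (v : E) :
    chartCoframe p y (a • v) = a • chartCoframe p y v :=
  fderiv_real_smul (holo_chart_comp (G := G) 1
    (φ := fun w => ((chartAt E p).symm y)⁻¹ * (chartAt E p).symm w)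
    (contMDiffAt_const.mul (contMDiffOn_chart_symm.contMDiffAt
      ((chartAt E p).open_target.mem_nhds hy))) (by simp)) a v

variable [LieGroup 𝓘(ℝ, E) ∞ G]

theorem contMDiffAt_chart_symm (p : G) {y : E} (hy : y ∈ (chartAt E p).target) :
    ContMDiffAt 𝓘(ℝ, E) 𝓘(ℝ, E) ∞ ((chartAt E p).symm : E → G) y :=
  contMDiffOn_chart_symm.contMDiffAt ((chartAt E p).open_target.mem_nhds hy)

theorem fderiv_comp_chart_symm {F : Type*} [NormedAddCommGroup F] [NormedSpace ℝ F] {f : G → F}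
    (hf : ContMDiff 𝓘(ℝ, E) 𝓘(ℝ, F) ∞ f) (p : G) {y : E} (hy : y ∈ (chartAt E p).target) :
    fderiv ℝ (fun u => f ((chartAt E p).symm u)) y =
      (leftDeriv f ((chartAt E p).symm y)).comp (chartCoframe p y) :=
  (fderiv_comp_eq_leftDeriv (differentiableAt_mul_unitParam hf _)
    (contMDiffAt_chart_symm p hy)).fderiv

/-- The chain rule for the chart at `p` itself exhibits a left inverse. -/
theorem chartCoframe_injective (p : G) {y : E} (hy : y ∈ (chartAt E p).target) {v : E}
    (hv : chartCoframe p y v = 0) : v = 0 := by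
  set x := (chartAt E p).symm y with hx
  have hxs : x ∈ (chartAt E p).source := (chartAt E p).map_target hy
  have hd : DifferentiableAt ℝ (fun w => chartAt E p (x * unitParam E G w)) (unitCoord E G) := by
    have h1 : ContMDiffAt 𝓘(ℝ, E) 𝓘(ℝ, E) ∞ (chartAt E p) (x * unitParam E G (unitCoord E G)) := by
      rw [unitParam_unitCoord, mul_one]
      exact contMDiffOn_chart.contMDiffAt ((chartAt E p).open_source.mem_nhds hxs)
    exact (contMDiffAt_iff_contDiffAt.1 (ContMDiffAt.comp (g := chartAt E p) (unitCoord E G) h1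
      (contMDiffAt_mul_unitParam x unitCoord_mem))).differentiableAt (by simp)
  have h := fderiv_comp_eq_leftDeriv (f := fun g : G => chartAt E p g)
    (φ := ((chartAt E p).symm : E → G)) (z := y) hd (contMDiffAt_chart_symm p hy)
  have h' : HasFDerivAt (fun w => chartAt E p ((chartAt E p).symm w)) (.id ℝ E) y := by
    refine (hasFDerivAt_id y).congr_of_eventuallyEq ?_
    filter_upwards [(chartAt E p).open_target.mem_nhds hy] with w hw using (chartAt E p).right_inv hw
  have := DFunLike.congr_fun (h.unique h') v
  rw [ContinuousLinearMap.comp_apply, show fderiv ℝ (fun w => chartAt E (1 : G)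
    (((chartAt E p).symm y)⁻¹ * (chartAt E p).symm w)) y v = 0 from hv, map_zero] at this
  exact this.symm

theorem isHoloAt_comp_chart_symm {f : G → ℂ} (hf : ContMDiff 𝓘(ℝ, E) 𝓘(ℝ, ℂ) ∞ f)
    (hI : ∀ g X, leftDeriv (E := E) f g (Complex.I • X) = Complex.I • leftDeriv f g X) (p : G) {y : E}
    (hy : y ∈ (chartAt E p).target) : IsHoloAt (fun u => f ((chartAt E p).symm u)) y := by
  refine ⟨contDiffAt_comp_of_contMDiff hf (contMDiffAt_chart_symm p hy), ?_⟩
  filter_upwards [(chartAt E p).open_target.mem_nhds hy] with u hu v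
  rw [fderiv_comp_chart_symm hf p hu, ContinuousLinearMap.comp_apply, ContinuousLinearMap.comp_apply,
    chartCoframe_smul p hu, hI]

theorem lineLaplacian_add {f g : E → ℝ} {z : E} (hf : ContDiffAt ℝ ∞ f z) (hg : ContDiffAt ℝ ∞ g z)
    (v : E) : lineLaplacian (fun y => f y + g y) z v = lineLaplacian f z v + lineLaplacian g z v := by
  have key : ∀ w, fderiv ℝ (fderiv ℝ fun y => f y + g y) z w w =
      fderiv ℝ (fderiv ℝ f) z w w + fderiv ℝ (fderiv ℝ g) z w w := fun w =>
    ((isTwoJet_of_contDiffAt (hf.add hg) w).unique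
      ((isTwoJet_of_contDiffAt hf w).add (isTwoJet_of_contDiffAt hg w))).2.2
  rw [lineLaplacian, key, key, lineLaplacian, lineLaplacian]
  ring

theorem lineLaplacian_sum {κ : Type*} (s : Finset κ) {f : κ → E → ℝ} {z : E}
    (hf : ∀ i, ContDiffAt ℝ ∞ (f i) z) (v : E) :
    lineLaplacian (fun y => ∑ i ∈ s, f i y) z v = ∑ i ∈ s, lineLaplacian (f i) z v := by
  have key : ∀ w, fderiv ℝ (fderiv ℝ fun y => ∑ i ∈ s, f i y) z w w =
      ∑ i ∈ s, fderiv ℝ (fderiv ℝ (f i)) z w w := fun w =>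
    ((isTwoJet_of_contDiffAt (ContDiffAt.sum fun i _ => hf i) w).unique
      (IsTwoJet.sum s fun i => isTwoJet_of_contDiffAt (hf i) w)).2.2
  rw [lineLaplacian, key, key, ← Finset.sum_add_distrib]
  rfl

theorem contDiffAt_normSq_comp {f : E → ℂ} {z : E} (hf : ContDiffAt ℝ ∞ f z) :
    ContDiffAt ℝ ∞ (fun y => Complex.normSq (f y)) z := by
  have h1 : ContDiffAt ℝ ∞ (fun y => (f y).re) z := Complex.reCLM.contDiff.contDiffAt.comp z hf
  have h2 : ContDiffAt ℝ ∞ (fun y => (f y).im) z := Complex.imCLM.contDiff.contDiffAt.comp z hf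
  simp only [Complex.normSq_apply]
  exact (h1.mul h1).add (h2.mul h2)

theorem lineLaplacian_normSq {f : E → ℂ} {z : E} (hf : IsHoloAt f z) (v : E) :
    lineLaplacian (fun y => Complex.normSq (f y)) z v = 4 * Complex.normSq (fderiv ℝ f z v) := by
  obtain ⟨p, q, p₂, q₂, hpq, h1, h2, h3, h4⟩ := hf.re_jets v
  have hs := contDiffAt_normSq_comp hf.1
  have e1 := ((isTwoJet_of_contDiffAt hs v).unique ((h1.mul h1).add (h2.mul h2))).2.2
  have e2 := ((isTwoJet_of_contDiffAt hs (Complex.I • v)).unique ((h3.mul h3).add (h4.mul h4))).2.2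
  rw [lineLaplacian, e1, e2, hpq, Complex.normSq_add_mul_I]
  ring

variable [FiniteDimensional ℂ E] [SimplyConnectedSpace G]
  {E₀ : Type*} [NormedAddCommGroup E₀] [NormedSpace ℝ E₀]
  {G₀ : Type*} [TopologicalSpace G₀] [ChartedSpace E₀ G₀] [Group G₀] [LieGroup 𝓘(ℝ, E₀) ∞ G₀]
  [PreconnectedSpace G₀]

/-- A strictly triangular representation, real on the real subgroup, and invariant functionals which
are jointly injective give rise to a Kähler form on the quotient. -/
theorem isKahlerCRS_of_representation {Γ : Subgroup G} (hΓ : IsDiscrete (Γ : Set G)) {ι : G₀ →* G}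
    (hι : ContMDiff 𝓘(ℝ, E₀) 𝓘(ℝ, E) ∞ ι) (hle : Γ ≤ ι.range)
    {J : Type*} [Fintype J] [DecidableEq J] {wt : J → ℕ} {ρ : J → J → E →L[ℝ] ℂ}
    (hρ : ∀ b a, ρ b a ≠ 0 → wt a < wt b)
    (hρI : ∀ b a X, ρ b a (Complex.I • X) = Complex.I • ρ b a X)
    (hbr : ∀ X Y a b, ρ a b (unitBracket E G X Y) =
      ∑ c, (ρ a c X * ρ c b Y - ρ a c Y * ρ c b X))
    (hreal : ∀ b a X, (ρ b a (unitDeriv E E₀ ι X)).im = 0)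
    {N : Type*} [Fintype N] {lam : N → E →L[ℝ] ℂ}
    (hlamI : ∀ l X, lam l (Complex.I • X) = Complex.I • lam l X)
    (hlam : ∀ l X Y, lam l (unitBracket E G X Y) = 0)
    (hinj : ∀ X, (∀ a b, ρ a b X = 0) → (∀ l, lam l X = 0) → X = 0) : IsKahlerCRS E hΓ := by
  obtain ⟨A, hA, htri, hA1, hA'⟩ := exists_integral_representation (G := G) hρ hbr
  choose w hw hw' hwmul using fun l => exists_additive_primitive (G := G) (hlam l)
  have hAI : ∀ a b g X, leftDeriv (E := E) (A a b) g (Complex.I • X) =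
      Complex.I • leftDeriv (A a b) g X := by
    intro a b g X
    rw [hA', hA', Finset.smul_sum]
    exact Finset.sum_congr rfl fun c _ => by rw [hρI, smul_eq_mul, smul_eq_mul]; ring
  have hwI : ∀ l g X, leftDeriv (E := E) (w l) g (Complex.I • X) =
      Complex.I • leftDeriv (w l) g X := fun l g X => by rw [hw', hlamI]
  have hmul := integral_representation_mul hρ hA hA1 hA'
  let K : ℝ := 20 * (Fintype.card J) ^ 4 + 5
  let D := Finset.univ.sup wt
  have htriU : ∀ g, IsUnitriangular wt fun a b => A a b g := fun g a b h => htri a b h g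
  -- This summand is exactly `Γ`-invariant, because `A` is real on `Γ` and the slope ignores real
  -- right factors. The squares `|w l|²` added below are invariant only up to pluriharmonic
  -- functions.
  let Ψ : G → ℝ := fun g => levelFun K wt D (slopeMat wt fun a b => A a b g)
  have hΨ : ContMDiff 𝓘(ℝ, E) 𝓘(ℝ, ℝ) ∞ Ψ := contMDiff_of_comp_unitParam fun g =>
    contDiffAt_levelFun_slopeMat K D fun a b => contDiffAt_mul_unitParam (hA a b) g unitCoord_mem
  have hΨinv : ∀ γ ∈ Γ, ∀ g, Ψ (g * γ) = Ψ g := by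
    intro γ hγ g
    obtain ⟨γ₀, rfl⟩ := hle hγ
    change levelFun K wt D _ = levelFun K wt D _
    rw [slopeMat_mul_real (A := fun a b => A a b g) (C := fun a b => A a b (ι γ₀)) (htriU g) (htriU _)
      (fun a b => integral_representation_real hι hρ hreal hA hA1 hA' a b γ₀)
      (fun a b => hmul a b g (ι γ₀))]
  let Φ : G → ℝ := fun g => Ψ g + ∑ l, Complex.normSq (w l g)
  refine isKahlerCRS_of_potential hΓ (Φ := Φ) ?_ (fun γ hγ => ?_) (fun p y hy v hv => ?_)
  · exact contMDiff_of_comp_unitParam fun g => (contDiffAt_mul_unitParam hΨ g unitCoord_mem).add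
      (ContDiffAt.sum fun l _ => contDiffAt_normSq_comp
        (contDiffAt_mul_unitParam (hw l) g unitCoord_mem))
  · let k : N → ℂ := fun l => w l γ - w l 1
    -- Chosen from `|w|² = |w + k|² - Re (2 k̄ w + |k|²)`, where `k` is the increment of `w` under
    -- `γ`.
    let H : G → ℂ := fun g => -∑ l, (2 * (starRingEnd ℂ) (k l) * w l g + Complex.normSq (k l))
    have hH : ContMDiff 𝓘(ℝ, E) 𝓘(ℝ, ℂ) ∞ H := contMDiff_of_comp_unitParam fun g =>
      (ContDiffAt.sum fun l _ => (contDiffAt_const.mul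
        (contDiffAt_mul_unitParam (hw l) g unitCoord_mem)).add contDiffAt_const).neg
    have hH' : ∀ g, leftDeriv (E := E) H g = -∑ l, (2 * (starRingEnd ℂ) (k l)) • leftDeriv (w l) g :=
      fun g => (HasFDerivAt.fun_neg (HasFDerivAt.fun_sum (u := Finset.univ) fun l _ =>
        ((hasFDerivAt_leftDeriv (hw l) g).const_mul (2 * (starRingEnd ℂ) (k l))).add_const
          (Complex.normSq (k l) : ℂ))).fderiv
    refine ⟨H, fun p y hy => isHoloAt_comp_chart_symm hH (fun g X => ?_) p hy, fun g => ?_⟩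
    · rw [hH']
      simp only [neg_apply, sum_apply, smul_apply, hwI, smul_eq_mul]
      rw [mul_neg, Finset.mul_sum]
      congr 1
      exact Finset.sum_congr rfl fun l _ => by ring
    · change Ψ g + _ = Ψ (g * γ) + _ + _
      rw [hΨinv γ hγ, Complex.neg_re, Complex.re_sum, add_assoc, ← sub_eq_add_neg,
        ← Finset.sum_sub_distrib]
      congr 1
      refine Finset.sum_congr rfl fun l _ => ?_
      have : w l (g * γ) = w l g + k l := by rw [hwmul]; simp only [k]; ring
      rw [this]
      simp only [Complex.normSq_apply, Complex.add_re, Complex.add_im, Complex.mul_re, Complex.mul_im,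
        Complex.conj_re, Complex.conj_im, Complex.ofReal_re, Complex.re_ofNat, Complex.im_ofNat]
      ring
  · have hAh : ∀ a b, IsHoloAt (fun u => A a b ((chartAt E p).symm u)) y := fun a b =>
      isHoloAt_comp_chart_symm (hA a b) (hAI a b) p hy
    have hwh : ∀ l, IsHoloAt (fun u => w l ((chartAt E p).symm u)) y := fun l =>
      isHoloAt_comp_chart_symm (hw l) (hwI l) p hy
    have hL := lineLaplacian_levelFun_slopeMat (wt := wt)
      (A := fun u a b => A a b ((chartAt E p).symm u)) hAh (fun u => htriU _) (K := K) rfl v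
    have e1 : lineLaplacian (fun u => Φ ((chartAt E p).symm u)) y v =
        lineLaplacian (fun u => Ψ ((chartAt E p).symm u)) y v +
          ∑ l, 4 * Complex.normSq (fderiv ℝ (fun u => w l ((chartAt E p).symm u)) y v) := by
      rw [lineLaplacian_add
        (contDiffAt_comp_of_contMDiff hΨ (contMDiffAt_chart_symm p hy))
        (ContDiffAt.sum fun l _ => contDiffAt_normSq_comp (hwh l).1),
        lineLaplacian_sum _ fun l => contDiffAt_normSq_comp (hwh l).1]
      congr 1
      exact Finset.sum_congr rfl fun l _ => lineLaplacian_normSq (hwh l) v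
    have hnn : ∀ l, 0 ≤ 4 * Complex.normSq (fderiv ℝ (fun u => w l ((chartAt E p).symm u)) y v) :=
      fun l => mul_nonneg (by norm_num) (Complex.normSq_nonneg _)
    have h0 : 0 ≤ lineLaplacian (fun u => Ψ ((chartAt E p).symm u)) y v := hL.1
    have hsum := Finset.sum_nonneg fun l (_ : l ∈ Finset.univ) => hnn l
    rw [e1]
    -- Both contributions are nonnegative, so failure of strictness makes both vanish, and then
    -- every `ρ` and `lam` kills the vector `X`.
    by_contra hneg
    have hz1 : lineLaplacian (fun u => Ψ ((chartAt E p).symm u)) y v = 0 := by linarith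
    have hz2 : ∑ l, 4 * Complex.normSq (fderiv ℝ (fun u => w l ((chartAt E p).symm u)) y v) = 0 := by
      linarith
    have hAz := hL.2 hz1
    set x := (chartAt E p).symm y with hx
    set X := chartCoframe p y v with hX
    have hρX : ∀ a b, ρ a b X = 0 := by
      intro a b
      have h1 : ∀ c, ∑ d, A c d x * ρ d b X = 0 := by
        intro c
        have := hAz c b
        rw [fderiv_comp_chart_symm (hA c b) p hy, ContinuousLinearMap.comp_apply, hA'] at this
        exact this
      -- The factor `A x` in front of `ρ X` is cancelled by multiplying with `A x⁻¹`.
      have h2 : ∑ c, A a c x⁻¹ * ∑ d, A c d x * ρ d b X = 0 := by simp [h1]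
      have h3 : ∑ c, A a c x⁻¹ * ∑ d, A c d x * ρ d b X = ρ a b X := by
        calc ∑ c, A a c x⁻¹ * ∑ d, A c d x * ρ d b X
            = ∑ d, (∑ c, A a c x⁻¹ * A c d x) * ρ d b X := by
              simp only [Finset.mul_sum, Finset.sum_mul]
              rw [Finset.sum_comm]
              simp only [mul_assoc]
          _ = ρ a b X := by
              simp only [← hmul, inv_mul_cancel, hA1]
              simp
      rw [← h3, h2]
    have hlX : ∀ l, lam l X = 0 := by
      intro l
      have h1 := (Finset.sum_eq_zero_iff_of_nonneg fun l _ => hnn l).1 hz2 l (Finset.mem_univ l)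
      have h2 := Complex.normSq_eq_zero.1 (by linarith)
      rwa [fderiv_comp_chart_symm (hw l) p hy, ContinuousLinearMap.comp_apply, hw'] at h2
    exact hv (chartCoframe_injective p hy (hinj X hρX hlX))

end Construction

/-! ### Complex linear extension from a generic real subspace -/

section ComplexExtension

theorem I_smul_I_smul {W : Type*} [AddCommGroup W] [Module ℂ W] (w : W) :
    Complex.I • Complex.I • w = -w := by
  rw [smul_smul, Complex.I_mul_I, neg_one_smul]

/-- A real linear map on a generic real subspace extends to a complex linear map on the whole space as
soon as it is compatible with the complex structure on the complex part. -/
theorem exists_complex_extension {L E V : Type*} [AddCommGroup L] [Module ℝ L] [AddCommGroup E]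
    [Module ℂ E] [AddCommGroup V] [Module ℂ V] {T : L →ₗ[ℝ] E}
    (hgen : ∀ e, ∃ x y, T x + Complex.I • T y = e) (f : L →ₗ[ℝ] V)
    (hf : ∀ x y, T x + Complex.I • T y = 0 → f x + Complex.I • f y = 0) :
    ∃ F : E →ₗ[ℝ] V, (∀ X, F (Complex.I • X) = Complex.I • F X) ∧ ∀ x, F (T x) = f x := by
  let S : L × L →ₗ[ℝ] E := T.coprod ((LinearMap.lsmul ℂ E Complex.I).restrictScalars ℝ ∘ₗ T)
  have hS : ∀ z, S z = T z.1 + Complex.I • T z.2 := fun z => rfl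
  -- A real section writes each vector as `T x + i T y`; by `hf` the extension does not depend on
  -- this choice, which yields complex linearity.
  obtain ⟨s, hs⟩ := S.exists_rightInverse_of_surjective (LinearMap.range_eq_top.2 fun e => by
    obtain ⟨x, y, h⟩ := hgen e
    exact ⟨(x, y), h⟩)
  let f' : L × L →ₗ[ℝ] V := f.coprod ((LinearMap.lsmul ℂ V Complex.I).restrictScalars ℝ ∘ₗ f)
  have hf' : ∀ z, f' z = f z.1 + Complex.I • f z.2 := fun z => rfl
  have key : ∀ x y, (f' ∘ₗ s) (T x + Complex.I • T y) = f x + Complex.I • f y := by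
    intro x y
    set z := s (T x + Complex.I • T y) with hz
    have h1 : T z.1 + Complex.I • T z.2 = T x + Complex.I • T y := by
      rw [← hS, hz]
      exact LinearMap.congr_fun hs _
    have h2 := hf (z.1 - x) (z.2 - y) (by
      rw [map_sub, map_sub, smul_sub, sub_add_sub_comm, h1, sub_self])
    rw [map_sub, map_sub, smul_sub, sub_add_sub_comm, sub_eq_zero] at h2
    rw [LinearMap.comp_apply, ← hz, hf', h2]
  refine ⟨f' ∘ₗ s, fun X => ?_, fun x => ?_⟩
  · obtain ⟨x, y, rfl⟩ := hgen X
    have := key (-y) x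
    rw [map_neg, map_neg] at this
    rw [key, smul_add, smul_add, I_smul_I_smul, I_smul_I_smul, add_comm, this, add_comm]
  · simpa using key x 0

end ComplexExtension

/-! ### A splitting yields a Kähler form -/

section Splitting

variable {E : Type*} [NormedAddCommGroup E] [NormedSpace ℂ E] [FiniteDimensional ℂ E]
  {G : Type*} [TopologicalSpace G] [ChartedSpace E G] [Group G] [LieGroup 𝓘(ℂ, E) ω G]
  {E₀ : Type*} [NormedAddCommGroup E₀] [NormedSpace ℝ E₀] [FiniteDimensional ℝ E₀]
  {G₀ : Type*} [TopologicalSpace G₀] [ChartedSpace E₀ G₀] [Group G₀] [LieGroup 𝓘(ℝ, E₀) ∞ G₀]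

theorem lieDifferential_eq_lieDeriv [LieGroup 𝓘(ℝ, E) ∞ G] {ι : G₀ →* G}
    (hι : ContMDiff 𝓘(ℝ, E₀) 𝓘(ℝ, E) ∞ ι) (x : GroupLieAlgebra 𝓘(ℝ, E₀) G₀) :
    lieDifferential E₀ E ι x = lieDeriv E ι x :=
  DFunLike.congr_fun (mfderiv_hom_eq (E := E) hι) x

theorem mem_iLieSubspace [LieGroup 𝓘(ℝ, E) ∞ G] {ι : G₀ →* G}
    (hι : ContMDiff 𝓘(ℝ, E₀) 𝓘(ℝ, E) ∞ ι) {V : Submodule ℝ (GroupLieAlgebra 𝓘(ℝ, E₀) G₀)} {e : E} :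
    e ∈ iLieSubspace E₀ E ι V ↔ ∃ y ∈ V, Complex.I • lieDeriv E (E₀ := E₀) ι y = e := by
  constructor
  · rintro ⟨_, ⟨y, hy, rfl⟩, rfl⟩
    exact ⟨y, hy, congrArg (fun u : E => Complex.I • u) (lieDifferential_eq_lieDeriv hι y).symm⟩
  · rintro ⟨y, hy, rfl⟩
    exact ⟨_, ⟨y, hy, rfl⟩,
      congrArg (fun u : E => Complex.I • u) (lieDifferential_eq_lieDeriv hι y)⟩

theorem mem_complexPart [LieGroup 𝓘(ℝ, E) ∞ G] {ι : G₀ →* G}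
    (hι : ContMDiff 𝓘(ℝ, E₀) 𝓘(ℝ, E) ∞ ι) {x : GroupLieAlgebra 𝓘(ℝ, E₀) G₀} :
    x ∈ complexPart E₀ E ι ↔ ∃ y, Complex.I • lieDeriv E (E₀ := E₀) ι y = lieDeriv E (E₀ := E₀) ι x := by
  have := mem_iLieSubspace (E := E) hι (V := ⊤) (e := lieDeriv E ι x)
  simp only [Submodule.mem_top, true_and] at this
  rw [← this, ← lieDifferential_eq_lieDeriv hι]
  rfl

theorem IsCRSolvmanifold.exists_add_smul_eq [LieGroup 𝓘(ℝ, E) ∞ G] {ι : G₀ →* G} {Γ : Subgroup G}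
    (h : IsCRSolvmanifold E₀ E ι Γ) (e : E) :
    ∃ x y, lieDeriv E (E₀ := E₀) ι x + Complex.I • lieDeriv E (E₀ := E₀) ι y = e := by
  let e' : TangentSpace 𝓘(ℝ, E) (ι 1) := e
  have he : e' ∈ (⊤ : Submodule ℝ (GroupLieAlgebra 𝓘(ℝ, E₀) G₀)).map
      (lieDifferential E₀ E ι) ⊔ iLieSubspace E₀ E ι ⊤ := by
    rw [h.generic]; trivial
  obtain ⟨_, ⟨x, -, rfl⟩, z, hz, h2⟩ := Submodule.mem_sup.1 he
  obtain ⟨y, -, rfl⟩ := (mem_iLieSubspace h.smooth).1 hz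
  exact ⟨x, y, (congrArg (fun u : E => u + Complex.I • lieDeriv E ι y)
    (lieDifferential_eq_lieDeriv h.smooth x).symm).trans h2⟩

theorem IsCRSolvmanifold.lieDeriv_injective [LieGroup 𝓘(ℝ, E) ∞ G] {ι : G₀ →* G} {Γ : Subgroup G}
    (h : IsCRSolvmanifold E₀ E ι Γ) : Function.Injective (lieDeriv E (E₀ := E₀) ι) := by
  intro x y hxy
  have h1 : lieDifferential E₀ E ι x = lieDifferential E₀ E ι y :=
    (lieDifferential_eq_lieDeriv h.smooth x).trans
      (hxy.trans (lieDifferential_eq_lieDeriv h.smooth y).symm)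
  exact h.immersion 1 h1

variable [LieGroup 𝓘(ℝ, E) ∞ G]

/-- The bracket of a complex Lie group on combinations of elements of a real subalgebra. -/
theorem unitBracket_combination {L : Type*} [LieRing L] [LieAlgebra ℝ L] {T : L →ₗ[ℝ] E}
    (hbr : ∀ x y, T ⁅x, y⁆ = unitBracket E G (T x) (T y)) (x y x' y' : L) :
    unitBracket E G (T x + Complex.I • T y) (T x' + Complex.I • T y') =
      T ⁅x, x'⁆ - T ⁅y, y'⁆ + Complex.I • (T ⁅x, y'⁆ + T ⁅y, x'⁆) := by
  simp only [unitBracket_add_left, unitBracket_add_right, unitBracket_smul_left,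
    unitBracket_smul_right, ← hbr, smul_smul, Complex.I_mul_I, neg_one_smul, smul_add]
  abel

/-- A relation `T x + i T y = 0` forces `x, y ∈ 𝔪`. Hence the representation of `L ⧸ 𝔪` extends
complex linearly to `E`, and so does the projection onto `𝔪`, which is the identity on such pairs. A
vector killed by the first extension comes from `𝔪`, and there the second is injective. -/
theorem isKahlerCRS_of_hasAbelianSplitting {ι : G₀ →* G} {Γ : Subgroup G}
    (h : IsCRSolvmanifold E₀ E ι Γ) (hnil : Group.IsNilpotent G)
    (hs : HasAbelianSplitting E₀ E ι) : IsKahlerCRS E h.discrete := by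
  have := h.simplyConnected
  have := h.connected
  obtain ⟨𝔞, 𝔪, h𝔪, hc, hab, -⟩ := hs
  set L := GroupLieAlgebra 𝓘(ℝ, E₀) G₀ with hL
  have : FiniteDimensional ℝ L := inferInstanceAs (FiniteDimensional ℝ E₀)
  have : LieRing.IsNilpotent L := lieRing_isNilpotent_of_immersion h.smooth h.lieDeriv_injective hnil
  let q : L →ₗ⁅ℝ⁆ L ⧸ 𝔪 :=
    { (LieSubmodule.Quotient.mk' 𝔪 : L →ₗ[ℝ] L ⧸ 𝔪) with
      map_lie' := fun {_ _} => rfl }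
  have : LieRing.IsNilpotent (L ⧸ 𝔪) := Function.Surjective.lieAlgebra_isNilpotent (R := ℝ) (f := q)
    (LieSubmodule.Quotient.surjective_mk' 𝔪)
  set T : L →ₗ[ℝ] E := lieDeriv E ι with hT
  have hbr : ∀ x y : L, T ⁅x, y⁆ = unitBracket E G (T x) (T y) := lieDeriv_bracket h.smooth
  have hgen : ∀ e, ∃ x y : L, T x + Complex.I • T y = e := h.exists_add_smul_eq
  have hmem : ∀ x : L, x ∈ 𝔪 ↔ ∃ y, Complex.I • T y = T x := fun x => by
    rw [← mem_complexPart h.smooth, ← h𝔪]; rfl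
  have hker : ∀ x y : L, T x + Complex.I • T y = 0 → x ∈ 𝔪 ∧ y ∈ 𝔪 := by
    intro x y hxy
    have h1 : T x = -(Complex.I • T y) := eq_neg_of_add_eq_zero_left hxy
    refine ⟨(hmem x).2 ⟨-y, by rw [h1, map_neg, smul_neg]⟩, (hmem y).2 ⟨x, ?_⟩⟩
    rw [h1, smul_neg, smul_smul, Complex.I_mul_I, neg_one_smul, neg_neg]
  obtain ⟨J, _, _, wt, ρ₁, hρ₁, hρ₁br, hρ₁inj⟩ := exists_strict_representation (k := ℝ) (L ⧸ 𝔪)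
  have hq0 : ∀ x, q x = 0 ↔ x ∈ 𝔪 := fun x => LieSubmodule.Quotient.mk_eq_zero'
  let f : J → J → L →ₗ[ℝ] ℂ := fun b a => Complex.ofRealLI.toLinearMap ∘ₗ ρ₁ b a ∘ₗ q.toLinearMap
  have hf : ∀ b a x, f b a x = (ρ₁ b a (q x) : ℂ) := fun b a x => rfl
  choose ρ hρI hρT using fun b a => exists_complex_extension hgen (f b a) fun x y hxy => by
    obtain ⟨h1, h2⟩ := hker x y hxy
    rw [hf, hf, (hq0 x).2 h1, (hq0 y).2 h2]
    simp
  have hc' : IsCompl 𝔪.toSubmodule 𝔞.toSubmodule := (LieSubmodule.isCompl_toSubmodule.2 hc).symm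
  let π : L →ₗ[ℝ] L := 𝔪.toSubmodule.projection 𝔞.toSubmodule hc'
  have hπ𝔪 : ∀ x ∈ 𝔪, π x = x := fun x hx => Submodule.projection_apply_left hc' ⟨x, hx⟩
  have hπ𝔞 : ∀ x ∈ 𝔞, π x = 0 := fun x hx => (Submodule.projection_apply_eq_zero_iff hc').2 hx
  have hπbr : ∀ x y : L, π ⁅x, y⁆ = 0 := by
    -- The ideal `𝔪` is central: it is abelian, and its brackets with `𝔞` lie in `𝔪 ∩ 𝔞 = 0`.
    -- Brackets therefore lie in `𝔞`, where `π` vanishes.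
    have key : ∀ m ∈ 𝔪, ∀ y : L, ⁅m, y⁆ = 0 := by
      intro m hm y
      obtain ⟨m', hm', a, ha, rfl⟩ := Submodule.mem_sup.1
        (show y ∈ 𝔪.toSubmodule ⊔ 𝔞.toSubmodule by rw [hc'.sup_eq_top]; trivial)
      have h1 : ⁅m, m'⁆ = 0 := congrArg Subtype.val (hab.trivial ⟨m, hm⟩ ⟨m', hm'⟩)
      have h2 : ⁅m, a⁆ = 0 := Submodule.disjoint_def.1 hc'.disjoint _
        (lie_mem_left ℝ L 𝔪 m a hm) (lie_mem_right ℝ L 𝔞 m a ha)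
      rw [lie_add, h1, h2, add_zero]
    intro x y
    obtain ⟨m, hm, a, ha, rfl⟩ := Submodule.mem_sup.1
      (show x ∈ 𝔪.toSubmodule ⊔ 𝔞.toSubmodule by rw [hc'.sup_eq_top]; trivial)
    rw [add_lie, key m hm, zero_add]
    exact hπ𝔞 _ (lie_mem_left ℝ L 𝔞 a y ha)
  obtain ⟨ζ, hζI, hζT⟩ := exists_complex_extension hgen (T ∘ₗ π) fun x y hxy => by
    obtain ⟨h1, h2⟩ := hker x y hxy
    rw [LinearMap.comp_apply, LinearMap.comp_apply, hπ𝔪 x h1, hπ𝔪 y h2, hxy]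
  let bas := Module.finBasis ℂ E
  let lam : Fin (Module.finrank ℂ E) → E →ₗ[ℝ] ℂ := fun l => (bas.coord l).restrictScalars ℝ ∘ₗ ζ
  have hlam : ∀ l X, lam l X = bas.coord l (ζ X) := fun l X => rfl
  refine isKahlerCRS_of_representation h.discrete h.smooth h.le_range (wt := wt)
    (ρ := fun b a => (ρ b a).toContinuousLinearMap)
    (lam := fun l => (lam l).toContinuousLinearMap) (fun b a hba => hρ₁ b a ?_)
    (fun b a X => hρI b a X) (fun X Y a b => ?_) (fun b a X => ?_) (fun l X => ?_) (fun l X Y => ?_)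
    (fun X hX1 hX2 => ?_)
  · rintro h0
    refine hba ?_
    ext X
    obtain ⟨x, y, rfl⟩ := hgen X
    change ρ b a _ = 0
    rw [map_add, hρI, hρT, hρT, hf, hf, h0]
    simp
  · obtain ⟨x, y, rfl⟩ := hgen X
    obtain ⟨x', y', rfl⟩ := hgen Y
    rw [unitBracket_combination hbr]
    change ρ a b _ = ∑ c, (ρ a c _ * ρ c b _ - ρ a c _ * ρ c b _)
    have hl : ∀ x y : L, f a b ⁅x, y⁆ = ∑ c, (f a c x * f c b y - f a c y * f c b x) := by
      intro x y
      simp only [hf]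
      rw [LieHom.map_lie, hρ₁br]
      push_cast
      rfl
    simp only [map_add, map_sub, hρI, hρT, hl, smul_eq_mul]
    rw [← Finset.sum_sub_distrib, ← Finset.sum_add_distrib, Finset.mul_sum,
      ← Finset.sum_add_distrib]
    refine Finset.sum_congr rfl fun c _ => ?_
    linear_combination -(f a c y * f c b y' - f a c y' * f c b y) * Complex.I_sq
  · exact (congrArg Complex.im (hρT b a X)).trans (Complex.ofReal_im _)
  · change lam l _ = Complex.I • lam l _
    rw [hlam, hlam, hζI, map_smul]
  · obtain ⟨x, y, rfl⟩ := hgen X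
    obtain ⟨x', y', rfl⟩ := hgen Y
    rw [unitBracket_combination hbr]
    change lam l _ = 0
    rw [hlam]
    simp [hζI, hζT, hπbr]
  · obtain ⟨x, y, rfl⟩ := hgen X
    have h1 : ∀ a b, ρ₁ a b (q x) = 0 ∧ ρ₁ a b (q y) = 0 := by
      intro a b
      have := hX1 a b
      change ρ a b _ = 0 at this
      rw [map_add, hρI, hρT, hρT, hf, hf] at this
      constructor
      · simpa using congrArg Complex.re this
      · simpa using congrArg Complex.im this
    have hx := (hq0 x).1 (hρ₁inj _ fun a b => (h1 a b).1)
    have hy := (hq0 y).1 (hρ₁inj _ fun a b => (h1 a b).2)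
    have h2 : ζ (T x + Complex.I • T y) = 0 := by
      apply bas.ext_elem
      intro l
      rw [map_zero]
      exact hX2 l
    rwa [map_add, hζI, hζT, hζT, LinearMap.comp_apply, LinearMap.comp_apply, hπ𝔪 x hx,
      hπ𝔪 y hy] at h2

end Splitting

/-! ### Nilpotent Lie algebras with a cocycle positive on the complex part -/

section PositiveCocycle

variable {E : Type*} [AddCommGroup E] [Module ℂ E] {L : Type*} [LieRing L] [LieAlgebra ℝ L]

theorem foldr_lie_mem_lowerCentralSeries (l : List L) (v : L) :
    l.foldr (fun x w => ⁅x, w⁆) v ∈ LieModule.lowerCentralSeries ℝ L L l.length := by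
  induction l with
  | nil => simp
  | cons x l ih =>
    rw [List.length_cons, LieModule.lowerCentralSeries_succ]
    exact LieSubmodule.lie_mem_lie (LieSubmodule.mem_top x) ih

variable {T : L →ₗ[ℝ] E} (hI : ∀ x v v' : L, T v' = Complex.I • T v → T ⁅x, v'⁆ = Complex.I • T ⁅x, v⁆)
  (hT : Function.Injective T) {β : L →ₗ[ℝ] L →ₗ[ℝ] ℝ}
  (hβ : ∀ x y z : L, β ⁅x, y⁆ z + β ⁅y, z⁆ x + β ⁅z, x⁆ y = 0)
  (hpos : ∀ v v' : L, T v' = Complex.I • T v → v ≠ 0 → 0 < β v v')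

include hI in
theorem foldr_lie_smul (l : List L) {v v' : L} (h : T v' = Complex.I • T v) :
    T (l.foldr (fun x w => ⁅x, w⁆) v') = Complex.I • T (l.foldr (fun x w => ⁅x, w⁆) v) := by
  induction l with
  | nil => exact h
  | cons x l ih => exact hI x _ _ ih

include hI hβ hpos in
/-- A nilpotent Lie algebra with a closed form which is positive on the complex part has a central
complex part. -/
theorem lie_eq_zero_of_positive_cocycle [LieRing.IsNilpotent L] (x : L) {v v' : L}
    (h : T v' = Complex.I • T v) : ⁅x, v⁆ = 0 := by
  have hswap : ∀ {v v' : L}, T v' = Complex.I • T v → T (-v) = Complex.I • T v' := by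
    intro v v' h
    rw [h, I_smul_I_smul, map_neg]
  obtain ⟨n, hn⟩ := (LieModule.isNilpotent_iff ℝ L L).1 ‹_›
  -- Iterated brackets ending in the complex part are shown to vanish from the longest down; `k = n`
  -- leaves a single bracket.
  have key : ∀ k, k ≤ n → ∀ l : List L, l.length = n - k + 1 → ∀ v v' : L,
      T v' = Complex.I • T v → l.foldr (fun x w => ⁅x, w⁆) v = 0 := by
    intro k
    induction k with
    | zero =>
      intro _ l hl v v' _
      have h1 := foldr_lie_mem_lowerCentralSeries l v
      have h2 := LieModule.antitone_lowerCentralSeries ℝ L L (show n ≤ l.length by omega) h1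
      rw [hn] at h2
      simpa using h2
    | succ k ih =>
      intro hk l hl v v' hv
      obtain ⟨a, l', rfl⟩ := List.exists_cons_of_length_eq_add_one hl
      set z := (a :: l').foldr (fun x w => ⁅x, w⁆) v with hz
      set z' := (a :: l').foldr (fun x w => ⁅x, w⁆) v' with hz'
      have hzz : T z' = Complex.I • T z := foldr_lie_smul hI _ hv
      have hc' : ∀ y, ⁅y, z'⁆ = 0 := fun y =>
        ih (by omega) (y :: a :: l') (by simp at hl ⊢; omega) v' (-v) (hswap hv)
      by_contra hne
      have h1 := hpos z z' hzz hne
      -- Here `z` is a bracket, and `z' = i z` is central by the induction hypothesis, so the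
      -- cocycle identity collapses to `β z z' = 0`, against positivity.
      have h2 := hβ a (l'.foldr (fun x w => ⁅x, w⁆) v) z'
      rw [hc', ← lie_skew z' a, hc'] at h2
      simp only [neg_zero, map_zero, LinearMap.zero_apply, add_zero] at h2
      exact h1.ne' h2
  have := key n le_rfl [x] (by simp) v v' h
  simpa using this

include hI hT hβ hpos in
-- The complex part is central. For central `z' = i z` the functional `β(·, z')` kills all brackets
-- but is positive at `z ≠ 0`, so the derived algebra meets the complex part trivially. A complement
-- containing the derived algebra is automatically an ideal.
theorem exists_splitting_of_positive_cocycle [LieRing.IsNilpotent L] :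
    ∃ 𝔞 𝔪 : LieIdeal ℝ L, (∀ x, x ∈ 𝔪 ↔ ∃ y, Complex.I • T y = T x) ∧ IsCompl 𝔞 𝔪 ∧
      IsLieAbelian 𝔪 := by
  have hmem : ∀ x : L, (∃ y, Complex.I • T y = T x) ↔ ∃ y, T y = Complex.I • T x := fun x => by
    constructor
    · rintro ⟨y, hy⟩
      exact ⟨-y, by rw [← hy, I_smul_I_smul, map_neg]⟩
    · rintro ⟨y, hy⟩
      exact ⟨-y, by rw [map_neg, hy, smul_neg, I_smul_I_smul, neg_neg]⟩
  have hcen : ∀ v : L, (∃ y, Complex.I • T y = T v) → ∀ x : L, ⁅x, v⁆ = 0 := fun v hv x => by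
    obtain ⟨v', hv'⟩ := (hmem v).1 hv
    exact lie_eq_zero_of_positive_cocycle hI hβ hpos x hv'
  let 𝔪 : LieIdeal ℝ L :=
    { carrier := {x | ∃ y, Complex.I • T y = T x}
      add_mem' := by
        rintro x x' ⟨y, hy⟩ ⟨y', hy'⟩
        exact ⟨y + y', by rw [map_add, smul_add, hy, hy', map_add]⟩
      zero_mem' := ⟨0, by simp⟩
      smul_mem' := by
        rintro c x ⟨y, hy⟩
        exact ⟨c • y, by rw [map_smul, smul_comm, hy, map_smul]⟩
      lie_mem := by
        intro x v hv
        exact ⟨0, by rw [hcen v hv x]; simp⟩ }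
  have h𝔪 : ∀ x, x ∈ 𝔪 ↔ ∃ y, Complex.I • T y = T x := fun x => Iff.rfl
  let D : Submodule ℝ L := Submodule.span ℝ {z | ∃ x y : L, ⁅x, y⁆ = z}
  have hdisj : Disjoint D 𝔪.toSubmodule := by
    rw [Submodule.disjoint_def]
    intro z hzD hz
    obtain ⟨z', hz'⟩ := (hmem z).1 hz
    have hz'm : ∃ y, Complex.I • T y = T z' := ⟨z, hz'.symm⟩
    have hle : D ≤ LinearMap.ker (β.flip z') := by
      refine Submodule.span_le.2 ?_
      rintro _ ⟨x, y, rfl⟩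
      have h2 := hβ x y z'
      rw [hcen z' hz'm, ← lie_skew z' x, hcen z' hz'm] at h2
      simp only [neg_zero, map_zero, LinearMap.zero_apply, add_zero] at h2
      exact h2
    by_contra hne
    exact (hpos z z' hz' hne).ne' (hle hzD)
  obtain ⟨A, hDA, hA⟩ := hdisj.exists_isCompl
  let 𝔞 : LieIdeal ℝ L :=
    { A with lie_mem := fun {x m} _ => hDA (Submodule.subset_span ⟨x, m, rfl⟩) }
  refine ⟨𝔞, 𝔪, h𝔪, LieSubmodule.isCompl_toSubmodule.1 hA, ⟨fun x y => Subtype.ext ?_⟩⟩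
  exact hcen y y.2 x

end PositiveCocycle

/-! ### From a positive cocycle to the required splitting -/

section Splitting

variable {E : Type*} [NormedAddCommGroup E] [NormedSpace ℂ E] [FiniteDimensional ℂ E]
  {G : Type*} [TopologicalSpace G] [ChartedSpace E G] [Group G] [LieGroup 𝓘(ℂ, E) ω G]
  {E₀ : Type*} [NormedAddCommGroup E₀] [NormedSpace ℝ E₀] [FiniteDimensional ℝ E₀]
  {G₀ : Type*} [TopologicalSpace G₀] [ChartedSpace E₀ G₀] [Group G₀] [LieGroup 𝓘(ℝ, E₀) ∞ G₀]
  [LieGroup 𝓘(ℝ, E) ∞ G]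

theorem hasAbelianSplitting_of_positive_cocycle {ι : G₀ →* G} {Γ : Subgroup G}
    (h : IsCRSolvmanifold E₀ E ι Γ) (hnil : Group.IsNilpotent G)
    {β : GroupLieAlgebra 𝓘(ℝ, E₀) G₀ →ₗ[ℝ] GroupLieAlgebra 𝓘(ℝ, E₀) G₀ →ₗ[ℝ] ℝ}
    (hβ : ∀ x y z, β ⁅x, y⁆ z + β ⁅y, z⁆ x + β ⁅z, x⁆ y = 0)
    (hpos : ∀ v v', lieDeriv E ι v' = Complex.I • lieDeriv E ι v → v ≠ 0 → 0 < β v v') :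
    HasAbelianSplitting E₀ E ι := by
  have : LieRing.IsNilpotent (GroupLieAlgebra 𝓘(ℝ, E₀) G₀) :=
    lieRing_isNilpotent_of_immersion h.smooth h.lieDeriv_injective hnil
  obtain ⟨𝔞, 𝔪, h𝔪, hc, hab⟩ := exists_splitting_of_positive_cocycle (T := lieDeriv E (E₀ := E₀) ι)
    (fun x v v' hv => by
      rw [lieDeriv_bracket h.smooth, lieDeriv_bracket h.smooth, hv, unitBracket_smul_right])
    h.lieDeriv_injective hβ hpos
  refine ⟨𝔞, 𝔪, ?_, hc, hab, ?_⟩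
  · ext x
    exact (h𝔪 x).trans (mem_complexPart h.smooth).symm
  -- An element of `𝔞` that also lies in `i 𝔞` belongs to `𝔪`, hence vanishes.
  · rw [Submodule.eq_bot_iff]
    rintro _ ⟨⟨x, hx, rfl⟩, hz⟩
    obtain ⟨y, -, hy⟩ := (mem_iLieSubspace h.smooth).1 hz
    have hxm : x ∈ 𝔪 := (h𝔪 x).2 ⟨y, hy.trans (lieDifferential_eq_lieDeriv h.smooth x)⟩
    have hx0 : x = 0 := Submodule.disjoint_def.1 (LieSubmodule.disjoint_toSubmodule.2 hc.disjoint) x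
      hx hxm
    rw [hx0, map_zero]

end Splitting

/-! ### Pulling back forms to the model space -/

section PullbackForm

open Filter Topology

variable {E : Type*} [NormedAddCommGroup E] [NormedSpace ℂ E]
  {M : Type*} [TopologicalSpace M] [ChartedSpace E M]

/-- A form at a point, on the model space. -/
def formAt (η : ∀ x : M, TangentSpace 𝓘(ℝ, E) x [⋀^Fin 2]→L[ℝ] ℝ) (x : M) : E [⋀^Fin 2]→L[ℝ] ℝ := η x

/-- The pullback of a form on a manifold by a map from the model space. -/
def pullForm (η : ∀ x : M, TangentSpace 𝓘(ℝ, E) x [⋀^Fin 2]→L[ℝ] ℝ) (s : E → M) (y : E) :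
    E [⋀^Fin 2]→L[ℝ] ℝ :=
  (formAt η (s y)).compContinuousLinearMap (fderiv ℝ (fun z => chartAt E (s y) (s z)) y)

variable {η : ∀ x : M, TangentSpace 𝓘(ℝ, E) x [⋀^Fin 2]→L[ℝ] ℝ} {s : E → M} {y : E}

theorem pullForm_of_eq {x : M} (h : s y = x) : pullForm η s y =
    (formAt η x).compContinuousLinearMap (fderiv ℝ (fun z => chartAt E x (s z)) y) := by
  subst h; rfl

variable [IsManifold 𝓘(ℂ, E) ω M]

theorem contDiffAt_chart_comp [IsManifold 𝓘(ℝ, E) ∞ M] (a : M)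
    (hs : ContMDiffAt 𝓘(ℝ, E) 𝓘(ℝ, E) ∞ s y)
    (ha : s y ∈ (chartAt E a).source) : ContDiffAt ℝ ∞ (fun z => chartAt E a (s z)) y :=
  contMDiffAt_iff_contDiffAt.1 (ContMDiffAt.comp (g := chartAt E a) y
    (contMDiffOn_chart.contMDiffAt ((chartAt E a).open_source.mem_nhds ha)) hs)

/-- Any chart around the image may replace the preferred one, by the chain rule through the
transition map. -/
theorem pullForm_eq [IsManifold 𝓘(ℝ, E) ∞ M] (a : M) (hs : ContMDiffAt 𝓘(ℝ, E) 𝓘(ℝ, E) ∞ s y)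
    (ha : s y ∈ (chartAt E a).source) : pullForm η s y =
      (formInChart η (chartAt E a) (chartAt E a (s y))).compContinuousLinearMap
        (fderiv ℝ (fun z => chartAt E a (s z)) y) := by
  have ht := (chartAt E a).map_source ha
  have hx : (chartAt E a).symm (chartAt E a (s y)) = s y := (chartAt E a).left_inv ha
  have h1 : fderiv ℝ (fun z => chartAt E ((chartAt E a).symm (chartAt E a (s y))) (s z)) y =
      (fderiv ℝ (fun u => chartAt E ((chartAt E a).symm (chartAt E a (s y)))
        ((chartAt E a).symm u)) (chartAt E a (s y))).comp
        (fderiv ℝ (fun z => chartAt E a (s z)) y) := by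
    have hd := (contDiffAt_transition (E := E) a ((chartAt E a).symm (chartAt E a (s y))) ht
      (mem_chart_source E _)).differentiableAt (by simp)
    have hd' := (contDiffAt_chart_comp a hs ha).differentiableAt (by simp)
    refine HasFDerivAt.fderiv (((hd.restrictScalars ℝ).hasFDerivAt.comp y
      hd'.hasFDerivAt).congr_of_eventuallyEq ?_)
    filter_upwards [hs.continuousAt.eventually_mem ((chartAt E a).open_source.mem_nhds ha)] with z hz
    simp only [Function.comp_apply, (chartAt E a).left_inv hz]
  rw [pullForm_of_eq hx.symm, h1, formInChart_chartAt η a ht]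
  rfl

variable {U : Set M}

/-- Near `y` one fixed chart suffices, in which the form is smooth and closed. Strict
differentiability is kept because the averaging argument needs difference quotients that are uniform
in the base point. -/
theorem hasStrictFDerivAt_pullForm (hη : IsKahlerFormOn η U) (hU : IsOpen U)
    (hs : ∀ᶠ z in 𝓝 y, ContMDiffAt 𝓘(ℝ, E) 𝓘(ℝ, E) ∞ s z) (hy : s y ∈ U) :
    (∃ D : E →L[ℝ] E [⋀^Fin 2]→L[ℝ] ℝ, HasStrictFDerivAt (pullForm η s) D y) ∧ extDeriv (pullForm η s) y = 0 := by
  have := isManifold_real (E := E) M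
  set a := s y with ha
  have hsy := hs.self_of_nhds
  have has : s y ∈ (chartAt E a).source := mem_chart_source E a
  have hP := contDiffAt_chart_comp a hsy has
  have hinv : (chartAt E a).symm (chartAt E a (s y)) = s y := (chartAt E a).left_inv has
  have hmem : chartAt E a (s y) ∈ (chartAt E a).target ∩ (chartAt E a).symm ⁻¹' U :=
    ⟨(chartAt E a).map_source has, by rw [Set.mem_preimage, hinv]; exact hy⟩
  have hform : ContDiffAt ℝ ∞ (formInChart η (chartAt E a)) (chartAt E a (s y)) :=
    (hη.smooth _ (chart_mem_atlas E a)).contDiffAt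
      (((chartAt E a).isOpen_inter_preimage_symm hU).mem_nhds hmem)
  have hev : pullForm η s =ᶠ[𝓝 y] fun u =>
      (formInChart η (chartAt E a) (chartAt E a (s u))).compContinuousLinearMap
        (fderiv ℝ (fun z => chartAt E a (s z)) u) := by
    filter_upwards [hs, hsy.continuousAt.eventually_mem
      ((chartAt E a).open_source.mem_nhds has)] with u hu1 hu2 using pullForm_eq a hu1 hu2
  constructor
  · have h1 : HasStrictFDerivAt (fun u => formInChart η (chartAt E a) (chartAt E a (s u))) _ y :=
      (hform.hasStrictFDerivAt (by simp)).comp y (hP.hasStrictFDerivAt (by simp))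
    have h2 : HasStrictFDerivAt (fderiv ℝ (fun z => chartAt E a (s z))) _ y :=
      (hP.fderiv_right (m := ∞) (by simp)).hasStrictFDerivAt (by simp)
    exact ⟨_, (h1.continuousAlternatingMapCompContinuousLinearMap h2).congr_of_eventuallyEq
      hev.symm⟩
  · rw [hev.extDeriv_eq, extDeriv_pullback (f := fun z => chartAt E a (s z)) (hform.differentiableAt (by simp)) hP
      (by simp; exact ENat.LEInfty.out), hη.closed _ (chart_mem_atlas E a) _ hmem]
    rfl

end PullbackForm

/-! ### Algebra and exterior derivative of two-forms -/

section TwoForms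

variable {E : Type*} [NormedAddCommGroup E] [NormedSpace ℝ E] (α : E [⋀^Fin 2]→L[ℝ] ℝ)

theorem twoForm_add_left (a a' b : E) : α ![a + a', b] = α ![a, b] + α ![a', b] :=
  α.toAlternatingMap.map_vecCons_add ![b] a a'

theorem twoForm_smul_left (c : ℝ) (a b : E) : α ![c • a, b] = c * α ![a, b] :=
  α.toAlternatingMap.map_vecCons_smul ![b] c a

theorem twoForm_neg_left (a b : E) : α ![-a, b] = -α ![a, b] := by
  rw [← neg_one_smul ℝ a, twoForm_smul_left, neg_one_mul]

theorem twoForm_swap (a b : E) : α ![a, b] = -α ![b, a] := by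
  have h := α.toAlternatingMap.map_swap ![b, a] (i := 0) (j := 1) (by simp)
  refine Eq.trans (congrArg α ?_) h
  ext i
  fin_cases i <;> rfl

/-- The exterior derivative of a two-form on three vector fields. -/
theorem extDeriv_two_form_vectorField {p : E → E [⋀^Fin 2]→L[ℝ] ℝ} {x : E} {V W S : E → E}
    (hp : DifferentiableAt ℝ p x) (hV : DifferentiableAt ℝ V x) (hW : DifferentiableAt ℝ W x)
    (hS : DifferentiableAt ℝ S x) : extDeriv p x ![V x, W x, S x] =
      fderiv ℝ (fun y => p y ![W y, S y]) x (V x) - fderiv ℝ (fun y => p y ![V y, S y]) x (W x) +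
        fderiv ℝ (fun y => p y ![V y, W y]) x (S x) - p x ![VectorField.lieBracket ℝ V W x, S x] +
          p x ![VectorField.lieBracket ℝ V S x, W x] - p x ![VectorField.lieBracket ℝ W S x, V x] := by
  have key := extDeriv_apply_vectorField (V := ![V, W, S]) hp (fun i => by
    fin_cases i <;> assumption)
  have e : (fun i => ![V, W, S] i x) = ![V x, W x, S x] := by ext i; fin_cases i <;> rfl
  have e0 : (fun y => p y ((0 : Fin 3).removeNth fun i => ![V, W, S] i y)) =
      fun y => p y ![W y, S y] := by
    ext y; congr 1; ext i; fin_cases i <;> rfl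
  have e1 : (fun y => p y ((1 : Fin 3).removeNth fun i => ![V, W, S] i y)) =
      fun y => p y ![V y, S y] := by
    ext y; congr 1; ext i; fin_cases i <;> rfl
  have e2 : (fun y => p y ((2 : Fin 3).removeNth fun i => ![V, W, S] i y)) =
      fun y => p y ![V y, W y] := by
    ext y; congr 1; ext i; fin_cases i <;> rfl
  have hsum : ∀ c : Fin 2 → Fin 2 → ℝ, ∑ i, ∑ j ≥ i, c i j = c 0 0 + c 0 1 + c 1 1 := by
    intro c
    rw [Fin.sum_univ_two, show Finset.Ici (0 : Fin 2) = {0, 1} by decide,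
      show Finset.Ici (1 : Fin 2) = {1} by decide, Finset.sum_pair (by simp), Finset.sum_singleton]
  have d0 : (0 : Fin 2).removeNth ((0 : Fin 2).castSucc.removeNth ![V x, W x, S x]) = ![S x] := by
    ext i; fin_cases i; rfl
  have d1 : (1 : Fin 2).removeNth ((0 : Fin 2).castSucc.removeNth ![V x, W x, S x]) = ![W x] := by
    ext i; fin_cases i; rfl
  have d2 : (1 : Fin 2).removeNth ((1 : Fin 2).castSucc.removeNth ![V x, W x, S x]) = ![V x] := by
    ext i; fin_cases i; rfl
  rw [e, Fin.sum_univ_three, hsum, e0, e1, e2, d0, d1, d2] at key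
  rw [key]
  change (-1) ^ 0 • _ + (-1) ^ 1 • _ + (-1) ^ 2 • _ - ((-1) ^ (0 + 0) •
    p x ![VectorField.lieBracket ℝ V W x, S x] + (-1) ^ (0 + 1) •
    p x ![VectorField.lieBracket ℝ V S x, W x] + (-1) ^ (1 + 1) •
    p x ![VectorField.lieBracket ℝ W S x, V x]) = _
  simp
  ring

end TwoForms

/-! ### Forms evaluated on the vector fields of a group action -/

section ActionForm

open Filter Topology

variable {E : Type*} [NormedAddCommGroup E] [NormedSpace ℂ E]
  {M : Type*} [TopologicalSpace M] [ChartedSpace E M] [IsManifold 𝓘(ℂ, E) ω M]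
  {G : Type*} [TopologicalSpace G] [ChartedSpace E G] [Group G] [LieGroup 𝓘(ℝ, E) ∞ G]
  [MulAction G M]

variable (G) in
/-- The form on the tangent space at the identity of a group acting on a manifold induced by a form
at a point. -/
def actionForm (η : ∀ x : M, TangentSpace 𝓘(ℝ, E) x [⋀^Fin 2]→L[ℝ] ℝ) (x : M) :
    E [⋀^Fin 2]→L[ℝ] ℝ :=
  pullForm η (fun z => unitParam E G z • x) (unitCoord E G)

variable {η : ∀ x : M, TangentSpace 𝓘(ℝ, E) x [⋀^Fin 2]→L[ℝ] ℝ} {U : Set M}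
  {x : M} (hs : ∀ᶠ z in 𝓝 (unitCoord E G),
    ContMDiffAt 𝓘(ℝ, E) 𝓘(ℝ, E) ∞ (fun z => unitParam E G z • x) z)

theorem actionForm_apply (x : M) (v w : E) : actionForm G η x ![v, w] = formAt η x
    ![fderiv ℝ (fun z => chartAt E x (unitParam E G z • x)) (unitCoord E G) v,
      fderiv ℝ (fun z => chartAt E x (unitParam E G z • x)) (unitCoord E G) w] := by
  rw [actionForm, pullForm_of_eq (x := x) (by simp)]
  rw [ContinuousAlternatingMap.compContinuousLinearMap_apply]
  congr 1
  ext i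
  fin_cases i <;> rfl

theorem hasStrictFDerivAt_rightFrame :
    HasStrictFDerivAt (rightFrame E G) (mixedDeriv E G).flip (unitCoord E G) := by
  have h : ContDiffAt ℝ ∞ (fun z => (fderiv ℝ (localMul E G) (unitCoord E G, z)).comp
      (ContinuousLinearMap.inl ℝ E E)) (unitCoord E G) :=
    ((contDiffAt_fderiv_localMul (E := E) (G := G)).comp (f := fun z => (unitCoord E G, z))
      (unitCoord E G) (contDiffAt_const.prodMk contDiffAt_id)).clm_comp contDiffAt_const
  have h' : rightFrame E G =ᶠ[𝓝 (unitCoord E G)] fun z =>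
      (fderiv ℝ (localMul E G) (unitCoord E G, z)).comp (ContinuousLinearMap.inl ℝ E E) := by
    filter_upwards [target_mem_nhds (E := E) (G := G)] with z hz using rightFrame_eq hz
  have := (h.congr_of_eventuallyEq h').hasStrictFDerivAt (by simp)
  rwa [hasFDerivAt_rightFrame.fderiv] at this

include hs

/-- Since `w • (y • x) = (w * y) • x`, moving the base point composes with a right translation: the
fields generating a left action are the right invariant ones. -/
theorem eventually_actionForm_smul : ∀ᶠ y in 𝓝 (unitCoord E G),
    actionForm G η (unitParam E G y • x) =
      (pullForm η (fun z => unitParam E G z • x) y).compContinuousLinearMap (rightFrame E G y) := by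
  have := isManifold_real (E := E) M
  filter_upwards [hs, target_mem_nhds (E := E) (G := G)] with y hy hyt
  set x' := unitParam E G y • x with hx'
  have h1 : (fun w => unitParam E G w • x') =ᶠ[𝓝 (unitCoord E G)]
      fun w => unitParam E G (localMul E G (w, y)) • x := by
    have hc : ContinuousAt (fun w => unitParam E G w * unitParam E G y) (unitCoord E G) :=
      (contMDiffAt_unitParam_mul _ unitCoord_mem).continuousAt
    filter_upwards [hc.eventually_mem ((chartAt E (1 : G)).open_source.mem_nhds
      (by simpa using unitParam_mem hyt))] with w hw
    rw [localMul, unitParam_chart hw, mul_smul]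
  have h2 : fderiv ℝ (fun w => chartAt E x' (unitParam E G w • x')) (unitCoord E G) =
      (fderiv ℝ (fun z => chartAt E x' (unitParam E G z • x)) y).comp (rightFrame E G y) := by
    have hd := (contDiffAt_chart_comp x' hy (mem_chart_source E x')).differentiableAt (by simp)
    have hm : HasFDerivAt (fun w => localMul E G (w, y)) (rightFrame E G y) (unitCoord E G) := by
      rw [rightFrame_eq hyt]
      exact HasFDerivAt.comp (f := fun e => (e, y)) (unitCoord E G)
        (((localMul_contDiffAt_right hyt).differentiableAt (by simp)).hasFDerivAt)
        (hasFDerivAt_prodMk_left (𝕜 := ℝ) (unitCoord E G) y)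
    have hd' : HasFDerivAt (fun z => chartAt E x' (unitParam E G z • x))
        (fderiv ℝ (fun z => chartAt E x' (unitParam E G z • x)) y)
        (localMul E G (unitCoord E G, y)) := by
      rw [localMul_unitCoord_left hyt]; exact hd.hasFDerivAt
    refine ((hd'.comp (unitCoord E G) hm).congr_of_eventuallyEq ?_).fderiv
    filter_upwards [h1] with w hw
    rw [hw]; rfl
  rw [actionForm, pullForm_of_eq (x := x') (by simp), h2]
  rfl

theorem hasStrictFDerivAt_actionForm (hη : IsKahlerFormOn η U) (hU : IsOpen U) (hx : x ∈ U) (Y Z : E) :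
    ∃ D : E →L[ℝ] ℝ, HasStrictFDerivAt (fun z => actionForm G η (unitParam E G z • x) ![Y, Z]) D
      (unitCoord E G) := by
  obtain ⟨D, hD⟩ := (hasStrictFDerivAt_pullForm hη hU hs (by simpa using hx)).1
  have h := (hD.continuousAlternatingMapCompContinuousLinearMap
    hasStrictFDerivAt_rightFrame).continuousAlternatingMap_apply_const
    ![Y, Z]
  refine ⟨_, h.congr_of_eventuallyEq ?_⟩
  filter_upwards [eventually_actionForm_smul (η := η) hs] with y hy
  rw [hy]

/-- Closedness of a form, in terms of the vector fields of a group action. -/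
theorem actionForm_cocycle (hη : IsKahlerFormOn η U) (hU : IsOpen U) (hx : x ∈ U) (X Y Z : E) :
    fderiv ℝ (fun z => actionForm G η (unitParam E G z • x) ![Y, Z]) (unitCoord E G) X +
    fderiv ℝ (fun z => actionForm G η (unitParam E G z • x) ![Z, X]) (unitCoord E G) Y +
    fderiv ℝ (fun z => actionForm G η (unitParam E G z • x) ![X, Y]) (unitCoord E G) Z =
      -(actionForm G η x ![unitBracket E G X Y, Z] + actionForm G η x ![unitBracket E G Y Z, X] +
        actionForm G η x ![unitBracket E G Z X, Y]) := by
  set o := unitCoord E G with ho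
  obtain ⟨⟨D, hD⟩, hcl⟩ := hasStrictFDerivAt_pullForm hη hU hs (by simpa [ho] using hx)
  set p := pullForm η (fun z => unitParam E G z • x) with hp
  have hV : ∀ X, HasFDerivAt (fun y => rightFrame E G y X) ((mixedDeriv E G) X) o := fun X => by
    have := (hasFDerivAt_rightFrame (E := E) (G := G)).clm_apply (hasFDerivAt_const X o)
    refine this.congr_fderiv ?_
    ext; simp
  -- Right invariant fields have the opposite bracket, which accounts for the sign in the
  -- conclusion.
  have hbr : ∀ X Y, VectorField.lieBracket ℝ (fun y => rightFrame E G y X)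
      (fun y => rightFrame E G y Y) o = -unitBracket E G X Y := fun X Y => by
    rw [VectorField.lieBracket, (hV X).fderiv, (hV Y).fderiv, unitBracket, ho]
    simp
  have key := extDeriv_two_form_vectorField hD.hasFDerivAt.differentiableAt
    (hV X).differentiableAt (hV Y).differentiableAt (hV Z).differentiableAt
  have hf : ∀ Y Z, fderiv ℝ (fun z => actionForm G η (unitParam E G z • x) ![Y, Z]) o =
      fderiv ℝ (fun y => p y ![rightFrame E G y Y, rightFrame E G y Z]) o := fun Y Z => by
    apply Filter.EventuallyEq.fderiv_eq
    filter_upwards [eventually_actionForm_smul (η := η) hs] with y hy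
    rw [hy, ContinuousAlternatingMap.compContinuousLinearMap_apply]
    congr 1
    ext i
    fin_cases i <;> rfl
  have hpo : p o = actionForm G η x := rfl
  rw [hcl, hbr, hbr, hbr, hpo, twoForm_neg_left, twoForm_neg_left, twoForm_neg_left] at key
  have hZX : fderiv ℝ (fun y => p y ![rightFrame E G y Z, rightFrame E G y X]) o =
      -fderiv ℝ (fun y => p y ![rightFrame E G y X, rightFrame E G y Z]) o := by
    rw [← fderiv_fun_neg]
    congr 1
    ext y
    exact twoForm_swap _ _ _
  have hbZX : actionForm G η x ![unitBracket E G Z X, Y] =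
      -actionForm G η x ![unitBracket E G X Z, Y] := by
    rw [← twoForm_neg_left, unitBracket, unitBracket, neg_sub]
  rw [hf, hf, hf, hZX, hbZX]
  simp only [ho, rightFrame_unitCoord, ContinuousLinearMap.id_apply, neg_apply,
    show (0 : E [⋀^Fin 3]→L[ℝ] ℝ) ![X, Y, Z] = 0 from rfl] at key ⊢
  linarith

end ActionForm

/-! ### Invariant means of derivatives on a cocompact quotient -/

section MeanOfDerivative

open Filter Topology

variable {E : Type*} [NormedAddCommGroup E] [NormedSpace ℝ E]
  {G : Type*} [TopologicalSpace G] [ChartedSpace E G] [Group G] [LieGroup 𝓘(ℝ, E) ∞ G]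
  {Γ : Subgroup G} {f : G → ℝ}

theorem exists_continuous_quotient_lift (hf : Continuous f) (hinv : ∀ γ ∈ Γ, ∀ g, f (g * γ) = f g) :
    ∃ F : G ⧸ Γ → ℝ, Continuous F ∧ ∀ g : G, F g = f g := by
  have h : ∀ a b : G, QuotientGroup.leftRel Γ a b → f a = f b := fun a b hab => by
    have := hinv _ (QuotientGroup.leftRel_apply.1 hab) a
    rwa [mul_inv_cancel_left, eq_comm] at this
  exact ⟨Quotient.lift f h, hf.quotient_lift h, fun g => rfl⟩

theorem isBddFun_of_cocompact [CompactSpace (G ⧸ Γ)] (hf : Continuous f)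
    (hinv : ∀ γ ∈ Γ, ∀ g, f (g * γ) = f g) : IsBddFun f := by
  obtain ⟨F, hF, hFf⟩ := exists_continuous_quotient_lift hf hinv
  obtain ⟨C, hC⟩ := isCompact_univ.exists_bound_of_continuousOn hF.continuousOn
  exact ⟨C, fun g => by simpa [hFf] using hC g trivial⟩

theorem exists_pos_le_of_cocompact [CompactSpace (G ⧸ Γ)] (hf : Continuous f)
    (hinv : ∀ γ ∈ Γ, ∀ g, f (g * γ) = f g) (hpos : ∀ g, 0 < f g) : ∃ δ > 0, ∀ g, δ ≤ f g := by
  obtain ⟨F, hF, hFf⟩ := exists_continuous_quotient_lift hf hinv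
  obtain ⟨q, -, hq⟩ := isCompact_univ.exists_isMinOn ⟨((1 : G) : G ⧸ Γ), trivial⟩ hF.continuousOn
  obtain ⟨g₀, rfl⟩ := QuotientGroup.mk_surjective q
  refine ⟨f g₀, hpos g₀, fun g => ?_⟩
  rw [← hFf, ← hFf]
  exact hq (Set.mem_univ (g : G ⧸ Γ))

theorem tendsto_unitChart_mul_inv (g : G) :
    Tendsto (fun h => chartAt E (1 : G) (h * g⁻¹)) (𝓝 g) (𝓝 (unitCoord E G)) := by
  have : IsTopologicalGroup G := topologicalGroup_of_lieGroup 𝓘(ℝ, E) ∞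
  have h1 : Tendsto (fun h => h * g⁻¹) (𝓝 g) (𝓝 1) := by
    have : ContinuousAt (fun h => h * g⁻¹) g := by fun_prop
    simpa [ContinuousAt] using this
  exact ((chartAt E (1 : G)).continuousAt (mem_chart_source E 1)).tendsto.comp h1

theorem eventually_unitParam_chart_mul (g : G) :
    ∀ᶠ h in 𝓝 g, unitParam E G (chartAt E (1 : G) (h * g⁻¹)) * g = h := by
  have : IsTopologicalGroup G := topologicalGroup_of_lieGroup 𝓘(ℝ, E) ∞
  have : ContinuousAt (fun h => h * g⁻¹) g := by fun_prop
  filter_upwards [this.eventually_mem (by simpa using source_mem_nhds (E := E))] with h hh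
  rw [unitParam_chart hh]; group

variable (hf : ∀ g, ∃ D : E →L[ℝ] ℝ, HasStrictFDerivAt (fun z => f (unitParam E G z * g)) D
  (unitCoord E G))

include hf

theorem continuous_of_hasStrictFDerivAt_unitParam_mul : Continuous f := by
  rw [continuous_iff_continuousAt]
  intro g
  obtain ⟨D, hD⟩ := hf g
  have h1 : Tendsto (fun z => f (unitParam E G z * g)) (𝓝 (unitCoord E G)) (𝓝 (f g)) := by
    simpa [ContinuousAt] using hD.continuousAt
  refine (h1.comp (tendsto_unitChart_mul_inv g)).congr' ?_
  filter_upwards [eventually_unitParam_chart_mul (E := E) g] with h hh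
  rw [Function.comp_apply, hh]

/-- Strict differentiability at `g₀` bounds the difference quotients at all nearby `g` against the
single derivative `A` at `g₀`, with half of `ε`. Letting the step tend to zero puts the derivative
at `g` itself within the other half of `A`. -/
theorem eventually_rightDeriv_estimate (X : E) {ε : ℝ} (hε : 0 < ε) (g₀ : G) :
    ∀ᶠ p : ℝ × G in 𝓝 (0, g₀), |f (unitParam E G (unitCoord E G + p.1 • X) * p.2) - f p.2 -
      p.1 * fderiv ℝ (fun z => f (unitParam E G z * p.2)) (unitCoord E G) X| ≤ ε * |p.1| := by
  have : IsTopologicalGroup G := topologicalGroup_of_lieGroup 𝓘(ℝ, E) ∞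
  set o := unitCoord E G with ho
  obtain ⟨A, hA⟩ := hf g₀
  have hmul : localMul E G (o, o) = o := localMul_unitCoord_left unitCoord_mem
  have hloc : HasStrictFDerivAt (localMul E G) (ContinuousLinearMap.fst ℝ E E +
      ContinuousLinearMap.snd ℝ E E) (o, o) := by
    have := (localMul_contDiffAt_left (E := E) (G := G) unitCoord_mem).hasStrictFDerivAt (by simp)
    rwa [hasFDerivAt_localMul.fderiv] at this
  have hψ := HasStrictFDerivAt.comp (g := fun z => f (unitParam E G z * g₀)) (o, o)
    (by rw [hmul]; exact hA) hloc
  obtain ⟨c, hc, hcX⟩ : ∃ c > 0, c * ‖X‖ ≤ ε / 2 := by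
    refine ⟨ε / 2 / (‖X‖ + 1), by positivity, ?_⟩
    rw [div_mul_eq_mul_div, div_le_iff₀ (by positivity)]
    nlinarith [norm_nonneg X]
  have hlim : Tendsto (fun p : ℝ × G => (((o + p.1 • X, chartAt E (1 : G) (p.2 * g₀⁻¹)) : E × E),
      ((o, chartAt E (1 : G) (p.2 * g₀⁻¹)) : E × E))) (𝓝 (0, g₀)) (𝓝 ((o, o), (o, o))) := by
    have h1 : Tendsto (fun p : ℝ × G => o + p.1 • X) (𝓝 (0, g₀)) (𝓝 o) := by
      have : Continuous fun p : ℝ × G => o + p.1 • X := by fun_prop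
      simpa using this.tendsto (0, g₀)
    have h2 : Tendsto (fun p : ℝ × G => chartAt E (1 : G) (p.2 * g₀⁻¹)) (𝓝 (0, g₀)) (𝓝 o) :=
      (tendsto_unitChart_mul_inv g₀).comp (continuous_snd.tendsto (0, g₀))
    exact (h1.prodMk_nhds h2).prodMk_nhds (tendsto_const_nhds.prodMk_nhds h2)
  have hsrc : ∀ᶠ q : E × E in 𝓝 (o, o),
      unitParam E G q.1 * unitParam E G q.2 ∈ (chartAt E (1 : G)).source := by
    have hc1 : ContinuousAt (fun q : E × E => unitParam E G q.1) (o, o) :=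
      ContinuousAt.comp (g := unitParam E G) (continuousAt_unitParam unitCoord_mem) continuousAt_fst
    have hc2 : ContinuousAt (fun q : E × E => unitParam E G q.2) (o, o) :=
      ContinuousAt.comp (g := unitParam E G) (continuousAt_unitParam unitCoord_mem) continuousAt_snd
    refine (hc1.mul hc2).eventually_mem ?_
    simpa [ho] using source_mem_nhds (E := E) (G := G)
  have key : ∀ᶠ p : ℝ × G in 𝓝 (0, g₀), |f (unitParam E G (o + p.1 • X) * p.2) - f p.2 -
      p.1 * A X| ≤ ε / 2 * |p.1| := by
    filter_upwards [hlim.eventually (hψ.isLittleO.def hc),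
      (continuous_snd.tendsto ((0 : ℝ), g₀)).eventually (eventually_unitParam_chart_mul (E := E) g₀),
      ((continuous_fst.tendsto ((o, o), (o, o))).comp hlim).eventually hsrc,
      ((continuous_snd.tendsto ((o, o), (o, o))).comp hlim).eventually hsrc] with p h1 h2 h3 h4
    simp only [Function.comp_apply] at h1 h3 h4
    have e1 : f (unitParam E G (localMul E G (o + p.1 • X, chartAt E (1 : G) (p.2 * g₀⁻¹))) * g₀) =
        f (unitParam E G (o + p.1 • X) * p.2) := by
      rw [localMul, unitParam_chart h3, mul_assoc, h2]
    have e2 : f (unitParam E G (localMul E G (o, chartAt E (1 : G) (p.2 * g₀⁻¹))) * g₀) = f p.2 := by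
      rw [localMul, unitParam_chart h4, mul_assoc, h2, ho, unitParam_unitCoord, one_mul]
    rw [e1, e2] at h1
    simp only [Prod.mk_sub_mk, add_sub_cancel_left, sub_self, ContinuousLinearMap.comp_apply,
      add_apply, ContinuousLinearMap.coe_fst', ContinuousLinearMap.coe_snd', add_zero, map_smul,
      smul_eq_mul, Prod.norm_mk, norm_zero, Real.norm_eq_abs, norm_smul] at h1
    rw [max_eq_left (by positivity)] at h1
    calc _ ≤ _ := h1
      _ = c * ‖X‖ * |p.1| := by ring
      _ ≤ _ := by gcongr
  have hD : ∀ᶠ g in 𝓝 g₀, |fderiv ℝ (fun z => f (unitParam E G z * g)) o X - A X| ≤ ε / 2 := by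
    have h1 := ((continuous_swap.tendsto (g₀, (0 : ℝ))).eventually key).curry_nhds
    filter_upwards [h1] with g hg
    obtain ⟨D, hD⟩ := hf g
    have hline : HasDerivAt (fun t : ℝ => o + t • X) X 0 := by
      simpa using ((hasDerivAt_id (0 : ℝ)).smul_const X).const_add o
    have hder : HasDerivAt (fun t : ℝ => f (unitParam E G (o + t • X) * g)) (D X) 0 := by
      have := hD.hasFDerivAt
      rw [show o = o + (0 : ℝ) • X by simp] at this
      exact this.comp_hasDerivAt (0 : ℝ) hline
    have h2 := (hder.sub ((hasDerivAt_id (0 : ℝ)).mul_const (A X))).le_of_lip' (C := ε / 2)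
      (by positivity) (by
        filter_upwards [hg] with t ht
        simpa [ho, sub_right_comm] using ht)
    rw [hD.hasFDerivAt.fderiv]
    simpa using h2
  filter_upwards [key, (continuous_snd.tendsto ((0 : ℝ), g₀)).eventually hD] with p h1 h2
  have e : f (unitParam E G (o + p.1 • X) * p.2) - f p.2 -
      p.1 * fderiv ℝ (fun z => f (unitParam E G z * p.2)) o X =
      (f (unitParam E G (o + p.1 • X) * p.2) - f p.2 - p.1 * A X) -
        p.1 * (fderiv ℝ (fun z => f (unitParam E G z * p.2)) o X - A X) := by ring
  rw [e]
  refine (abs_sub _ _).trans ?_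
  rw [abs_mul]
  nlinarith [abs_nonneg p.1]

/-- An invariant mean vanishes on derivatives along right invariant vector fields. -/
theorem IsInvariantMean.map_rightDeriv_eq_zero {M : (G → ℝ) →ₗ[ℝ] ℝ} (hM : IsInvariantMean M)
    [CompactSpace (G ⧸ Γ)] (hinv : ∀ γ ∈ Γ, ∀ g, f (g * γ) = f g) (X : E) :
    M (fun g => fderiv ℝ (fun z => f (unitParam E G z * g)) (unitCoord E G) X) = 0 := by
  have : IsTopologicalGroup G := topologicalGroup_of_lieGroup 𝓘(ℝ, E) ∞
  set o := unitCoord E G with ho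
  -- In the mean of this error the first two terms cancel by left invariance, leaving `-t` times the
  -- mean of the derivative.
  let e : ℝ → G → ℝ := fun t g => f (unitParam E G (o + t • X) * g) - f g -
    t * fderiv ℝ (fun z => f (unitParam E G z * g)) o X
  have hcont := continuous_of_hasStrictFDerivAt_unitParam_mul hf
  have hbdd := isBddFun_of_cocompact hcont hinv
  have heinv : ∀ t, ∀ γ ∈ Γ, ∀ g, e t (g * γ) = e t g := fun t γ hγ g => by
    simp only [e, ← mul_assoc, hinv γ hγ]
  have key : ∀ ε > 0, |M (fun g => fderiv ℝ (fun z => f (unitParam E G z * g)) o X)| ≤ ε := by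
    intro ε hε
    -- The error descends to the compact quotient, so the local estimates hold there for one common
    -- range of `t`.
    have h1 : ∀ᶠ t in 𝓝 (0 : ℝ), ∀ q ∈ (Set.univ : Set (G ⧸ Γ)), ∀ g : G, (g : G ⧸ Γ) = q →
        |e t g| ≤ ε * |t| := by
      refine isCompact_univ.eventually_forall_of_forall_eventually fun q _ => ?_
      obtain ⟨g₀, rfl⟩ := QuotientGroup.mk_surjective q
      have hopen : IsOpenMap (Prod.map id (QuotientGroup.mk : G → G ⧸ Γ) : ℝ × G → ℝ × (G ⧸ Γ)) :=
        IsOpenMap.id.prodMap QuotientGroup.isOpenMap_coe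
      refine hopen.nhds_le (0, g₀) (eventually_map.2 ?_)
      filter_upwards [eventually_rightDeriv_estimate hf X hε g₀] with p hp g hg
      have hγ := QuotientGroup.eq.1 hg.symm
      have := heinv p.1 _ hγ p.2
      rw [mul_inv_cancel_left] at this
      rw [Prod.map_fst, id, this]
      exact hp
    obtain ⟨t, ht, ht0⟩ := ((h1.filter_mono nhdsWithin_le_nhds).and
      (self_mem_nhdsWithin : {0}ᶜ ∈ 𝓝[≠] (0 : ℝ))).exists
    have h2 : M (e t) = -(t * M (fun g => fderiv ℝ (fun z => f (unitParam E G z * g)) o X)) := by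
      have : e t = (fun g => f (unitParam E G (o + t • X) * g)) - f -
        t • (fun g => fderiv ℝ (fun z => f (unitParam E G z * g)) o X) := rfl
      rw [this, map_sub, map_sub, hM.invariant _ _ hbdd, map_smul, sub_self, zero_sub, smul_eq_mul]
    have h3 := hM.abs_le (f := e t) (c := ε * |t|) fun g => ht _ trivial g rfl
    rw [h2, abs_neg, abs_mul, mul_comm] at h3
    exact le_of_mul_le_mul_right h3 (abs_pos.2 ht0)
  by_contra hne
  have := key _ (half_pos (abs_pos.2 hne))
  linarith [abs_pos.2 hne]

end MeanOfDerivative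

/-! ### The action of the group on the quotient manifold -/

section QuotientAction

open Filter Topology

variable {E : Type*} [NormedAddCommGroup E] [NormedSpace ℂ E]
  {G : Type*} [TopologicalSpace G] [ChartedSpace E G] [Group G] [LieGroup 𝓘(ℂ, E) ω G]
  [LieGroup 𝓘(ℝ, E) ∞ G] {Γ : Subgroup G} (hΓ : IsDiscrete (Γ : Set G))

theorem contMDiff_quotientMk : letI : ChartedSpace E (G ⧸ Γ) := quotientChartedSpace hΓ
    ContMDiff 𝓘(ℝ, E) 𝓘(ℝ, E) ∞ (QuotientGroup.mk : G → G ⧸ Γ) := by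
  let : ChartedSpace E (G ⧸ Γ) := quotientChartedSpace hΓ
  intro g
  refine contMDiffAt_iff_target.2 ⟨QuotientGroup.continuous_mk.continuousAt, ?_⟩
  obtain ⟨γ, -, hγ⟩ := exists_eventually_quotient_chartAt_mk hΓ (q := (g : G ⧸ Γ)) (g := g)
    (mem_chart_source E _)
  have h1 : ContMDiffAt 𝓘(ℝ, E) 𝓘(ℝ, E) ∞
      (fun h => chartAt E (quotientLift (g : G ⧸ Γ)) (h * γ)) g :=
    ContMDiffAt.comp (g := chartAt E (quotientLift (g : G ⧸ Γ))) g
      (contMDiffOn_chart.contMDiffAt ((chartAt E _).open_source.mem_nhds hγ.self_of_nhds.2))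
      contMDiff_mul_right.contMDiffAt
  refine h1.congr_of_eventuallyEq ?_
  filter_upwards [hγ] with h hh
  rw [← hh.1]
  simp

theorem contMDiffAt_unitParam_smul (x : G ⧸ Γ) {z : E} (hz : z ∈ (chartAt E (1 : G)).target) :
    letI : ChartedSpace E (G ⧸ Γ) := quotientChartedSpace hΓ
    ContMDiffAt 𝓘(ℝ, E) 𝓘(ℝ, E) ∞ (fun z => unitParam E G z • x) z := by
  let : ChartedSpace E (G ⧸ Γ) := quotientChartedSpace hΓ
  obtain ⟨g, rfl⟩ := QuotientGroup.mk_surjective x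
  exact (contMDiff_quotientMk hΓ).contMDiffAt.comp z (contMDiffAt_unitParam_mul g hz)

theorem exists_eventually_chartAt_unitParam_smul (x : G ⧸ Γ) :
    letI : ChartedSpace E (G ⧸ Γ) := quotientChartedSpace hΓ
    ∃ a k : G, k ∈ (chartAt E a).source ∧ ∀ᶠ z in 𝓝 (unitCoord E G),
      chartAt E x (unitParam E G z • x) = chartAt E a (unitParam E G z * k) := by
  let : ChartedSpace E (G ⧸ Γ) := quotientChartedSpace hΓ
  obtain ⟨g, rfl⟩ := QuotientGroup.mk_surjective x
  obtain ⟨γ, -, hγ⟩ := exists_eventually_quotient_chartAt_mk hΓ (q := (g : G ⧸ Γ)) (g := g)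
    (mem_chart_source E _)
  refine ⟨quotientLift (g : G ⧸ Γ), g * γ, hγ.self_of_nhds.2, ?_⟩
  have h1 : Tendsto (fun z => unitParam E G z * g) (𝓝 (unitCoord E G)) (𝓝 g) := by
    simpa [ContinuousAt] using (contMDiffAt_unitParam_mul (E := E) g unitCoord_mem).continuousAt
  filter_upwards [h1.eventually hγ] with z hz
  rw [← mul_assoc, ← hz.1]
  rfl

/-- The differential of the orbit map of the action on the quotient is a complex linear
injection. -/
theorem fderiv_chartAt_unitParam_smul (x : G ⧸ Γ) :
    letI : ChartedSpace E (G ⧸ Γ) := quotientChartedSpace hΓ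
    (∀ v : E, fderiv ℝ (fun z => chartAt E x (unitParam E G z • x)) (unitCoord E G) (Complex.I • v) =
      Complex.I • fderiv ℝ (fun z => chartAt E x (unitParam E G z • x)) (unitCoord E G) v) ∧
    ∀ v : E, fderiv ℝ (fun z => chartAt E x (unitParam E G z • x)) (unitCoord E G) v = 0 → v = 0 := by
  let : ChartedSpace E (G ⧸ Γ) := quotientChartedSpace hΓ
  obtain ⟨a, k, hk, hev⟩ := exists_eventually_chartAt_unitParam_smul (E := E) hΓ x
  have hk' : unitParam E G (unitCoord E G) * k ∈ (chartAt E a).source := by simpa using hk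
  have hholo : DifferentiableAt ℂ (fun z => chartAt E a (unitParam E G z * k)) (unitCoord E G) :=
    holo_chart_comp a ((holo_unitParam unitCoord_mem).mul contMDiffAt_const) hk'
  have e : fderiv ℝ (fun z => chartAt E x (unitParam E G z • x)) (unitCoord E G) =
      fderiv ℝ (fun z => chartAt E a (unitParam E G z * k)) (unitCoord E G) :=
    Filter.EventuallyEq.fderiv_eq hev
  rw [e]
  refine ⟨fun v => fderiv_real_smul hholo _ v, fun v hv => ?_⟩
  set y := chartAt E a (unitParam E G (unitCoord E G) * k) with hy
  have hyt : y ∈ (chartAt E a).target := (chartAt E a).map_source hk'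
  -- Right translation by `k⁻¹` undoes the orbit map, giving a left inverse of its differential.
  have hθ : DifferentiableAt ℂ (fun u => chartAt E (1 : G) ((chartAt E a).symm u * k⁻¹)) y := by
    refine holo_chart_comp (1 : G) ((contMDiffOn_chart_symm.contMDiffAt
      ((chartAt E a).open_target.mem_nhds hyt)).mul contMDiffAt_const) ?_
    rw [hy, (chartAt E a).left_inv hk']
    simp
  have hcomp := (hθ.restrictScalars ℝ).hasFDerivAt.comp (unitCoord E G)
    (hholo.restrictScalars ℝ).hasFDerivAt
  have hid : HasFDerivAt ((fun u => chartAt E (1 : G) ((chartAt E a).symm u * k⁻¹)) ∘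
      fun z => chartAt E a (unitParam E G z * k)) (.id ℝ E) (unitCoord E G) := by
    refine (hasFDerivAt_id _).congr_of_eventuallyEq ?_
    filter_upwards [(contMDiffAt_unitParam_mul (E := E) k unitCoord_mem).continuousAt.eventually_mem
      ((chartAt E a).open_source.mem_nhds hk'), target_mem_nhds (E := E) (G := G)] with z h1 h2
    rw [Function.comp_apply, (chartAt E a).left_inv h1, mul_inv_cancel_right, chart_unitParam h2]
    rfl
  have := DFunLike.congr_fun (hcomp.unique hid) v
  rw [ContinuousLinearMap.comp_apply, hv, map_zero] at this
  exact this.symm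

end QuotientAction

/-! ### Averaging a local Kähler form -/

section LocallyKahler

open Filter Topology

variable {E : Type*} [NormedAddCommGroup E] [NormedSpace ℂ E] [FiniteDimensional ℂ E]
  {G : Type*} [TopologicalSpace G] [ChartedSpace E G] [Group G] [LieGroup 𝓘(ℂ, E) ω G]
  {E₀ : Type*} [NormedAddCommGroup E₀] [NormedSpace ℝ E₀] [FiniteDimensional ℝ E₀]
  {G₀ : Type*} [TopologicalSpace G₀] [ChartedSpace E₀ G₀] [Group G₀] [LieGroup 𝓘(ℝ, E₀) ∞ G₀]
  [LieGroup 𝓘(ℝ, E) ∞ G]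

theorem hasAbelianSplitting_of_isLocallyKahlerCRS {ι : G₀ →* G} {Γ : Subgroup G}
    (h : IsCRSolvmanifold E₀ E ι Γ) (hnil : Group.IsNilpotent G)
    (hK : IsLocallyKahlerCRS E ι h.discrete) : HasAbelianSplitting E₀ E ι := by
  let : ChartedSpace E (G ⧸ Γ) := quotientChartedSpace h.discrete
  have : IsManifold 𝓘(ℂ, E) ω (G ⧸ Γ) := quotient_isManifold h.discrete
  have := h.cocompact
  obtain ⟨U, hU, hUι, η, hη⟩ := hK
  have : Group.IsNilpotent G₀ := 
    Subgroup.isNilpotent_of_ker_le_center ι (by simp [(MonoidHom.ker_eq_bot_iff ι).2 h.injective])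
  obtain ⟨M, hM⟩ := exists_isInvariantMean_of_isNilpotent G₀
  let x : G₀ → G ⧸ Γ := fun g => QuotientGroup.mk (ι g)
  have hx : ∀ g, x g ∈ U := fun g => hUι ⟨g, rfl⟩
  let L := GroupLieAlgebra 𝓘(ℝ, E₀) G₀
  let T : L →ₗ[ℝ] E := lieDeriv E ι
  -- These are the functions to be averaged. They depend on `g` only through its image in the
  -- compact space `Y`.
  let f : L → L → G₀ → ℝ := fun Y Z g => actionForm G η (x g) ![T Y, T Z]
  have hs : ∀ q : G ⧸ Γ, ∀ᶠ z in 𝓝 (unitCoord E G),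
      ContMDiffAt 𝓘(ℝ, E) 𝓘(ℝ, E) ∞ (fun z => unitParam E G z • q) z := fun q => by
    filter_upwards [target_mem_nhds (E := E) (G := G)] with z hz using
      contMDiffAt_unitParam_smul h.discrete q hz
  have hinv : ∀ Y Z, ∀ γ ∈ Γ.comap ι, ∀ g, f Y Z (g * γ) = f Y Z g := by
    intro Y Z γ hγ g
    have : x (g * γ) = x g := by
      simp only [x, map_mul]
      exact (QuotientGroup.mk_mul_of_mem _ hγ)
    simp only [f, this]
  have hev : ∀ Y Z g, (fun z => f Y Z (unitParam E₀ G₀ z * g)) =ᶠ[𝓝 (unitCoord E₀ G₀)]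
      fun z => actionForm G η (unitParam E G (localHom E E₀ ι z) • x g) ![T Y, T Z] := by
    intro Y Z g
    filter_upwards [eventually_unitParam_localHom (E := E) h.smooth] with z hz
    have : x (unitParam E₀ G₀ z * g) = unitParam E G (localHom E E₀ ι z) • x g := by
      simp only [x, map_mul, hz]
      rfl
    simp only [f, this]
  have hder : ∀ Y Z g, ∃ D : E₀ →L[ℝ] ℝ,
      HasStrictFDerivAt (fun z => f Y Z (unitParam E₀ G₀ z * g)) D (unitCoord E₀ G₀) ∧
      ∀ X : L, D X = fderiv ℝ (fun z => actionForm G η (unitParam E G z • x g) ![T Y, T Z])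
        (unitCoord E G) (T X) := by
    intro Y Z g
    obtain ⟨D, hD⟩ := hasStrictFDerivAt_actionForm (hs (x g)) hη hU (hx g) (T Y) (T Z)
    have hl : HasStrictFDerivAt (localHom E E₀ ι) (unitDeriv E E₀ ι) (unitCoord E₀ G₀) :=
      (contDiffAt_localHom h.smooth).hasStrictFDerivAt (by simp)
    refine ⟨D.comp (unitDeriv E E₀ ι), ?_, fun X => ?_⟩
    · exact (HasStrictFDerivAt.comp (g := fun z => actionForm G η (unitParam E G z • x g) ![T Y, T Z])
        (unitCoord E₀ G₀) (by rw [localHom_unitCoord]; exact hD) hl).congr_of_eventuallyEq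
          (hev Y Z g).symm
    · rw [hD.hasFDerivAt.fderiv]
      rfl
  have hder' : ∀ Y Z g, ∃ D : E₀ →L[ℝ] ℝ,
      HasStrictFDerivAt (fun z => f Y Z (unitParam E₀ G₀ z * g)) D (unitCoord E₀ G₀) :=
    fun Y Z g => (hder Y Z g).imp fun D hD => hD.1
  let R : L → (G₀ → ℝ) → G₀ → ℝ := fun X k g =>
    fderiv ℝ (fun z => k (unitParam E₀ G₀ z * g)) (unitCoord E₀ G₀) X
  have hR : ∀ X Y Z g, R X (f Y Z) g = fderiv ℝ (fun z => actionForm G η (unitParam E G z • x g)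
      ![T Y, T Z]) (unitCoord E G) (T X) := fun X Y Z g => by
    obtain ⟨D, hD1, hD2⟩ := hder Y Z g
    rw [← hD2, ← hD1.hasFDerivAt.fderiv]
  have hMR : ∀ X Y Z, M (R X (f Y Z)) = 0 := fun X Y Z =>
    hM.map_rightDeriv_eq_zero (hder' Y Z) (hinv Y Z) X
  have hadd : ∀ Y Y' Z, f (Y + Y') Z = f Y Z + f Y' Z := fun Y Y' Z => by
    ext g; simp only [f, map_add, twoForm_add_left, Pi.add_apply]
  have hsmul : ∀ (c : ℝ) Y Z, f (c • Y) Z = c • f Y Z := fun c Y Z => by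
    ext g; simp only [f, map_smul, twoForm_smul_left, Pi.smul_apply, smul_eq_mul]
  have hswap : ∀ Y Z, f Y Z = -f Z Y := fun Y Z => by
    ext g; exact twoForm_swap _ _ _
  let β : L →ₗ[ℝ] L →ₗ[ℝ] ℝ := LinearMap.mk₂ ℝ (fun Y Z => M (f Y Z))
    (fun Y Y' Z => by rw [hadd, map_add])
    (fun c Y Z => by rw [hsmul, map_smul])
    (fun Y Z Z' => by
      rw [hswap, hadd, neg_add, ← hswap, ← hswap, map_add])
    (fun c Y Z => by rw [hswap, hsmul, ← smul_neg, ← hswap, map_smul])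
  have hβ : ∀ Y Z, β Y Z = M (f Y Z) := fun Y Z => rfl
  refine hasAbelianSplitting_of_positive_cocycle h hnil (β := β) (fun X Y Z => ?_)
    (fun v v' hv hv0 => ?_)
  -- Closedness at every point of `Y`; the mean annihilates the left side and leaves the cocycle
  -- identity.
  · have key : R X (f Y Z) + R Y (f Z X) + R Z (f X Y) =
        -(f ⁅X, Y⁆ Z + f ⁅Y, Z⁆ X + f ⁅Z, X⁆ Y) := by
      ext g
      have hb : ∀ X Y : L, T ⁅X, Y⁆ = unitBracket E G (T X) (T Y) := lieDeriv_bracket h.smooth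
      simp only [Pi.add_apply, Pi.neg_apply, hR, f, hb]
      exact actionForm_cocycle (hs (x g)) hη hU (hx g) (T X) (T Y) (T Z)
    have h1 := congrArg M key
    rw [map_add, map_add, hMR, hMR, hMR, map_neg, map_add, map_add] at h1
    rw [hβ, hβ, hβ]
    linarith
  · have hTv : T v ≠ 0 := fun h0 => hv0 (h.lieDeriv_injective (h0.trans (map_zero T).symm))
    have hpos : ∀ g, 0 < f v v' g := by
      intro g
      obtain ⟨hI, hinj⟩ := fderiv_chartAt_unitParam_smul (E := E) h.discrete (x g)
      change 0 < actionForm G η (x g) ![T v, T v']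
      rw [actionForm_apply, show T v' = Complex.I • T v from hv, hI]
      exact hη.positive (x g) (hx g) _ fun h0 => hTv (hinj _ h0)
    have hcont := continuous_of_hasStrictFDerivAt_unitParam_mul (hder' v v')
    -- Pointwise positivity would only give a nonnegative mean; compactness supplies a uniform
    -- positive lower bound.
    obtain ⟨δ, hδ, hδf⟩ := exists_pos_le_of_cocompact hcont (hinv v v') hpos
    rw [hβ]
    exact hδ.trans_le (hM.ge_of_forall_ge (isBddFun_of_cocompact hcont (hinv v v')) hδf)

end LocallyKahler

end

theorem corollary2
    {E : Type*} [NormedAddCommGroup E] [NormedSpace ℂ E] [FiniteDimensional ℂ E]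
    {G : Type*} [TopologicalSpace G] [T2Space G] [ChartedSpace E G] [Group G]
    [LieGroup 𝓘(ℂ, E) ω G]
    {E₀ : Type*} [NormedAddCommGroup E₀] [NormedSpace ℝ E₀] [FiniteDimensional ℝ E₀]
    {G₀ : Type*} [TopologicalSpace G₀] [ChartedSpace E₀ G₀] [Group G₀]
    [LieGroup 𝓘(ℝ, E₀) ∞ G₀]
    (ι : G₀ →* G) (Γ : Subgroup G) (h : IsCRSolvmanifold E₀ E ι Γ)
    (hnil : Group.IsNilpotent G) :
    [IsLocallyKahlerCRS E ι h.discrete,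
      IsKahlerCRS E h.discrete,
      HasAbelianSplitting E₀ E ι].TFAE := by
  have := lieGroup_real (E := E) (G := G)
  tfae_have 1 → 3 := hasAbelianSplitting_of_isLocallyKahlerCRS h hnil
  tfae_have 3 → 2 := isKahlerCRS_of_hasAbelianSplitting h hnil
  tfae_have 2 → 1 := fun hK => ⟨Set.univ, isOpen_univ, Set.subset_univ _, hK⟩
  tfae_finish
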